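/- **Conventions.** Let $n\ge 1$ and fix $\beta>0$. Let $\Psi^0\in C_0^\infty([-\tfrac{4\pi}3,\tfrac{4\pi}3])$ be even with values in $[0,1]$ and $\Psi^0=1$ on $[-\tfrac{2\pi}3,\tfrac{2\pi}3]$, such that $\Omega(\xi)=(\Psi^0(\xi/2)^2-\Psi^0(\xi)^2)^{1/2}$ is smooth and $\Omega(\xi)^2+\Omega(2\pi-\xi)^2=1$ for $\xi\in[\tfrac{2\pi}3,\tfrac{4\pi}3]$; put $\Psi^1(\xi)=\Omega(\xi)e^{-i\xi/2}$. With $\hat f(\xi)=\int e^{-ix\cdot\xi}f(x)\,dx$, let $\hat\Phi^\varepsilon(\xi)=\prod_{i=1}^n\Psi^{\varepsilon_i}(\xi_i)$ for $\varepsilon\in\{0,1\}^n$, and $\Phi^\varepsilon_{j,k}(x)=2^{nj/2}\Phi^\varepsilon(2^jx-k)$ for $\varepsilon\in E_n=\{0,1\}^n\setminus\{0\}$, $j\in\mathbb Z$, $k\in\mathbb Z^n$ (the classical tensor product Meyer wavelets). Let $\chi$ be the indicator function of $[0,1)^n$ and $Q_{j,k}=2^{-j}(k+[0,1)^n)$;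 $Q_r$ denotes a dyadic cube of side length $r\in\{2^{-J}:J\in\mathbb Z\}$. Let $\mathscr S_\infty(\mathbb R^n)$ be the space of Schwartz functions with all moments zero (equivalently, with Fourier transform vanishing to infinite order at $0$) and $\mathscr S_\infty'(\mathbb R^n)$ its dual, i.e. tempered distributions modulo polynomials. The Riesz transform $R_l$, $1\le l\le n$, is the Fourier multiplier with symbol $-i\xi_l/|\xi|$ on $\mathscr S_\infty$, and acts on $\mathscr S'_\infty$ by $\langle R_lf,\varphi\rangle=-\langle f,R_l\varphi\rangle$. Let $1<p,q<\infty$, $\gamma_1,\gamma_2,m\in\mathbb R$ and $m'>0$. For a weakly measurable $a:(0,\infty)\to\mathscr S'_\infty(\mathbb R^n)$, put $a^\varepsilon_{j,k}(t)=\langle a(t,\cdot),\Phi^\varepsilon_{j,k}\rangle$ and $$\|a\|_{I}=\sup_{t>0}\sup_{Q_r}|Q_r|^{\frac{\gamma_2}n-\frac1p}\,t^m\Big\|\Big(\sum_{j\ge\max\{-\log_2r,-\frac{\log_2t}{2\beta}\}}\ \sum_{\varepsilon\in E_n,\,Q_{j,k}\subset Q_r}2^{qj(\gamma_1+\frac n2+2m\beta)}|a^\varepsilon_{j,k}(t)|^q\chi(2^jx-k)\Big)^{1/q}\Big\|_{L^p(dx)},$$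 $$\|a\|_{II}=\sup_{t>0}\sup_{Q_r}|Q_r|^{\frac{\gamma_2}n-\frac1p}\Big\|\Big(\sum_{-\log_2r<j<-\frac{\log_2t}{2\beta}}\ \sum_{\varepsilon\in E_n,\,Q_{j,k}\subset Q_r}2^{qj(\gamma_1+\frac n2)}|a^\varepsilon_{j,k}(t)|^q\chi(2^jx-k)\Big)^{1/q}\Big\|_{L^p(dx)},$$ $$\|a\|_{III}=\sup_{Q_r}|Q_r|^{\frac{\gamma_2}n-\frac1p}\Big\|\Big(\sum_{\varepsilon\in E_n,\,Q_{j,k}\subset Q_r}2^{qj(\gamma_1+\frac n2+2m\beta)}\int_{2^{-2j\beta}}^{r^{2\beta}}|a^\varepsilon_{j,k}(t)|^qt^{qm}\frac{dt}t\,\chi(2^jx-k)\Big)^{1/q}\Big\|_{L^p(dx)},$$ $$\|a\|_{IV}=\sup_{Q_r}|Q_r|^{\frac{\gamma_2}n-\frac1p}\Big\|\Big(\sum_{\varepsilon\in E_n,\,Q_{j,k}\subset Q_r}2^{qj(\gamma_1+\frac n2+2m'\beta)}\int_0^{2^{-2j\beta}}|a^\varepsilon_{j,k}(t)|^qt^{qm'}\frac{dt}t\,\chi(2^jx-k)\Big)^{1/q}\Big\|_{L^p(dx)}.$$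 The space $\mathbb F^{\gamma_1,\gamma_2}_{p,q,m,m'}$ consists of all such $a$ with $\|a\|_{\mathbb F^{\gamma_1,\gamma_2}_{p,q,m,m'}}:=\|a\|_I+\|a\|_{II}+\|a\|_{III}+\|a\|_{IV}<\infty$. **Theorem.** Let $1<p,q<\infty$, $\gamma_1,\gamma_2\in\mathbb R$, $m>p$ and $m'>0$. Then the Riesz transforms $R_1,\dots,R_n$, acting in the variable $x$ for each fixed $t$, are bounded on $\mathbb F^{\gamma_1,\gamma_2}_{p,q,m,m'}$: there is a finite constant $C$ (depending only on $n,p,q,\gamma_1,\gamma_2,m,m',\beta$ and $\Psi^0$) such that for every $1\le l\le n$ and every $a\in\mathbb F^{\gamma_1,\gamma_2}_{p,q,m,m'}$ one has $R_la\in\mathbb F^{\gamma_1,\gamma_2}_{p,q,m,m'}$ and $$\|R_la\|_{\mathbb F^{\gamma_1,\gamma_2}_{p,q,m,m'}}\le C\,\|a\|_{\mathbb F^{\gamma_1,\gamma_2}_{p,q,m,m'}}.$$ -/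

import Mathlib

open scoped SchwartzMap FourierTransform ContDiff ENNReal NNReal

/-- Euclidean space `ℝⁿ`, with the Euclidean norm and Lebesgue measure. -/
abbrev RSpace (n : ℕ) : Type := EuclideanSpace ℝ (Fin n)

/-- Schwartz functions all of whose derivatives vanish at the origin. -/
noncomputable def flatAtZero (n : ℕ) : Submodule ℂ 𝓢(RSpace n, ℂ) where
  carrier := {u | ∀ N : ℕ, iteratedFDeriv ℝ N (u : RSpace n → ℂ) 0 = 0}
  add_mem' := by
    intro u v hu hv N
    have h : ((u + v : 𝓢(RSpace n, ℂ)) : RSpace n → ℂ) = (u : RSpace n → ℂ) + v := rfl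
    rw [h, iteratedFDeriv_add_apply (u.smooth N).contDiffAt (v.smooth N).contDiffAt, hu N, hv N,
      add_zero]
  zero_mem' := by
    intro N
    have h : ((0 : 𝓢(RSpace n, ℂ)) : RSpace n → ℂ) = fun _ => 0 := rfl
    rw [h]; simp
  smul_mem' := by
    intro c u hu N
    have h : ((c • u : 𝓢(RSpace n, ℂ)) : RSpace n → ℂ) = c • (u : RSpace n → ℂ) := rfl
    rw [h, iteratedFDeriv_const_smul_apply (u.smooth N).contDiffAt, hu N, smul_zero]

/-- The Fourier multiplier `-i ξ_l / |ξ|` of the `l`-th Riesz transform. It is homogeneous of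
degree `0`, hence independent of the normalisation of the Fourier transform. -/
noncomputable def rieszSymbol {n : ℕ} (l : Fin n) (ξ : RSpace n) : ℂ :=
  -Complex.I * ((ξ l / ‖ξ‖ : ℝ) : ℂ)

theorem rieszSymbol_contDiffAt {n : ℕ} (l : Fin n) {ξ : RSpace n} (hξ : ξ ≠ 0) :
    ContDiffAt ℝ ∞ (rieszSymbol l) ξ := by
  unfold rieszSymbol
  refine contDiffAt_const.mul (Complex.ofRealCLM.contDiff.contDiffAt.comp ξ ?_)
  refine ContDiffAt.div ?_ (contDiffAt_norm ℝ hξ) (norm_ne_zero_iff.2 hξ)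
  exact (EuclideanSpace.proj (𝕜 := ℝ) l).contDiff.contDiffAt

theorem rieszSymbol_smul {n : ℕ} (l : Fin n) {s : ℝ} (hs : 0 < s) (ξ : RSpace n) :
    rieszSymbol l (s • ξ) = rieszSymbol l ξ := by
  unfold rieszSymbol
  rw [norm_smul, Real.norm_of_nonneg hs.le, PiLp.smul_apply, smul_eq_mul,
    mul_div_mul_left _ _ hs.ne']

theorem rieszSymbol_bound {n : ℕ} (l : Fin n) (k : ℕ) : ∃ C : ℝ, 0 ≤ C ∧ ∀ ξ : RSpace n, ξ ≠ 0 →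
    ‖iteratedFDeriv ℝ k (rieszSymbol l) ξ‖ ≤ C * (‖ξ‖ ^ k)⁻¹ := by
  have hcont : ContinuousOn (iteratedFDeriv ℝ k (rieszSymbol l)) (Metric.sphere (0 : RSpace n) 1) := by
    intro ξ hξ
    have h0 : ξ ≠ 0 := by
      rintro rfl
      simp at hξ
    exact ((rieszSymbol_contDiffAt l h0).continuousAt_iteratedFDeriv
      (by exact_mod_cast le_top)).continuousWithinAt
  obtain ⟨C, hC⟩ := (isCompact_sphere (0 : RSpace n) 1).exists_bound_of_continuousOn hcont
  refine ⟨max C 0, le_max_right _ _, fun ξ hξ => ?_⟩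
  have hpos : 0 < ‖ξ‖ := norm_pos_iff.2 hξ
  have hinv : 0 < ‖ξ‖⁻¹ := inv_pos.2 hpos
  let g : RSpace n ≃L[ℝ] RSpace n := ContinuousLinearEquiv.smulLeft (Units.mk0 ‖ξ‖⁻¹ hinv.ne')
  have hg : ∀ x, g x = ‖ξ‖⁻¹ • x := fun x => rfl
  have hcomp : rieszSymbol l ∘ g = rieszSymbol l := by
    funext x
    exact rieszSymbol_smul l hinv x
  have key := g.iteratedFDerivWithin_comp_right (rieszSymbol l) uniqueDiffOn_univ
    (Set.mem_univ (g ξ)) k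
  rw [hcomp, Set.preimage_univ, iteratedFDerivWithin_univ] at key
  rw [key]
  refine (ContinuousMultilinearMap.norm_compContinuousLinearMap_le _ _).trans ?_
  have hgn : ‖(g : RSpace n →L[ℝ] RSpace n)‖ ≤ ‖ξ‖⁻¹ := by
    refine ContinuousLinearMap.opNorm_le_bound _ hinv.le fun x => ?_
    change ‖g x‖ ≤ _
    rw [hg, norm_smul, norm_inv, norm_norm]
  have hs : g ξ ∈ Metric.sphere (0 : RSpace n) 1 := by
    rw [mem_sphere_zero_iff_norm, hg, norm_smul, norm_inv, norm_norm, inv_mul_cancel₀ hpos.ne']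
  rw [Finset.prod_const, Finset.card_univ, Fintype.card_fin, ← inv_pow]
  gcongr
  exact (hC _ hs).trans (le_max_left _ _)

theorem flatAtZero_bound {n : ℕ} {u : 𝓢(RSpace n, ℂ)} (hu : u ∈ flatAtZero n) (N : ℕ) :
    ∀ (k : ℕ) (ξ : RSpace n),
      ‖iteratedFDeriv ℝ k (u : RSpace n → ℂ) ξ‖ ≤ ‖ξ‖ ^ N * SchwartzMap.seminorm ℂ 0 (k + N) u := by
  induction N with
  | zero =>
    intro k ξ
    simpa using SchwartzMap.le_seminorm ℂ 0 k u ξ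
  | succ N ih =>
    intro k ξ
    have hd : ∀ x ∈ segment ℝ (0 : RSpace n) ξ,
        DifferentiableAt ℝ (iteratedFDeriv ℝ k (u : RSpace n → ℂ)) x := fun x _ =>
      ((u.smooth ⊤).differentiable_iteratedFDeriv (by exact_mod_cast WithTop.coe_lt_top k)) x
    have hb : ∀ x ∈ segment ℝ (0 : RSpace n) ξ,
        ‖fderiv ℝ (iteratedFDeriv ℝ k (u : RSpace n → ℂ)) x‖ ≤
          ‖ξ‖ ^ N * SchwartzMap.seminorm ℂ 0 (k + (N + 1)) u := by
      intro x hx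
      rw [norm_fderiv_iteratedFDeriv]
      refine (ih (k + 1) x).trans ?_
      rw [show k + 1 + N = k + (N + 1) by ring]
      have : ‖x‖ ≤ ‖ξ‖ := by
        have := (convex_closedBall (0 : RSpace n) ‖ξ‖).segment_subset
          (by simp) (by simp) hx
        simpa using this
      gcongr
    have := (convex_segment (0 : RSpace n) ξ).norm_image_sub_le_of_norm_fderiv_le hd hb
      (left_mem_segment ℝ _ _) (right_mem_segment ℝ _ _)
    rw [hu k, sub_zero, sub_zero] at this
    calc _ ≤ _ := this
      _ = _ := by ring

theorem riesz_mul_leibniz {n : ℕ} (l : Fin n) (k : ℕ) : ∃ C : ℕ → ℝ, (∀ i, 0 ≤ C i) ∧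
    ∀ (u : 𝓢(RSpace n, ℂ)) (ξ : RSpace n), ξ ≠ 0 →
    ‖iteratedFDeriv ℝ k (fun x => rieszSymbol l x * u x) ξ‖ ≤
      ∑ i ∈ Finset.range (k + 1),
        C i * ((‖ξ‖ ^ i)⁻¹ * ‖iteratedFDeriv ℝ (k - i) (u : RSpace n → ℂ) ξ‖) := by
  choose B hB0 hB using fun i => rieszSymbol_bound l i
  refine ⟨fun i => (k.choose i : ℝ) * B i, fun i => mul_nonneg (by positivity) (hB0 i),
    fun u ξ hξ => ?_⟩
  have ho : IsOpen ({0}ᶜ : Set (RSpace n)) := isOpen_compl_singleton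
  have h := norm_iteratedFDerivWithin_mul_le (𝕜 := ℝ) (N := ∞) (n := k) (x := ξ)
    (s := ({0}ᶜ : Set (RSpace n))) (f := rieszSymbol l) (g := (u : RSpace n → ℂ))
    (fun x hx => (rieszSymbol_contDiffAt l hx).contDiffWithinAt)
    (u.smooth ⊤).contDiffOn ho.uniqueDiffOn hξ (by exact_mod_cast le_top)
  rw [iteratedFDerivWithin_of_isOpen k ho hξ] at h
  refine h.trans (Finset.sum_le_sum fun i _ => ?_)
  rw [iteratedFDerivWithin_of_isOpen i ho hξ, iteratedFDerivWithin_of_isOpen (k - i) ho hξ,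
    mul_assoc, mul_assoc]
  have := hB i ξ hξ
  rw [← mul_assoc (B i)]
  gcongr

theorem riesz_mul_small {n : ℕ} (l : Fin n) {u : 𝓢(RSpace n, ℂ)} (hu : u ∈ flatAtZero n) (k : ℕ) :
    ∃ K : ℝ, ∀ ξ : RSpace n, ξ ≠ 0 →
      ‖iteratedFDeriv ℝ k (fun x => rieszSymbol l x * u x) ξ‖ ≤ K * ‖ξ‖ ^ 2 := by
  obtain ⟨C, hC0, hC⟩ := riesz_mul_leibniz l k
  refine ⟨∑ i ∈ Finset.range (k + 1), C i * SchwartzMap.seminorm ℂ 0 (k - i + (i + 2)) u,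
    fun ξ hξ => (hC u ξ hξ).trans ?_⟩
  rw [Finset.sum_mul]
  refine Finset.sum_le_sum fun i _ => ?_
  have hpos : 0 < ‖ξ‖ := norm_pos_iff.2 hξ
  have h := flatAtZero_bound hu (i + 2) (k - i) ξ
  rw [mul_assoc]
  refine mul_le_mul_of_nonneg_left ?_ (hC0 i)
  rw [inv_mul_le_iff₀ (by positivity)]
  calc _ ≤ _ := h
    _ = _ := by ring

theorem riesz_mul_flat {n : ℕ} (l : Fin n) {u : 𝓢(RSpace n, ℂ)} (hu : u ∈ flatAtZero n) (k : ℕ) :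
    iteratedFDeriv ℝ k (fun x => rieszSymbol l x * u x) 0 = 0 ∧
      HasFDerivAt (iteratedFDeriv ℝ k (fun x => rieszSymbol l x * u x))
        (0 : RSpace n →L[ℝ] _) 0 := by
  have step : ∀ k, iteratedFDeriv ℝ k (fun x => rieszSymbol l x * u x) 0 = 0 →
      HasFDerivAt (iteratedFDeriv ℝ k (fun x => rieszSymbol l x * u x))
        (0 : RSpace n →L[ℝ] _) 0 := by
    intro k h0
    obtain ⟨K, hK⟩ := riesz_mul_small l hu k
    rw [hasFDerivAt_iff_isLittleO_nhds_zero]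
    simp only [zero_add, h0, sub_zero, zero_apply]
    refine Asymptotics.IsBigO.trans_isLittleO (g := fun ξ : RSpace n => ‖ξ‖ ^ 2) ?_ ?_
    · refine Asymptotics.IsBigO.of_bound K (Filter.Eventually.of_forall fun ξ => ?_)
      by_cases hξ : ξ = 0
      · simp [hξ, h0]
      · simpa using hK ξ hξ
    · exact Asymptotics.isLittleO_norm_pow_id one_lt_two
  have main : ∀ k, iteratedFDeriv ℝ k (fun x => rieszSymbol l x * u x) 0 = 0 := by
    intro k
    induction k with
    | zero =>
      have : u 0 = 0 := by
        have := hu 0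
        simpa using congrArg (fun T => T 0) this
      ext m
      simp [this]
    | succ k ih =>
      rw [iteratedFDeriv_succ_eq_comp_left, Function.comp_apply, (step k ih).fderiv]
      exact LinearIsometryEquiv.map_zero _
  exact ⟨main k, step k (main k)⟩

theorem riesz_mul_contDiff {n : ℕ} (l : Fin n) {u : 𝓢(RSpace n, ℂ)} (hu : u ∈ flatAtZero n) :
    ContDiff ℝ ∞ (fun x => rieszSymbol l x * u x) := by
  refine contDiff_of_differentiable_iteratedFDeriv (n := ⊤) fun k _ ξ => ?_
  by_cases hξ : ξ = 0
  · subst hξ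
    exact (riesz_mul_flat l hu k).2.differentiableAt
  · have : ContDiffAt ℝ ∞ (fun x => rieszSymbol l x * u x) ξ :=
      (rieszSymbol_contDiffAt l hξ).mul (u.smooth ⊤).contDiffAt
    exact this.differentiableAt_iteratedFDeriv (by exact_mod_cast WithTop.coe_lt_top k)

theorem riesz_mul_decay {n : ℕ} (l : Fin n) (a k : ℕ) : ∃ C : ℕ → ℝ, (∀ i, 0 ≤ C i) ∧
    ∀ u : 𝓢(RSpace n, ℂ), u ∈ flatAtZero n → ∀ ξ : RSpace n,
    ‖ξ‖ ^ a * ‖iteratedFDeriv ℝ k (fun x => rieszSymbol l x * u x) ξ‖ ≤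
      ∑ i ∈ Finset.range (k + 1), C i *
        (SchwartzMap.seminorm ℂ 0 k u + SchwartzMap.seminorm ℂ a (k - i) u) := by
  obtain ⟨C, hC0, hC⟩ := riesz_mul_leibniz l k
  refine ⟨C, hC0, fun u hu ξ => ?_⟩
  have hs : ∀ b c, 0 ≤ SchwartzMap.seminorm ℂ b c u := fun b c => apply_nonneg _ _
  by_cases hξ : ξ = 0
  · subst hξ
    rw [(riesz_mul_flat l hu k).1]
    refine le_trans (le_of_eq (mul_eq_zero_of_right _ norm_zero)) ?_
    exact Finset.sum_nonneg fun i _ => mul_nonneg (hC0 i) (add_nonneg (hs _ _) (hs _ _))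
  have hpos : 0 < ‖ξ‖ := norm_pos_iff.2 hξ
  refine (mul_le_mul_of_nonneg_left (hC u ξ hξ) (by positivity)).trans ?_
  rw [Finset.mul_sum]
  refine Finset.sum_le_sum fun i hi => ?_
  rw [mul_left_comm]
  refine mul_le_mul_of_nonneg_left ?_ (hC0 i)
  rcases le_total ‖ξ‖ 1 with h1 | h1
  · refine le_trans ?_ (le_add_of_nonneg_right (hs _ _))
    have h := flatAtZero_bound hu i (k - i) ξ
    rw [Nat.sub_add_cancel (Nat.lt_succ_iff.1 (Finset.mem_range.1 hi))] at h
    rw [← inv_mul_le_iff₀ (by positivity)] at h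
    exact (mul_le_of_le_one_left (by positivity) (pow_le_one₀ hpos.le h1)).trans h
  · refine le_trans ?_ (le_add_of_nonneg_left (hs _ _))
    refine le_trans ?_ (SchwartzMap.le_seminorm ℂ a (k - i) u ξ)
    refine mul_le_mul_of_nonneg_left ?_ (by positivity)
    exact mul_le_of_le_one_left (by positivity) (inv_le_one_of_one_le₀ (one_le_pow₀ h1))


/-- Multiplication by the symbol `-i ξ_l / |ξ|` on Schwartz functions that vanish to infinite
order at the origin. -/
noncomputable def rieszMulLin {n : ℕ} (l : Fin n) : flatAtZero n →ₗ[ℂ] flatAtZero n where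
  toFun u := ⟨
    { toFun := fun ξ => rieszSymbol l ξ * (u : 𝓢(RSpace n, ℂ)) ξ
      smooth' := riesz_mul_contDiff l u.2
      decay' := fun a k => by
        obtain ⟨C, _, hC⟩ := riesz_mul_decay l a k
        exact ⟨_, hC u u.2⟩ },
    fun N => (riesz_mul_flat l u.2 N).1⟩
  map_add' u v := by
    ext ξ
    exact mul_add _ _ _
  map_smul' c u := by
    ext ξ
    exact mul_left_comm _ _ _

theorem rieszMulLin_continuous {n : ℕ} (l : Fin n) : Continuous (rieszMulLin l) := by
  have hind : Topology.IsInducing (flatAtZero n).subtype := Topology.IsInducing.subtypeVal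
  refine hind.continuous_iff.2 ?_
  refine WithSeminorms.continuous_of_continuous_comp (schwartz_withSeminorms ℂ (RSpace n) ℂ)
    ((flatAtZero n).subtype ∘ₗ rieszMulLin l) ?_
  rintro ⟨a, k⟩
  obtain ⟨C, hC0, hC⟩ := riesz_mul_decay (n := n) l a k
  have hcont : ∀ b c : ℕ, Continuous
      fun u : flatAtZero n => SchwartzMap.seminorm ℂ b c (u : 𝓢(RSpace n, ℂ)) := fun b c =>
    ((schwartz_withSeminorms ℂ (RSpace n) ℂ).continuous_seminorm (b, c)).comp continuous_subtype_val
  let D : ℕ → ℝ≥0 := fun i => ⟨C i, hC0 i⟩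
  let q : Seminorm ℂ (flatAtZero n) := ∑ i ∈ Finset.range (k + 1), D i •
    ((SchwartzMap.seminorm ℂ 0 k + SchwartzMap.seminorm ℂ a (k - i)).comp (flatAtZero n).subtype)
  have hq : ∀ u : flatAtZero n, q u = ∑ i ∈ Finset.range (k + 1), C i *
      (SchwartzMap.seminorm ℂ 0 k (u : 𝓢(RSpace n, ℂ)) +
        SchwartzMap.seminorm ℂ a (k - i) (u : 𝓢(RSpace n, ℂ))) := by
    intro u
    have h := congrFun (map_sum (FunLike.coeAddMonoidHom (Seminorm ℂ (flatAtZero n)) (flatAtZero n) ℝ) (fun i => D i •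
      ((SchwartzMap.seminorm ℂ 0 k + SchwartzMap.seminorm ℂ a (k - i)).comp
        (flatAtZero n).subtype)) (Finset.range (k + 1))) u
    rw [Finset.sum_apply] at h
    exact h
  refine Seminorm.continuous_of_le (q := q) ?_ ?_
  · rw [show (⇑q) = _ from funext hq]
    exact continuous_finsetSum _ fun i _ => continuous_const.mul ((hcont _ _).add (hcont _ _))
  · intro u
    rw [hq]
    refine SchwartzMap.seminorm_le_bound ℂ a k _ ?_ (hC u u.2)
    exact Finset.sum_nonneg fun i _ => mul_nonneg (hC0 i)
      (add_nonneg (apply_nonneg _ _) (apply_nonneg _ _))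

/-- Multiplication by the symbol `-i ξ_l / |ξ|`, as a continuous operator. -/
noncomputable def rieszMul {n : ℕ} (l : Fin n) : flatAtZero n →L[ℂ] flatAtZero n :=
  ⟨rieszMulLin l, rieszMulLin_continuous l⟩

/-- The space `𝓢_∞(ℝⁿ)` of Schwartz functions whose Fourier transform vanishes to infinite order
at the origin, that is, of Schwartz functions with all moments equal to zero, with the topology
inherited from `𝓢(ℝⁿ)`. -/
noncomputable def lizorkin (n : ℕ) : Submodule ℂ 𝓢(RSpace n, ℂ) :=
  (flatAtZero n).comap (FourierTransform.fourierCLE ℂ 𝓢(RSpace n, ℂ)).toLinearMap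

theorem mem_lizorkin_iff {n : ℕ} (φ : 𝓢(RSpace n, ℂ)) : φ ∈ lizorkin n ↔
    ∀ N : ℕ, iteratedFDeriv ℝ N (𝓕 (φ : RSpace n → ℂ)) 0 = 0 :=
  Iff.rfl

/-- The Fourier transform on `𝓢_∞`. -/
noncomputable def lizorkinFourier (n : ℕ) : lizorkin n →L[ℂ] flatAtZero n :=
  ((FourierTransform.fourierCLE ℂ 𝓢(RSpace n, ℂ)).toContinuousLinearMap.comp
    (lizorkin n).subtypeL).codRestrict (flatAtZero n) fun φ => φ.2

/-- The inverse Fourier transform, with values in `𝓢_∞`. -/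
noncomputable def lizorkinFourierInv (n : ℕ) : flatAtZero n →L[ℂ] lizorkin n :=
  ((FourierTransform.fourierCLE ℂ 𝓢(RSpace n, ℂ)).symm.toContinuousLinearMap.comp
    (flatAtZero n).subtypeL).codRestrict (lizorkin n) fun u => by
      change 𝓕 (𝓕⁻ (u : 𝓢(RSpace n, ℂ))) ∈ flatAtZero n
      rw [FourierTransform.fourier_fourierInv_eq]
      exact u.2

/-- The `l`-th Riesz transform on the test space `𝓢_∞`, that is, `φ ↦ 𝓕⁻¹(-i ξ_l / |ξ| 𝓕φ)`. -/
noncomputable def rieszTest {n : ℕ} (l : Fin n) : lizorkin n →L[ℂ] lizorkin n :=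
  (lizorkinFourierInv n).comp ((rieszMul l).comp (lizorkinFourier n))

theorem fourier_rieszTest {n : ℕ} (l : Fin n) (φ : lizorkin n) (ξ : RSpace n) :
    𝓕 ((rieszTest l φ : 𝓢(RSpace n, ℂ)) : RSpace n → ℂ) ξ =
      -Complex.I * ((ξ l / ‖ξ‖ : ℝ) : ℂ) * 𝓕 ((φ : 𝓢(RSpace n, ℂ)) : RSpace n → ℂ) ξ := by
  change (𝓕 (𝓕⁻ ((rieszMul l (lizorkinFourier n φ) : flatAtZero n) : 𝓢(RSpace n, ℂ))) :
    𝓢(RSpace n, ℂ)) ξ = _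
  rw [FourierTransform.fourier_fourierInv_eq]
  rfl

/-- The topological dual `𝓢'_∞(ℝⁿ)` of `𝓢_∞(ℝⁿ)`: tempered distributions modulo polynomials. -/
abbrev LizorkinDist (n : ℕ) : Type := lizorkin n →L[ℂ] ℂ

/-- The `l`-th Riesz transform of a distribution `f ∈ 𝓢'_∞`, by duality:
`⟨R_l f, φ⟩ = -⟨f, R_l φ⟩` for the bilinear pairing (the symbol of `R_l` is odd, so that this
extends the Riesz transform of functions). -/
noncomputable def riesz {n : ℕ} (l : Fin n) (f : LizorkinDist n) : LizorkinDist n :=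
  -(f.comp (rieszTest l))

/-- The data of a classical Meyer wavelet: an even function `Ψ⁰ ∈ C_0^∞([-4π/3, 4π/3])` with values
in `[0, 1]`, equal to `1` on `[-2π/3, 2π/3]`, for which `Ω = (Ψ⁰(ξ/2)² - Ψ⁰(ξ)²)^{1/2}` is smooth
and satisfies `Ω(ξ)² + Ω(2π - ξ)² = 1` on `[2π/3, 4π/3]`. -/
structure MeyerProfile where
  /-- The function `Ψ⁰`. -/
  scale : ℝ → ℝ
  smooth : ContDiff ℝ ∞ scale
  even : ∀ ξ, scale (-ξ) = scale ξ
  mem_Icc : ∀ ξ, scale ξ ∈ Set.Icc (0 : ℝ) 1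
  support : ∀ ξ, 4 * Real.pi / 3 < |ξ| → scale ξ = 0
  eq_one : ∀ ξ, |ξ| ≤ 2 * Real.pi / 3 → scale ξ = 1
  smooth_detail : ContDiff ℝ ∞ fun ξ => √(scale (ξ / 2) ^ 2 - scale ξ ^ 2)
  detail_symm : ∀ ξ ∈ Set.Icc (2 * Real.pi / 3) (4 * Real.pi / 3),
    √(scale (ξ / 2) ^ 2 - scale ξ ^ 2) ^ 2 +
      √(scale ((2 * Real.pi - ξ) / 2) ^ 2 - scale (2 * Real.pi - ξ) ^ 2) ^ 2 = 1

namespace MeyerProfile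

/-- The function `Ω`. -/
noncomputable def detail (Ψ : MeyerProfile) (ξ : ℝ) : ℝ :=
  √(Ψ.scale (ξ / 2) ^ 2 - Ψ.scale ξ ^ 2)

/-- The functions `Ψ⁰` (for `e = 0`) and `Ψ¹(ξ) = Ω(ξ) e^{-iξ/2}` (for `e = 1`). -/
noncomputable def hat (Ψ : MeyerProfile) (e : Fin 2) (ξ : ℝ) : ℂ :=
  if e = 0 then (Ψ.scale ξ : ℂ) else (Ψ.detail ξ : ℂ) * Complex.exp (-(Complex.I * ξ / 2))

theorem hat_contDiff (Ψ : MeyerProfile) (e : Fin 2) : ContDiff ℝ ∞ (Ψ.hat e) := by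
  unfold hat
  split_ifs
  · exact Complex.ofRealCLM.contDiff.comp Ψ.smooth
  · refine (Complex.ofRealCLM.contDiff.comp Ψ.smooth_detail).mul (ContDiff.cexp ?_)
    have : ContDiff ℝ ∞ fun ξ : ℝ => (ξ : ℂ) := Complex.ofRealCLM.contDiff
    fun_prop

theorem hat_eq_zero (Ψ : MeyerProfile) (e : Fin 2) {ξ : ℝ} (hξ : 8 * Real.pi / 3 < |ξ|) :
    Ψ.hat e ξ = 0 := by
  have hpi := Real.pi_pos
  have h1 : Ψ.scale ξ = 0 := Ψ.support ξ (by linarith)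
  have h2 : Ψ.scale (ξ / 2) = 0 := Ψ.support _ (by
    rw [abs_div, abs_two]
    linarith)
  unfold hat detail
  simp [h1, h2]

theorem hat_one_eq_zero (Ψ : MeyerProfile) {e : Fin 2} (he : e ≠ 0) {ξ : ℝ}
    (hξ : |ξ| ≤ 2 * Real.pi / 3) : Ψ.hat e ξ = 0 := by
  have hpi := Real.pi_pos
  have h1 : Ψ.scale ξ = 1 := Ψ.eq_one ξ hξ
  have h2 : Ψ.scale (ξ / 2) = 1 := Ψ.eq_one _ (by
    rw [abs_div, abs_two]
    linarith [abs_nonneg ξ])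
  unfold hat detail
  simp [h1, h2, he]

/-- The function `∏ Ψ^{ε_i}(ξ_i)` at `ξ = 2πv`. Mathlib's Fourier transform at `v` is
`∫ e^{-2πi x·v} f(x) dx`, so it is the classical one, `∫ e^{-i x·ξ} f(x) dx`, at `ξ = 2πv`. -/
noncomputable def motherHat (Ψ : MeyerProfile) {n : ℕ} (ε : Fin n → Fin 2) (v : RSpace n) : ℂ :=
  ∏ i, Ψ.hat (ε i) (2 * Real.pi * v i)

theorem motherHat_contDiff (Ψ : MeyerProfile) {n : ℕ} (ε : Fin n → Fin 2) :
    ContDiff ℝ ∞ (Ψ.motherHat ε) := by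
  unfold motherHat
  refine contDiff_prod fun i _ => (Ψ.hat_contDiff (ε i)).comp (contDiff_const.mul ?_)
  exact (EuclideanSpace.proj (𝕜 := ℝ) i).contDiff

theorem motherHat_hasCompactSupport (Ψ : MeyerProfile) {n : ℕ} (ε : Fin n → Fin 2) :
    HasCompactSupport (Ψ.motherHat ε) := by
  have hK : IsCompact ((EuclideanSpace.equiv (Fin n) ℝ) ⁻¹'
      (Metric.closedBall (0 : Fin n → ℝ) (4 / 3))) :=
    (EuclideanSpace.equiv (Fin n) ℝ).toHomeomorph.isCompact_preimage.2 (isCompact_closedBall _ _)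
  refine HasCompactSupport.intro hK fun v hv => ?_
  have hpi := Real.pi_pos
  simp only [Set.mem_preimage, mem_closedBall_zero_iff] at hv
  rw [pi_norm_le_iff_of_nonneg (by norm_num)] at hv
  push Not at hv
  obtain ⟨i, hi⟩ := hv
  refine Finset.prod_eq_zero (Finset.mem_univ i) (Ψ.hat_eq_zero _ ?_)
  rw [abs_mul, abs_of_pos (by positivity)]
  have : 4 / 3 < |v i| := hi
  nlinarith

/-- The tensor product Meyer wavelet `Φ^ε`, with (classical) Fourier transform `∏ Ψ^{ε_i}(ξ_i)`. -/
noncomputable def mother (Ψ : MeyerProfile) {n : ℕ} (ε : Fin n → Fin 2) : 𝓢(RSpace n, ℂ) :=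
  𝓕⁻ ((Ψ.motherHat_hasCompactSupport ε).toSchwartzMap (Ψ.motherHat_contDiff ε))

theorem fourier_mother (Ψ : MeyerProfile) {n : ℕ} (ε : Fin n → Fin 2) (v : RSpace n) :
    𝓕 (Ψ.mother ε : RSpace n → ℂ) v = ∏ i, Ψ.hat (ε i) (2 * Real.pi * v i) := by
  change (𝓕 (Ψ.mother ε) : 𝓢(RSpace n, ℂ)) v = _
  unfold mother
  rw [FourierTransform.fourier_fourierInv_eq]
  rfl

end MeyerProfile

/-- An element of `ℤⁿ` as a point of `ℝⁿ`. -/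
noncomputable def latticePoint {n : ℕ} (k : Fin n → ℤ) : RSpace n :=
  WithLp.toLp 2 fun i => (k i : ℝ)

/-- The map `x ↦ 2^j x - k`. -/
noncomputable def zoom {n : ℕ} (j : ℤ) (k : Fin n → ℤ) (x : RSpace n) : RSpace n :=
  (2 : ℝ) ^ j • x - latticePoint k

theorem zoom_hasTemperateGrowth {n : ℕ} (j : ℤ) (k : Fin n → ℤ) :
    (zoom j k : RSpace n → RSpace n).HasTemperateGrowth := by
  unfold zoom
  fun_prop

theorem zoom_antilipschitz {n : ℕ} (j : ℤ) (k : Fin n → ℤ) :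
    AntilipschitzWith (((2 : ℝ≥0) ^ j)⁻¹) (zoom j k : RSpace n → RSpace n) := by
  refine AntilipschitzWith.of_le_mul_dist fun x y => ?_
  have h2 : (0 : ℝ) < 2 ^ j := by positivity
  simp only [zoom, dist_sub_right, dist_smul₀, NNReal.coe_inv, NNReal.coe_zpow, NNReal.coe_ofNat,
    Real.norm_of_nonneg h2.le]
  rw [inv_mul_cancel_left₀ h2.ne']

namespace MeyerProfile

/-- The wavelet `Φ^ε_{j,k}(x) = 2^{nj/2} Φ^ε(2^j x - k)` as a Schwartz function. -/
noncomputable def waveletFun (Ψ : MeyerProfile) {n : ℕ} (ε : Fin n → Fin 2) (j : ℤ)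
    (k : Fin n → ℤ) : 𝓢(RSpace n, ℂ) :=
  (((2 : ℝ) ^ ((n : ℝ) * j / 2) : ℝ) : ℂ) •
    SchwartzMap.compCLMOfAntilipschitz ℂ (zoom_hasTemperateGrowth j k) (zoom_antilipschitz j k)
      (Ψ.mother ε)

theorem waveletFun_apply (Ψ : MeyerProfile) {n : ℕ} (ε : Fin n → Fin 2) (j : ℤ)
    (k : Fin n → ℤ) (x : RSpace n) : Ψ.waveletFun ε j k x =
      (((2 : ℝ) ^ ((n : ℝ) * j / 2) : ℝ) : ℂ) * Ψ.mother ε ((2 : ℝ) ^ j • x - latticePoint k) :=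
  rfl

theorem waveletFun_mem (Ψ : MeyerProfile) {n : ℕ} {ε : Fin n → Fin 2} (hε : ε ≠ 0) (j : ℤ)
    (k : Fin n → ℤ) : Ψ.waveletFun ε j k ∈ lizorkin n := by
  obtain ⟨i, hi⟩ : ∃ i, ε i ≠ 0 := by
    by_contra h
    push Not at h
    exact hε (funext h)
  have hpi := Real.pi_pos
  have h2 : (0 : ℝ) < 2 ^ j := by positivity
  have hz : ∀ v : RSpace n, ‖v‖ ≤ 2 ^ j / 3 → 𝓕 (Ψ.waveletFun ε j k : RSpace n → ℂ) v = 0 := by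
    intro v hv
    set F : RSpace n → ℂ := fun y =>
      Real.fourierChar (-(inner ℝ (((2 : ℝ) ^ j)⁻¹ • (y + latticePoint k)) v)) •
        ((((2 : ℝ) ^ ((n : ℝ) * j / 2) : ℝ) : ℂ) * Ψ.mother ε y) with hF
    have e1 : 𝓕 (Ψ.waveletFun ε j k : RSpace n → ℂ) v =
        ∫ x : RSpace n, F ((2 : ℝ) ^ j • x - latticePoint k) := by
      rw [Real.fourier_eq]
      refine MeasureTheory.integral_congr_ae (Filter.Eventually.of_forall fun x => ?_)
      simp only [hF, sub_add_cancel, inv_smul_smul₀ h2.ne', waveletFun_apply]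
    have e2 : ∫ y : RSpace n, F (y - latticePoint k) = ∫ y : RSpace n, F y :=
      MeasureTheory.integral_sub_right_eq_self F _
    have e3 : ∀ y, F y =
        ((Real.fourierChar (-(inner ℝ (((2 : ℝ) ^ j)⁻¹ • latticePoint k) v)) : ℂ) *
          (((2 : ℝ) ^ ((n : ℝ) * j / 2) : ℝ) : ℂ)) *
        (Real.fourierChar (-(inner ℝ y (((2 : ℝ) ^ j)⁻¹ • v))) • Ψ.mother ε y) := by
      intro y
      simp only [hF, smul_add, inner_add_left, neg_add, AddChar.map_add_eq_mul, Circle.smul_def,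
        Circle.coe_mul, smul_eq_mul, inner_smul_left, inner_smul_right]
      simp only [conj_trivial]
      ring
    have e4 : ∫ y : RSpace n, Real.fourierChar (-(inner ℝ y (((2 : ℝ) ^ j)⁻¹ • v))) •
        Ψ.mother ε y = 0 := by
      rw [← Real.fourier_eq, fourier_mother]
      refine Finset.prod_eq_zero (Finset.mem_univ i) (Ψ.hat_one_eq_zero hi ?_)
      have hvi : |v i| ≤ 2 ^ j / 3 := (PiLp.norm_apply_le v i).trans hv
      rw [PiLp.smul_apply, smul_eq_mul, abs_mul, abs_mul _ (v i), abs_of_pos (inv_pos.2 h2),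
        abs_of_pos (by positivity : 0 < 2 * Real.pi)]
      have : ((2 : ℝ) ^ j)⁻¹ * |v i| ≤ 1 / 3 := by
        rw [inv_mul_le_iff₀ h2]
        linarith
      nlinarith
    rw [e1, MeasureTheory.Measure.integral_comp_smul MeasureTheory.volume
      (fun y => F (y - latticePoint k)), e2]
    simp only [e3]
    rw [MeasureTheory.integral_const_mul, e4, mul_zero, smul_zero]
  rw [mem_lizorkin_iff]
  intro N
  have hev : 𝓕 (Ψ.waveletFun ε j k : RSpace n → ℂ) =ᶠ[nhds 0] fun _ => 0 := by
    filter_upwards [Metric.ball_mem_nhds (0 : RSpace n) (by positivity : (0 : ℝ) < 2 ^ j / 3)]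
      with v hv
    exact hz v (by simpa using (mem_ball_zero_iff.1 hv).le)
  rw [(hev.iteratedFDeriv ℝ N).eq_of_nhds]
  simp

/-- The wavelet `Φ^ε_{j,k}`, for `ε ∈ {0,1}ⁿ \ {0}`, as an element of `𝓢_∞`. -/
noncomputable def wavelet (Ψ : MeyerProfile) {n : ℕ} (ε : {ε : Fin n → Fin 2 // ε ≠ 0}) (j : ℤ)
    (k : Fin n → ℤ) : lizorkin n :=
  ⟨Ψ.waveletFun ε.1 j k, Ψ.waveletFun_mem ε.2 j k⟩

end MeyerProfile

/-- The dyadic cube `Q_{j,k} = 2^{-j}(k + [0,1)ⁿ)`, that is, the set where `χ(2^j x - k) = 1`. -/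
def dyadicCube {n : ℕ} (j : ℤ) (k : Fin n → ℤ) : Set (RSpace n) :=
  {x | ∀ i, (2 : ℝ) ^ j * x i - k i ∈ Set.Ico (0 : ℝ) 1}

open Classical in
/-- For the dyadic cube `Q = Q_{J,K}`, of side length `r = 2^{-J}`, and a non-negative array `c`,
`|Q|^{γ₂/n - 1/p} ‖(∑_{ε} ∑_{Q_{j,k} ⊆ Q} c^ε_{j,k} χ(2^j x - k))^{1/q}‖_{L^p(dx)}`. -/
noncomputable def localNorm {n : ℕ} (p q γ₂ : ℝ) (J : ℤ) (K : Fin n → ℤ)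
    (c : {ε : Fin n → Fin 2 // ε ≠ 0} → ℤ → (Fin n → ℤ) → ℝ≥0∞) : ℝ≥0∞ :=
  ENNReal.ofReal (((2 : ℝ) ^ (-((n : ℝ) * J))) ^ (γ₂ / n - 1 / p)) *
    (∫⁻ x : RSpace n, ((∑' (ε : {ε : Fin n → Fin 2 // ε ≠ 0}) (j : ℤ) (k : Fin n → ℤ),
      if dyadicCube j k ⊆ dyadicCube J K then
        c ε j k * (dyadicCube j k).indicator (fun _ => 1) x
      else 0) ^ (1 / q)) ^ p) ^ (1 / p)

section TentSpace

variable {n : ℕ} (Ψ : MeyerProfile) (p q γ₁ γ₂ m m' β : ℝ)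

/-- The wavelet coefficient `a^ε_{j,k}(t) = ⟨a(t, ·), Φ^ε_{j,k}⟩`. -/
noncomputable def waveletCoeff (a : ℝ → LizorkinDist n) (ε : {ε : Fin n → Fin 2 // ε ≠ 0}) (j : ℤ)
    (k : Fin n → ℤ) (t : ℝ) : ℂ :=
  a t (Ψ.wavelet ε j k)

open Classical in
/-- The norm of `𝔽^{γ₁,γ₂,I}_{p,q,m}`: the supremum over all dyadic cubes `Q_r` and all `t > 0`, with
the sum restricted to `j ≥ max(-log₂ r, -log₂ t / (2β))`, where `-log₂ r = J`. -/
noncomputable def tentNormI (a : ℝ → LizorkinDist n) : ℝ≥0∞ :=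
  ⨆ (J : ℤ) (K : Fin n → ℤ) (t : ℝ) (_ : 0 < t),
    ENNReal.ofReal (t ^ m) * localNorm p q γ₂ J K fun ε j k =>
      if max (J : ℝ) (-(Real.logb 2 t / (2 * β))) ≤ j then
        ENNReal.ofReal ((2 : ℝ) ^ (q * j * (γ₁ + n / 2 + 2 * m * β))) *
          ‖waveletCoeff Ψ a ε j k t‖ₑ ^ q
      else 0

open Classical in
/-- The norm of `𝔽^{γ₁,γ₂,II}_{p,q}`: the supremum over all dyadic cubes `Q_r` and all `t > 0`, with
the sum restricted to `-log₂ r < j < -log₂ t / (2β)`. -/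
noncomputable def tentNormII (a : ℝ → LizorkinDist n) : ℝ≥0∞ :=
  ⨆ (J : ℤ) (K : Fin n → ℤ) (t : ℝ) (_ : 0 < t),
    localNorm p q γ₂ J K fun ε j k =>
      if J < j ∧ (j : ℝ) < -(Real.logb 2 t / (2 * β)) then
        ENNReal.ofReal ((2 : ℝ) ^ (q * j * (γ₁ + n / 2))) * ‖waveletCoeff Ψ a ε j k t‖ₑ ^ q
      else 0

/-- The norm of `𝔽^{γ₁,γ₂,III}_{p,q,m}`: the supremum over all dyadic cubes `Q_r`, with the integrals
`∫_{2^{-2jβ}}^{r^{2β}} |a^ε_{j,k}(t)|^q t^{qm} dt/t`. -/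
noncomputable def tentNormIII (a : ℝ → LizorkinDist n) : ℝ≥0∞ :=
  ⨆ (J : ℤ) (K : Fin n → ℤ), localNorm p q γ₂ J K fun ε j k =>
    ENNReal.ofReal ((2 : ℝ) ^ (q * j * (γ₁ + n / 2 + 2 * m * β))) *
      ∫⁻ t in Set.Ioc ((2 : ℝ) ^ (-(2 * j * β))) ((2 : ℝ) ^ (-(2 * J * β))),
        ‖waveletCoeff Ψ a ε j k t‖ₑ ^ q * ENNReal.ofReal (t ^ (q * m) / t)

/-- The norm of `𝔽^{γ₁,γ₂,IV}_{p,q,m'}`: the supremum over all dyadic cubes `Q_r`, with the integrals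
`∫_0^{2^{-2jβ}} |a^ε_{j,k}(t)|^q t^{qm'} dt/t`. -/
noncomputable def tentNormIV (a : ℝ → LizorkinDist n) : ℝ≥0∞ :=
  ⨆ (J : ℤ) (K : Fin n → ℤ), localNorm p q γ₂ J K fun ε j k =>
    ENNReal.ofReal ((2 : ℝ) ^ (q * j * (γ₁ + n / 2 + 2 * m' * β))) *
      ∫⁻ t in Set.Ioc (0 : ℝ) ((2 : ℝ) ^ (-(2 * j * β))),
        ‖waveletCoeff Ψ a ε j k t‖ₑ ^ q * ENNReal.ofReal (t ^ (q * m') / t)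

/-- The norm of the intersection `𝔽^{γ₁,γ₂}_{p,q,m,m'}` of the four spaces. -/
noncomputable def tentNorm (a : ℝ → LizorkinDist n) : ℝ≥0∞ :=
  tentNormI Ψ p q γ₁ γ₂ m β a + tentNormII Ψ p q γ₁ γ₂ β a +
    tentNormIII Ψ p q γ₁ γ₂ m β a + tentNormIV Ψ p q γ₁ γ₂ m' β a

/-- The space `𝔽^{γ₁,γ₂}_{p,q,m,m'}`. Its elements are the weakly measurable `a(t, ·) ∈ 𝓢'_∞(ℝⁿ)`,
`t > 0`, with finite norm; the values of `a` at `t ≤ 0` play no role. -/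
def tentSpace : Set (ℝ → LizorkinDist n) :=
  {a | (∀ φ : lizorkin n, Measurable fun t : Set.Ioi (0 : ℝ) => a t φ) ∧
    tentNorm Ψ p q γ₁ γ₂ m m' β a < ⊤}

end TentSpace

/-! For each fixed `t`, the wavelet coefficients of `R_l a` arise from those of `a` by an almost
diagonal matrix that does not depend on `t`, and such matrices are bounded for all the local
`L^p(ℓ^q)` norms involved.

The matrix: multiplication by the symbol preserves the frequency annulus of a wavelet, and the
symbol is smooth there. Hence `R_l Φ^ε_{j,k}` is a combination of wavelets of levels `j-1`, `j`,
`j+1` with rapidly decreasing coefficients. Since `R_l` commutes with translations and dilations,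
these coefficients depend on `k` only modulo 2. No completeness theorem for the Meyer basis is
invoked: the Meyer identities and Poisson summation turn the sum over one level into a difference of
consecutive projections, and three levels telescope to the identity on the annulus
(`exists_fourier_expansion`, `exists_rieszTest_expansion`). The series converges in `𝓢_∞`, so a
distribution may be applied term by term.

Boundedness: the matrix is cut into off-diagonals, each of which moves weights from source cubes to
target cubes of comparable size at a distance of about `‖k'‖` side lengths. By
`lintegral_tsum_indicator_rpow_le`, with `s = p/q`, such a move costs a factor polynomial in `‖k'‖`.
This does the work usually done by a vector-valued maximal inequality. Nestedness of the cubes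
linearises the power `s`, maximal functions over the two families are compared by the layer-cake
formula, and Hölder's inequality concludes. The source cubes that matter for `Q_{J,K}` lie in
polynomially many cubes of level `J-2`, and the rapid decay sums the off-diagonals
(`localNorm_le_of_almostDiagonal`).

The four norms: I and II, and likewise III and IV, are the two halves, cut at `t = 2^{-2βj}`, of a
single norm with the weight `levelWeight`. Weights of adjacent levels are comparable uniformly in
`t` (`levelWeight_le`), so crossing the cut by one level is harmless. -/

/-! ### Tangent-line inequalities for powers. -/

theorem ENNReal.rpow_le_rpow_of_nonpos {x y : ℝ≥0∞} {z : ℝ} (hz : z ≤ 0) (h : x ≤ y) :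
    y ^ z ≤ x ^ z := by
  rw [← neg_neg z, ENNReal.rpow_neg y, ENNReal.rpow_neg x]
  exact ENNReal.inv_le_inv.2 (ENNReal.rpow_le_rpow h (by linarith))

/-- Convexity: the tangent of `y ↦ y ^ s` at `x + c` lies below the graph at `x`. This is
Bernoulli's inequality for `x / (x + c) = 1 - c / (x + c)`. -/
theorem ENNReal.add_rpow_le_rpow_add_mul {s : ℝ} (hs : 1 ≤ s) (x c : ℝ≥0∞) :
    (x + c) ^ s ≤ x ^ s + ENNReal.ofReal s * (c * (x + c) ^ (s - 1)) := by
  have hs0 : 0 < s := by linarith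
  rcases eq_or_ne x ⊤ with rfl | hx
  · simp [hs0]
  rcases eq_or_ne c ⊤ with rfl | hc
  · rcases hs.eq_or_lt with rfl | h1
    · simp
    · have : (⊤ : ℝ≥0∞) ^ (s - 1) = ⊤ := ENNReal.top_rpow_of_pos (by linarith)
      simp [this, hs0, ENNReal.mul_top]
  lift x to ℝ≥0 using hx
  lift c to ℝ≥0 using hc
  rcases eq_or_ne (x + c) 0 with h0 | h0
  · have : (x : ℝ≥0∞) + c = 0 := by exact_mod_cast h0
    rw [this, ENNReal.zero_rpow_of_pos hs0]
    exact zero_le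
  have hy : (0 : ℝ) < x + c := by
    have : 0 < x + c := pos_iff_ne_zero.2 h0
    exact_mod_cast this
  have hB := one_add_mul_self_le_rpow_one_add (s := -(c / (x + c) : ℝ)) (p := s)
    (by rw [neg_le_neg_iff, div_le_one hy]; linarith [x.coe_nonneg]) hs
  have e1 : 1 + -(c / (x + c) : ℝ) = x / (x + c) := by field_simp; ring
  rw [e1, Real.div_rpow x.coe_nonneg hy.le, le_div_iff₀ (by positivity)] at hB
  have e2 : ((x : ℝ) + c) ^ s = (x + c) * ((x : ℝ) + c) ^ (s - 1) := by
    rw [Real.rpow_sub_one hy.ne']; field_simp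
  have key : ((x : ℝ) + c) ^ s ≤ x ^ s + s * (c * (x + c) ^ (s - 1)) := by
    have : (1 + s * -(c / (x + c) : ℝ)) * ((x : ℝ) + c) ^ s =
        ((x : ℝ) + c) ^ s - s * (c * (x + c) ^ (s - 1)) := by
      rw [e2]; field_simp; ring
    linarith
  have h3 := ENNReal.ofReal_le_ofReal key
  rw [ENNReal.ofReal_add (by positivity) (by positivity), ENNReal.ofReal_mul hs0.le,
    ENNReal.ofReal_mul c.coe_nonneg, ← ENNReal.ofReal_rpow_of_nonneg hy.le hs0.le,
    ← ENNReal.ofReal_rpow_of_nonneg x.coe_nonneg hs0.le,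
    ← ENNReal.ofReal_rpow_of_nonneg hy.le (by linarith),
    ENNReal.ofReal_add x.coe_nonneg c.coe_nonneg] at h3
  simpa using h3

/-- The concave counterpart, with the tangent at `x + c` above the graph. -/
theorem ENNReal.rpow_add_mul_le_add_rpow {s : ℝ} (hs0 : 0 < s) (hs : s ≤ 1) (x c : ℝ≥0∞) :
    x ^ s + ENNReal.ofReal s * (c * (x + c) ^ (s - 1)) ≤ (x + c) ^ s := by
  rcases eq_or_ne (x + c) ⊤ with h | hxc
  · simp [h, hs0]
  obtain ⟨hx, hc⟩ := ENNReal.add_ne_top.1 hxc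
  lift x to ℝ≥0 using hx
  lift c to ℝ≥0 using hc
  rcases eq_or_ne (x + c) 0 with h0 | h0
  -- The power `0 ^ (s - 1)` may be `⊤`, but it is multiplied by `c = 0`.
  · obtain ⟨rfl, rfl⟩ := add_eq_zero.1 h0
    simp [hs0]
  have hy : (0 : ℝ) < x + c := by
    have : 0 < x + c := pos_iff_ne_zero.2 h0
    exact_mod_cast this
  have hB := rpow_one_add_le_one_add_mul_self (s := -(c / (x + c) : ℝ)) (p := s)
    (by rw [neg_le_neg_iff, div_le_one hy]; linarith [x.coe_nonneg]) hs0.le hs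
  have e1 : 1 + -(c / (x + c) : ℝ) = x / (x + c) := by field_simp; ring
  rw [e1, Real.div_rpow x.coe_nonneg hy.le, div_le_iff₀ (by positivity)] at hB
  have e2 : ((x : ℝ) + c) ^ s = (x + c) * ((x : ℝ) + c) ^ (s - 1) := by
    rw [Real.rpow_sub_one hy.ne']; field_simp
  have key : x ^ s + s * (c * (x + c) ^ (s - 1)) ≤ ((x : ℝ) + c) ^ s := by
    have : (1 + s * -(c / (x + c) : ℝ)) * ((x : ℝ) + c) ^ s =
        ((x : ℝ) + c) ^ s - s * (c * (x + c) ^ (s - 1)) := by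
      rw [e2]; field_simp; ring
    linarith
  have h3 := ENNReal.ofReal_le_ofReal key
  have h0 : 0 < ENNReal.ofReal x + ENNReal.ofReal c := by
    rw [← ENNReal.ofReal_add x.coe_nonneg c.coe_nonneg]; simpa using hy
  rw [ENNReal.ofReal_add (by positivity) (by positivity), ENNReal.ofReal_mul hs0.le,
    ENNReal.ofReal_mul c.coe_nonneg, ← ENNReal.ofReal_rpow_of_nonneg hy.le hs0.le,
    ← ENNReal.ofReal_rpow_of_nonneg x.coe_nonneg hs0.le,
    ← ENNReal.ofReal_rpow_of_pos hy,
    ENNReal.ofReal_add x.coe_nonneg c.coe_nonneg] at h3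
  simpa using h3

/-! ### Powers of sums along a chain. -/

section Chain

variable {ι : Type*}

/-- A discrete form of `y^s = ∫ s u^{s-1} du`: the terms are added in order of rank, and each
increment is bounded by the tangent at the new partial sum. Ties in rank only enlarge the partial
sums, which helps since `s - 1 ≥ 0`. -/
theorem Finset.rpow_sum_le_sum_partial {s : ℝ} (hs : 1 ≤ s) (ρ : ι → ℤ) (c : ι → ℝ≥0∞)
    (I : Finset ι) : (∑ i ∈ I, c i) ^ s ≤
      ENNReal.ofReal s * ∑ i ∈ I, c i * (∑ i' ∈ I with ρ i' ≤ ρ i, c i') ^ (s - 1) := by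
  classical
  induction I using Finset.induction_on_max_value ρ with
  | empty => simp [show 0 < s by linarith]
  | insert a I ha hmax ih =>
    rw [Finset.sum_insert ha, Finset.sum_insert ha, add_comm (c a), mul_add,
      add_comm (ENNReal.ofReal s * _)]
    refine (ENNReal.add_rpow_le_rpow_add_mul hs _ _).trans (add_le_add (ih.trans ?_) (le_of_eq ?_))
    · have : 0 ≤ s - 1 := by linarith
      gcongr with i hi
      exact Finset.subset_insert _ _
    · rw [Finset.filter_true_of_mem (s := insert a I), Finset.sum_insert ha, add_comm (c a)]
      intro i hi
      rcases Finset.mem_insert.1 hi with rfl | h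
      · exact le_rfl
      · exact hmax _ h

/-- The same telescoping with concavity. Enlarged partial sums now lower the left side, because `s -
1 ≤ 0`. -/
theorem Finset.sum_partial_le_rpow_sum {s : ℝ} (hs0 : 0 < s) (hs : s ≤ 1) (ρ : ι → ℤ)
    (c : ι → ℝ≥0∞) (I : Finset ι) :
    ENNReal.ofReal s * ∑ i ∈ I, c i * (∑ i' ∈ I with ρ i' ≤ ρ i, c i') ^ (s - 1) ≤
      (∑ i ∈ I, c i) ^ s := by
  classical
  induction I using Finset.induction_on_max_value ρ with
  | empty => simp
  | insert a I ha hmax ih =>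
    rw [Finset.sum_insert ha, Finset.sum_insert ha, add_comm (c a), mul_add,
      add_comm (ENNReal.ofReal s * _)]
    refine le_trans (add_le_add (le_trans ?_ ih) (le_of_eq ?_))
      (ENNReal.rpow_add_mul_le_add_rpow hs0 hs _ _)
    · refine mul_le_mul_right (Finset.sum_le_sum fun i _ => mul_le_mul_right
        (ENNReal.rpow_le_rpow_of_nonpos (by linarith) ?_) _) _
      gcongr
      exact Finset.subset_insert _ _
    · rw [Finset.filter_true_of_mem (s := insert a I), Finset.sum_insert ha, add_comm (c a)]
      intro i hi
      rcases Finset.mem_insert.1 hi with rfl | h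
      · exact le_rfl
      · exact hmax _ h

end Chain

theorem Finset.rpow_sum_le_card_mul_sum_rpow {ι : Type*} {s : ℝ} (hs : 0 < s) (I : Finset ι)
    (y : ι → ℝ≥0∞) : (∑ i ∈ I, y i) ^ s ≤ (I.card : ℝ≥0∞) ^ s * ∑ i ∈ I, y i ^ s := by
  rcases I.eq_empty_or_nonempty with rfl | hI
  · simp [hs]
  obtain ⟨a, ha, hmax⟩ := I.exists_max_image y hI
  calc (∑ i ∈ I, y i) ^ s ≤ (∑ i ∈ I, y a) ^ s := by gcongr with i hi; exact hmax i hi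
    _ = (I.card : ℝ≥0∞) ^ s * y a ^ s := by
      rw [Finset.sum_const, nsmul_eq_mul, ENNReal.mul_rpow_of_nonneg _ _ hs.le]
    _ ≤ _ := by
      gcongr
      exact Finset.single_le_sum (f := fun i => y i ^ s) (fun _ _ => zero_le) ha

/-! ### Sums and maxima of indicators over nested families. -/

section Nested

open MeasureTheory

variable {X ι : Type*}

/-- The sum `∑ c_i 1_{A_i}` over a finite family of sets. -/
noncomputable def indicatorSum (S : Finset ι) (A : ι → Set X) (c : ι → ℝ≥0∞) (x : X) : ℝ≥0∞ :=
  ∑ i ∈ S, (A i).indicator (fun _ => c i) x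

/-- The maximum of the functions `g_i 1_{A_i}` over a finite family of sets. -/
noncomputable def indicatorSup (S : Finset ι) (A : ι → Set X) (g : ι → ℝ≥0∞) (x : X) : ℝ≥0∞ :=
  S.sup fun i => (A i).indicator (fun _ => g i) x

open Classical in
/-- The total weight of the members of the family that contain `A_i`. -/
noncomputable def weightAbove (S : Finset ι) (A : ι → Set X) (c : ι → ℝ≥0∞) (i : ι) : ℝ≥0∞ :=
  ∑ i' ∈ S with A i ⊆ A i', c i'

open Classical in
theorem indicatorSum_eq_sum_filter (S : Finset ι) (A : ι → Set X) (c : ι → ℝ≥0∞) (x : X) :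
    indicatorSum S A c x = ∑ i ∈ S with x ∈ A i, c i := by
  rw [Finset.sum_filter]; rfl

theorem le_indicatorSup {S : Finset ι} {A : ι → Set X} {g : ι → ℝ≥0∞} {i : ι} (hi : i ∈ S) {x : X}
    (hx : x ∈ A i) : g i ≤ indicatorSup S A g x := by
  refine le_trans (le_of_eq ?_) (Finset.le_sup (f := fun i => (A i).indicator (fun _ => g i) x) hi)
  simp [hx]

theorem indicatorSup_le {S : Finset ι} {A : ι → Set X} {g : ι → ℝ≥0∞} {x : X} {b : ℝ≥0∞}
    (h : ∀ i ∈ S, x ∈ A i → g i ≤ b) : indicatorSup S A g x ≤ b := by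
  refine Finset.sup_le fun i hi => ?_
  by_cases hx : x ∈ A i
  · simpa [hx] using h i hi hx
  · simp [hx]

theorem weightAbove_le_indicatorSum {S : Finset ι} {A : ι → Set X} {c : ι → ℝ≥0∞} {i : ι} {x : X}
    (hx : x ∈ A i) : weightAbove S A c i ≤ indicatorSum S A c x := by
  classical
  rw [indicatorSum_eq_sum_filter]
  unfold weightAbove
  refine Finset.sum_le_sum_of_subset fun i' hi' => ?_
  rw [Finset.mem_filter] at hi' ⊢
  exact ⟨hi'.1, hi'.2 hx⟩

/-- Sets of larger rank are contained in, or disjoint from, those of smaller rank. -/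
def NestedFamily (ρ : ι → ℤ) (A : ι → Set X) : Prop :=
  ∀ i i' x, ρ i' ≤ ρ i → x ∈ A i → x ∈ A i' → A i ⊆ A i'

/-- The members that contain `x` form a chain, so those of rank at most `ρ i` all contain `A i`. The
bound no longer depends on `x`. -/
theorem NestedFamily.partial_le_weightAbove {ρ : ι → ℤ} {A : ι → Set X} (h : NestedFamily ρ A)
    (S : Finset ι) (c : ι → ℝ≥0∞) {i : ι} {x : X} (hx : x ∈ A i) (I : Finset ι) (hI : I ⊆ S)
    (hIx : ∀ i ∈ I, x ∈ A i) : ∑ i' ∈ I with ρ i' ≤ ρ i, c i' ≤ weightAbove S A c i := by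
  classical
  unfold weightAbove
  refine Finset.sum_le_sum_of_subset fun i' hi' => ?_
  rw [Finset.mem_filter] at hi' ⊢
  exact ⟨hI hi'.1, h i i' x hi'.2 hx (hIx _ hi'.1)⟩

/-- The right side is linear in the indicators with coefficients independent of `x`. Its integral
involves only the measures of the `A i` and can therefore be transferred to another family. -/
theorem NestedFamily.indicatorSum_rpow_le {ρ : ι → ℤ} {A : ι → Set X} (h : NestedFamily ρ A)
    (S : Finset ι) (c : ι → ℝ≥0∞) {s : ℝ} (hs : 1 ≤ s) (x : X) : indicatorSum S A c x ^ s ≤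
      ENNReal.ofReal s * indicatorSum S A (fun i => c i * weightAbove S A c i ^ (s - 1)) x := by
  classical
  rw [indicatorSum_eq_sum_filter, indicatorSum_eq_sum_filter]
  refine (Finset.rpow_sum_le_sum_partial hs ρ c _).trans ?_
  refine mul_le_mul_right (Finset.sum_le_sum fun i hi => mul_le_mul_right
    (ENNReal.rpow_le_rpow ?_ (by linarith)) _) _
  exact h.partial_le_weightAbove S c (Finset.mem_filter.1 hi).2 _ (Finset.filter_subset _ _)
    fun i hi => (Finset.mem_filter.1 hi).2

theorem NestedFamily.le_indicatorSum_rpow {ρ : ι → ℤ} {A : ι → Set X} (h : NestedFamily ρ A)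
    (S : Finset ι) (c : ι → ℝ≥0∞) {s : ℝ} (hs0 : 0 < s) (hs : s ≤ 1) (x : X) :
    ENNReal.ofReal s * indicatorSum S A (fun i => c i * weightAbove S A c i ^ (s - 1)) x ≤
      indicatorSum S A c x ^ s := by
  classical
  rw [indicatorSum_eq_sum_filter, indicatorSum_eq_sum_filter]
  refine le_trans (mul_le_mul_right (Finset.sum_le_sum fun i hi => mul_le_mul_right
    (ENNReal.rpow_le_rpow_of_nonpos (by linarith) ?_) _) _)
    (Finset.sum_partial_le_rpow_sum hs0 hs ρ c _)
  exact h.partial_le_weightAbove S c (Finset.mem_filter.1 hi).2 _ (Finset.filter_subset _ _)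
      fun i hi => (Finset.mem_filter.1 hi).2

variable [MeasurableSpace X] {μ : Measure X}

theorem measurable_indicatorSum (S : Finset ι) {A : ι → Set X} (hA : ∀ i, MeasurableSet (A i))
    (c : ι → ℝ≥0∞) : Measurable (indicatorSum S A c) := by
  unfold indicatorSum
  exact Finset.measurable_fun_sum _ fun i _ => measurable_const.indicator (hA i)

theorem measurable_indicatorSup (S : Finset ι) {A : ι → Set X} (hA : ∀ i, MeasurableSet (A i))
    (g : ι → ℝ≥0∞) : Measurable (indicatorSup S A g) := by
  unfold indicatorSup
  simp_rw [Finset.sup_eq_iSup]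
  exact Measurable.biSup _ S.countable_toSet fun i _ => measurable_const.indicator (hA i)

theorem lintegral_indicatorSum (S : Finset ι) {A : ι → Set X} (hA : ∀ i, MeasurableSet (A i))
    (c : ι → ℝ≥0∞) : ∫⁻ x, indicatorSum S A c x ∂μ = ∑ i ∈ S, c i * μ (A i) := by
  unfold indicatorSum
  rw [lintegral_finsetSum _ fun i _ => measurable_const.indicator (hA i)]
  simp [lintegral_indicator_const (hA _)]

/-- Comparison of maximal functions over two families whose unions are comparable. -/
theorem lintegral_indicatorSup_le {S : Finset ι} {A B : ι → Set X}
    (hA : ∀ i, MeasurableSet (A i)) (hB : ∀ i, MeasurableSet (B i)) {Λ : ℝ≥0∞} (hΛ : Λ ≠ ⊤)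
    (hBA : ∀ T ⊆ S, μ (⋃ i ∈ T, B i) ≤ Λ * μ (⋃ i ∈ T, A i)) {g : ι → ℝ≥0∞} (hg : ∀ i, g i ≠ ⊤) :
    ∫⁻ x, indicatorSup S B g x ∂μ ≤ Λ * ∫⁻ x, indicatorSup S A g x ∂μ := by
  classical
  have hfin : ∀ (D : ι → Set X) x, indicatorSup S D g x ≠ ⊤ := fun D x => by
    refine ne_of_lt (lt_of_le_of_lt (indicatorSup_le (b := ∑ i ∈ S, g i) fun i hi _ => ?_) ?_)
    · exact Finset.single_le_sum (f := g) (fun _ _ => zero_le) hi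
    · exact ENNReal.sum_lt_top.2 fun i _ => (hg i).lt_top
  -- Layer-cake formula: the superlevel set at height `t` is the union of the members with `t < g
  -- i`, so the hypothesis on unions applies height by height.
  have hlc : ∀ D : ι → Set X, (∀ i, MeasurableSet (D i)) → ∫⁻ x, indicatorSup S D g x ∂μ =
      ∫⁻ t in Set.Ioi (0 : ℝ), μ (⋃ i ∈ S.filter fun i => ENNReal.ofReal t < g i, D i) := by
    intro D hD
    have h1 : ∀ x, indicatorSup S D g x = ENNReal.ofReal (indicatorSup S D g x).toReal :=
      fun x => (ENNReal.ofReal_toReal (hfin D x)).symm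
    rw [lintegral_congr h1, lintegral_eq_lintegral_meas_lt μ (Filter.Eventually.of_forall fun x => ENNReal.toReal_nonneg)
      (measurable_indicatorSup S hD g).ennreal_toReal.aemeasurable]
    refine setLIntegral_congr_fun measurableSet_Ioi fun t ht => ?_
    have ht0 : (0 : ℝ) ≤ t := le_of_lt ht
    congr 1
    ext x
    simp only [Set.mem_ofPred_eq, Set.mem_iUnion, Finset.mem_filter, exists_prop]
    rw [← ENNReal.ofReal_lt_iff_lt_toReal ht0 (hfin D x)]
    unfold indicatorSup
    rw [Finset.lt_sup_iff]
    constructor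
    · rintro ⟨i, hi, h⟩
      by_cases hx : x ∈ D i
      · rw [Set.indicator_of_mem hx] at h
        exact ⟨i, ⟨hi, h⟩, hx⟩
      · simp [hx] at h
    · rintro ⟨i, ⟨hi, h⟩, hx⟩
      exact ⟨i, hi, by simpa [hx] using h⟩
  rw [hlc A hA, hlc B hB, ← lintegral_const_mul' _ _ hΛ]
  exact lintegral_mono fun t => hBA _ (Finset.filter_subset _ _)

/-- This finiteness permits the absorption of a power of the integral into the left side when `1 ≤
s`. -/
theorem lintegral_indicatorSum_rpow_ne_top {S : Finset ι} {A : ι → Set X}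
    (hA : ∀ i, MeasurableSet (A i)) (hAtop : ∀ i, μ (A i) ≠ ⊤) {c : ι → ℝ≥0∞} (hc : ∀ i, c i ≠ ⊤)
    {s : ℝ} (hs : 0 < s) : ∫⁻ x, indicatorSum S A c x ^ s ∂μ ≠ ⊤ := by
  have h1 : ∀ x, indicatorSum S A c x ^ s ≤
      (S.card : ℝ≥0∞) ^ s * indicatorSum S A (fun i => c i ^ s) x := by
    intro x
    refine (Finset.rpow_sum_le_card_mul_sum_rpow hs _ _).trans (le_of_eq ?_)
    unfold indicatorSum
    congr 1
    refine Finset.sum_congr rfl fun i _ => ?_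
    by_cases hx : x ∈ A i <;> simp [hx, hs]
  refine ne_top_of_le_ne_top ?_ (lintegral_mono h1)
  rw [lintegral_const_mul _ (measurable_indicatorSum S hA _), lintegral_indicatorSum S hA]
  refine ENNReal.mul_ne_top (ENNReal.rpow_ne_top_of_nonneg hs.le (by simp)) ?_
  refine ENNReal.sum_ne_top.2 fun i _ => ENNReal.mul_ne_top ?_ (hAtop i)
  exact ENNReal.rpow_ne_top_of_nonneg hs.le (hc i)

/-- Linearising over `B` and replacing `μ (B i)` by `Λ * μ (A i)` leaves the integral of `∑ c_i
G_i^{s-1} 1_{A_i}`, where `G_i` is the weight above `B_i`. Hölder's inequality with exponents `s`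
and `s/(s-1)` splits off the maximum of `G_i^s` over `A`. That maximum is compared with the one over
`B`, which is at most the `s`-th power of the sum over `B`, so the left side reappears with the
exponent `(s-1)/s` and is absorbed. -/
theorem NestedFamily.lintegral_rpow_le_of_one_le {ρ : ι → ℤ} {S : Finset ι} {A B : ι → Set X}
    (hB : NestedFamily ρ B)
    (hAm : ∀ i, MeasurableSet (A i)) (hBm : ∀ i, MeasurableSet (B i)) (hBtop : ∀ i, μ (B i) ≠ ⊤)
    {Λ : ℝ≥0∞} (hΛ : Λ ≠ ⊤) (hμ : ∀ i, μ (B i) ≤ Λ * μ (A i))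
    (hAB : ∀ T ⊆ S, μ (⋃ i ∈ T, A i) ≤ Λ * μ (⋃ i ∈ T, B i))
    {c : ι → ℝ≥0∞} (hc : ∀ i, c i ≠ ⊤) {s : ℝ} (hs : 1 ≤ s) :
    ∫⁻ x, indicatorSum S B c x ^ s ∂μ ≤
      (ENNReal.ofReal s * Λ) ^ s * Λ ^ (s - 1) * ∫⁻ x, indicatorSum S A c x ^ s ∂μ := by
  have hs0 : 0 < s := by linarith
  set G := weightAbove S B c with hG
  have hGtop : ∀ i, G i ≠ ⊤ := fun i => by
    rw [hG]; unfold weightAbove; exact ENNReal.sum_ne_top.2 fun i _ => hc i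
  set Y := ∫⁻ x, indicatorSum S B c x ^ s ∂μ with hY
  set Z := ∫⁻ x, indicatorSum S A c x ^ s ∂μ with hZ
  have hYtop : Y ≠ ⊤ := lintegral_indicatorSum_rpow_ne_top hBm hBtop hc hs0
  have hM : ∫⁻ x, indicatorSup S A (fun i => G i ^ s) x ∂μ ≤ Λ * Y := by
    refine (lintegral_indicatorSup_le hBm hAm hΛ hAB
      fun i => ENNReal.rpow_ne_top_of_nonneg hs0.le (hGtop i)).trans ?_
    gcongr Λ * ?_
    refine lintegral_mono fun x => indicatorSup_le fun i _ hx => ?_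
    gcongr
    exact weightAbove_le_indicatorSum hx
  have hpt : ∀ x, indicatorSum S A (fun i => c i * G i ^ (s - 1)) x ≤
      (indicatorSum S A c x ^ s) ^ (1 / s) *
        indicatorSup S A (fun i => G i ^ s) x ^ ((s - 1) / s) := by
    intro x
    rw [← ENNReal.rpow_mul, mul_one_div_cancel hs0.ne', ENNReal.rpow_one]
    unfold indicatorSum
    rw [Finset.sum_mul]
    refine Finset.sum_le_sum fun i hi => ?_
    by_cases hx : x ∈ A i
    · simp only [hx, Set.indicator_of_mem]
      gcongr
      calc G i ^ (s - 1) = (G i ^ s) ^ ((s - 1) / s) := by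
            rw [← ENNReal.rpow_mul, mul_div_cancel₀ _ hs0.ne']
        _ ≤ _ := ENNReal.rpow_le_rpow (le_indicatorSup (g := fun i => G i ^ s) hi hx)
            (div_nonneg (by linarith) hs0.le)
    · simp [hx]
  have hmain : Y ≤ ENNReal.ofReal s * Λ * (Z ^ (1 / s) * (Λ * Y) ^ ((s - 1) / s)) := by
    calc Y ≤ ∫⁻ x, ENNReal.ofReal s * indicatorSum S B (fun i => c i * G i ^ (s - 1)) x ∂μ :=
          lintegral_mono fun x => hB.indicatorSum_rpow_le S c hs x
      _ = ENNReal.ofReal s * ∑ i ∈ S, c i * G i ^ (s - 1) * μ (B i) := by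
          rw [lintegral_const_mul _ (measurable_indicatorSum S hBm _),
            lintegral_indicatorSum S hBm]
      _ ≤ ENNReal.ofReal s * ∑ i ∈ S, c i * G i ^ (s - 1) * (Λ * μ (A i)) := by
          gcongr with i
          exact hμ i
      _ = ENNReal.ofReal s * Λ * ∫⁻ x, indicatorSum S A (fun i => c i * G i ^ (s - 1)) x ∂μ := by
          rw [lintegral_indicatorSum S hAm, mul_assoc, Finset.mul_sum, Finset.mul_sum,
            Finset.mul_sum]
          exact Finset.sum_congr rfl fun i _ => by ring
      _ ≤ ENNReal.ofReal s * Λ * (Z ^ (1 / s) * (Λ * Y) ^ ((s - 1) / s)) := by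
          gcongr ENNReal.ofReal s * Λ * ?_
          refine (lintegral_mono hpt).trans ?_
          refine (ENNReal.lintegral_mul_norm_pow_le
            ((measurable_indicatorSum S hAm c).pow_const s).aemeasurable
            (measurable_indicatorSup S hAm _).aemeasurable (by positivity)
            (div_nonneg (by linarith) hs0.le) (by field_simp; ring)).trans ?_
          have : 0 ≤ (s - 1) / s := div_nonneg (by linarith) hs0.le
          gcongr
  -- Raised to the power `s`, `hmain` bounds `Y ^ s` by a constant times `Z * Y ^ (s - 1)`;
  -- cancelling requires `0 < Y < ⊤`.
  rcases eq_or_ne Y 0 with h0 | h0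
  · rw [h0]; exact zero_le
  have h2 := ENNReal.rpow_le_rpow hmain hs0.le
  have hs1 : 0 ≤ (s - 1) / s := div_nonneg (by linarith) hs0.le
  rw [ENNReal.mul_rpow_of_nonneg _ _ hs0.le,
    ENNReal.mul_rpow_of_nonneg (Z ^ _) _ hs0.le, ← ENNReal.rpow_mul, ← ENNReal.rpow_mul, one_div_mul_cancel hs0.ne', ENNReal.rpow_one,
    div_mul_cancel₀ _ hs0.ne', ENNReal.mul_rpow_of_nonneg _ _ (by linarith : (0:ℝ) ≤ s - 1)] at h2
  have h3 : Y ^ s = Y * Y ^ (s - 1) := by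
    conv_rhs => enter [1]; rw [← ENNReal.rpow_one Y]
    rw [← ENNReal.rpow_add _ _ h0 hYtop]; congr 1; ring
  rw [h3] at h2
  have hY1 : Y ^ (s - 1) ≠ 0 := by
    simp [ENNReal.rpow_eq_zero_iff, h0, hYtop]
  have hY2 : Y ^ (s - 1) ≠ ⊤ := ENNReal.rpow_ne_top_of_nonneg (by linarith) hYtop
  refine (ENNReal.mul_le_mul_iff_left hY1 hY2).1 (h2.trans (le_of_eq ?_))
  ring

/-- Here the linearisation is a lower bound and is applied to `A`, with `G_i` the weight above
`A_i`. Writing `c_i = c_i G_i^{s-1} · G_i^{1-s}` and applying Hölder's inequality with weights `s`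
and `1 - s`, both factors are controlled by the sum over `A`; no absorption is needed. -/
theorem NestedFamily.lintegral_rpow_le_of_le_one {ρ : ι → ℤ} {S : Finset ι} {A B : ι → Set X}
    (hA : NestedFamily ρ A)
    (hAm : ∀ i, MeasurableSet (A i)) (hBm : ∀ i, MeasurableSet (B i))
    {Λ : ℝ≥0∞} (hΛ : Λ ≠ ⊤) (hμ : ∀ i, μ (B i) ≤ Λ * μ (A i))
    (hBA : ∀ T ⊆ S, μ (⋃ i ∈ T, B i) ≤ Λ * μ (⋃ i ∈ T, A i))
    {c : ι → ℝ≥0∞} (hc : ∀ i, c i ≠ ⊤) {s : ℝ} (hs0 : 0 < s) (hs : s ≤ 1) :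
    ∫⁻ x, indicatorSum S B c x ^ s ∂μ ≤
      ((ENNReal.ofReal s)⁻¹ * Λ) ^ s * Λ ^ (1 - s) * ∫⁻ x, indicatorSum S A c x ^ s ∂μ := by
  set G := weightAbove S A c with hG
  have hGtop : ∀ i, G i ≠ ⊤ := fun i => by
    rw [hG]; unfold weightAbove; exact ENNReal.sum_ne_top.2 fun i _ => hc i
  set Z := ∫⁻ x, indicatorSum S A c x ^ s ∂μ with hZ
  have hM : ∫⁻ x, indicatorSup S B (fun i => G i ^ s) x ∂μ ≤ Λ * Z := by
    refine (lintegral_indicatorSup_le hAm hBm hΛ hBA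
      fun i => ENNReal.rpow_ne_top_of_nonneg hs0.le (hGtop i)).trans ?_
    gcongr Λ * ?_
    refine lintegral_mono fun x => indicatorSup_le fun i _ hx => ?_
    gcongr
    exact weightAbove_le_indicatorSum hx
  have hH : ∫⁻ x, indicatorSum S B (fun i => c i * G i ^ (s - 1)) x ∂μ ≤
      (ENNReal.ofReal s)⁻¹ * Λ * Z := by
    rw [lintegral_indicatorSum S hBm]
    calc _ ≤ ∑ i ∈ S, c i * G i ^ (s - 1) * (Λ * μ (A i)) := by
          gcongr with i
          exact hμ i
      _ = (ENNReal.ofReal s)⁻¹ * Λ *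
          (ENNReal.ofReal s * ∫⁻ x, indicatorSum S A (fun i => c i * G i ^ (s - 1)) x ∂μ) := by
          rw [lintegral_indicatorSum S hAm, ← mul_assoc, mul_comm _ Λ, mul_assoc Λ,
            ENNReal.inv_mul_cancel (by simpa using hs0) ENNReal.ofReal_ne_top, mul_one,
            Finset.mul_sum]
          exact Finset.sum_congr rfl fun i _ => by ring
      _ ≤ _ := by
          gcongr
          rw [← lintegral_const_mul _ (measurable_indicatorSum S hAm _)]
          exact lintegral_mono fun x => hA.le_indicatorSum_rpow S c hs0 hs x
  have hpt : ∀ x, indicatorSum S B c x ^ s ≤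
      indicatorSum S B (fun i => c i * G i ^ (s - 1)) x ^ s *
        indicatorSup S B (fun i => G i ^ s) x ^ (1 - s) := by
    intro x
    set m := indicatorSup S B (fun i => G i ^ s) x with hm
    have h1 : indicatorSum S B c x ≤
        indicatorSum S B (fun i => c i * G i ^ (s - 1)) x * m ^ ((1 - s) / s) := by
      unfold indicatorSum
      rw [Finset.sum_mul]
      refine Finset.sum_le_sum fun i hi => ?_
      by_cases hx : x ∈ B i
      · simp only [hx, Set.indicator_of_mem]
        -- If `c i ≠ 0` then `G i ≥ c i > 0`, so the powers of `G i` with exponents `s - 1` and `1 -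
        -- s` really cancel.
        rcases eq_or_ne (c i) 0 with h0 | h0
        · rw [h0]; exact zero_le
        have hG0 : G i ≠ 0 := by
          classical
          intro h
          have : c i ≤ G i := by
            rw [hG]
            refine Finset.single_le_sum (f := c) (fun _ _ => zero_le) ?_
            simp [hi]
          exact h0 (le_antisymm (h ▸ this) zero_le)
        calc c i = c i * (G i ^ (s - 1) * (G i ^ s) ^ ((1 - s) / s)) := by
              rw [← ENNReal.rpow_mul, mul_div_cancel₀ _ hs0.ne', ← ENNReal.rpow_add _ _ hG0 (hGtop i)]
              simp
          _ = c i * G i ^ (s - 1) * (G i ^ s) ^ ((1 - s) / s) := by ring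
          _ ≤ _ := by
            have : 0 ≤ (1 - s) / s := div_nonneg (by linarith) hs0.le
            gcongr
            exact le_indicatorSup (g := fun i => G i ^ s) hi hx
      · simp [hx]
    refine (ENNReal.rpow_le_rpow h1 hs0.le).trans (le_of_eq ?_)
    rw [ENNReal.mul_rpow_of_nonneg _ _ hs0.le, ← ENNReal.rpow_mul, div_mul_cancel₀ _ hs0.ne']
  calc _ ≤ _ := lintegral_mono hpt
    _ ≤ ((ENNReal.ofReal s)⁻¹ * Λ * Z) ^ s * (Λ * Z) ^ (1 - s) := by
      refine (ENNReal.lintegral_mul_norm_pow_le (measurable_indicatorSum S hBm _).aemeasurable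
        (measurable_indicatorSup S hBm _).aemeasurable hs0.le (by linarith) (by ring)).trans ?_
      have : 0 ≤ 1 - s := by linarith
      gcongr
    _ = ((ENNReal.ofReal s)⁻¹ * Λ) ^ s * Λ ^ (1 - s) * (Z ^ s * Z ^ (1 - s)) := by
      rw [ENNReal.mul_rpow_of_nonneg _ _ hs0.le, ENNReal.mul_rpow_of_nonneg Λ Z (by linarith)]
      ring
    _ = _ := by
      rw [← ENNReal.rpow_add_of_nonneg _ _ hs0.le (by linarith)]
      simp

end Nested

/-! ### Maximal members, and comparison of two nested families. -/

section Covering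

open MeasureTheory

variable {X ι : Type*}

/-- Members are added in order of increasing rank, the coarsest first. A newcomer that meets a
selected member lies inside it; otherwise it is selected as well. -/
theorem NestedFamily.exists_disjoint_subfamily {ρ : ι → ℤ} {A : ι → Set X}
    (hA : NestedFamily ρ A) (T : Finset ι) : ∃ U ⊆ T,
      (U : Set ι).PairwiseDisjoint A ∧ ∀ i ∈ T, ∃ P ∈ U, A i ⊆ A P := by
  classical
  induction T using Finset.induction_on_max_value ρ with
  | empty => exact ⟨∅, by simp⟩
  | insert a T ha hmax ih =>
    obtain ⟨U, hUT, hd, hU⟩ := ih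
    by_cases h : ∃ P ∈ U, ¬ Disjoint (A a) (A P)
    · obtain ⟨P, hP, hP'⟩ := h
      obtain ⟨x, hx, hx'⟩ := Set.not_disjoint_iff.1 hP'
      refine ⟨U, hUT.trans (Finset.subset_insert _ _), hd, fun i hi => ?_⟩
      rcases Finset.mem_insert.1 hi with rfl | hi
      · exact ⟨P, hP, hA _ _ x (hmax P (hUT hP)) hx hx'⟩
      · exact hU i hi
    · push Not at h
      refine ⟨insert a U, Finset.insert_subset_insert _ hUT, ?_, fun i hi => ?_⟩
      · rw [Finset.coe_insert]
        exact hd.insert fun P hP _ => h P hP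
      · rcases Finset.mem_insert.1 hi with rfl | hi
        · exact ⟨i, Finset.mem_insert_self _ _, subset_rfl⟩
        · obtain ⟨P, hP, h⟩ := hU i hi
          exact ⟨P, Finset.mem_insert_of_mem hP, h⟩

variable [MeasurableSpace X] {μ : Measure X}

/-- Each `B i` lies in the dilate `D P` of a selected `P`, and the measures of the disjoint selected
members add up. -/
theorem NestedFamily.measure_biUnion_le {ρ : ι → ℤ} {A B D : ι → Set X} (hA : NestedFamily ρ A)
    (hAm : ∀ i, MeasurableSet (A i)) {Λ : ℝ≥0∞}
    (hD : ∀ i i', A i ⊆ A i' → B i ⊆ D i') (hμ : ∀ i, μ (D i) ≤ Λ * μ (A i)) (T : Finset ι) :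
    μ (⋃ i ∈ T, B i) ≤ Λ * μ (⋃ i ∈ T, A i) := by
  obtain ⟨U, hUT, hd, hU⟩ := hA.exists_disjoint_subfamily T
  calc μ (⋃ i ∈ T, B i) ≤ μ (⋃ P ∈ U, D P) := by
        refine measure_mono (Set.iUnion₂_subset fun i hi => ?_)
        obtain ⟨P, hP, h⟩ := hU i hi
        exact (hD i P h).trans (Set.subset_biUnion_of_mem (u := D) (Finset.mem_coe.2 hP))
    _ ≤ ∑ P ∈ U, μ (D P) := measure_biUnion_finset_le _ _
    _ ≤ ∑ P ∈ U, Λ * μ (A P) := Finset.sum_le_sum fun i _ => hμ i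
    _ = Λ * μ (⋃ P ∈ U, A P) := by
      rw [← Finset.mul_sum, measure_biUnion_finset hd fun i _ => hAm i]
    _ ≤ _ := by
      gcongr
      exact Set.iUnion_mono' fun h => ⟨hUT h, subset_rfl⟩

/-- Monotone convergence for powers of sums of non-negative functions. -/
theorem lintegral_tsum_rpow_le [Countable ι] {f : ι → X → ℝ≥0∞} (hf : ∀ i, Measurable (f i))
    {s : ℝ} (hs : 0 < s) {K : ℝ≥0∞}
    (h : ∀ S : Finset ι, ∫⁻ x, (∑ i ∈ S, f i x) ^ s ∂μ ≤ K) :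
    ∫⁻ x, (∑' i, f i x) ^ s ∂μ ≤ K := by
  have h1 : ∀ x, (∑' i, f i x) ^ s = ⨆ S : Finset ι, (∑ i ∈ S, f i x) ^ s := by
    intro x
    rw [ENNReal.tsum_eq_iSup_sum]
    exact (ENNReal.orderIsoRpow s hs).map_iSup _
  simp_rw [h1]
  rw [lintegral_iSup_directed]
  · exact iSup_le h
  · exact fun S => ((Finset.measurable_fun_sum _ fun i _ => hf i).pow_const s).aemeasurable
  · classical
    refine Monotone.directed_le fun S T hST x => ?_
    exact ENNReal.rpow_le_rpow (Finset.sum_le_sum_of_subset hST) hs.le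

/-- The constant in the comparison of sums over two comparable families of sets. -/
noncomputable def comparisonConst (s : ℝ) : ℝ≥0∞ :=
  ENNReal.ofReal s ^ s + (ENNReal.ofReal s)⁻¹ ^ s

theorem comparisonConst_ne_top {s : ℝ} (hs : 0 < s) : comparisonConst s ≠ ⊤ := by
  unfold comparisonConst
  refine ENNReal.add_ne_top.2 ⟨ENNReal.rpow_ne_top_of_nonneg hs.le ENNReal.ofReal_ne_top,
    ENNReal.rpow_ne_top_of_nonneg hs.le ?_⟩
  simpa using hs

/-- Two nested families of sets of comparable measure, each member of one being contained in a
dilate of the corresponding member of the other, give comparable functions in `L^s`. -/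
theorem lintegral_tsum_indicator_rpow_le [Countable ι] {ρ σ : ι → ℤ} {A B D E : ι → Set X}
    (hA : NestedFamily ρ A) (hB : NestedFamily σ B)
    (hAm : ∀ i, MeasurableSet (A i)) (hBm : ∀ i, MeasurableSet (B i))
    (hA0 : ∀ i, μ (A i) ≠ 0) (hBtop : ∀ i, μ (B i) ≠ ⊤) {Λ : ℝ≥0∞} (hΛ : Λ ≠ ⊤) (hΛ1 : 1 ≤ Λ)
    (hD : ∀ i i', A i ⊆ A i' → B i ⊆ D i') (hDμ : ∀ i, μ (D i) ≤ Λ * μ (A i))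
    (hE : ∀ i i', B i ⊆ B i' → A i ⊆ E i') (hEμ : ∀ i, μ (E i) ≤ Λ * μ (B i))
    (c : ι → ℝ≥0∞) {s : ℝ} (hs : 0 < s) :
    ∫⁻ x, (∑' i, (B i).indicator (fun _ => c i) x) ^ s ∂μ ≤
      comparisonConst s * Λ ^ (2 * s + 1) *
        ∫⁻ x, (∑' i, (A i).indicator (fun _ => c i) x) ^ s ∂μ := by
  classical
  have hs0 : ENNReal.ofReal s ≠ 0 := by simpa using hs
  have hΛ0 : Λ ≠ 0 := (zero_lt_one.trans_le hΛ1).ne'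
  by_cases hc : ∀ i, c i ≠ ⊤
  · refine lintegral_tsum_rpow_le (fun i => measurable_const.indicator (hBm i)) hs fun S => ?_
    have hAS : ∫⁻ x, indicatorSum S A c x ^ s ∂μ ≤
        ∫⁻ x, (∑' i, (A i).indicator (fun _ => c i) x) ^ s ∂μ :=
      lintegral_mono fun x => ENNReal.rpow_le_rpow (ENNReal.sum_le_tsum S) hs.le
    have hBA : ∀ T ⊆ S, μ (⋃ i ∈ T, B i) ≤ Λ * μ (⋃ i ∈ T, A i) := fun T _ =>
      hA.measure_biUnion_le hAm hD hDμ T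
    have hAB : ∀ T ⊆ S, μ (⋃ i ∈ T, A i) ≤ Λ * μ (⋃ i ∈ T, B i) := fun T _ =>
      hB.measure_biUnion_le hBm hE hEμ T
    have hμ : ∀ i, μ (B i) ≤ Λ * μ (A i) := fun i =>
      (measure_mono (hD i i subset_rfl)).trans (hDμ i)
    change ∫⁻ x, indicatorSum S B c x ^ s ∂μ ≤ _
    refine le_trans ?_ (mul_le_mul_right hAS _)
    -- The powers of `Λ` produced by the two cases are `2s - 1` and `1`, both at most `2s + 1`.
    rcases le_total 1 s with h1 | h1
    · refine (hB.lintegral_rpow_le_of_one_le hAm hBm hBtop hΛ hμ hAB hc h1).trans ?_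
      refine mul_le_mul_left ?_ _
      rw [ENNReal.mul_rpow_of_nonneg _ _ hs.le, mul_assoc, ← ENNReal.rpow_add _ _ hΛ0 hΛ]
      refine mul_le_mul' le_self_add (ENNReal.rpow_le_rpow_of_exponent_le hΛ1 (by linarith))
    · refine (hA.lintegral_rpow_le_of_le_one hAm hBm hΛ hμ hBA hc hs h1).trans ?_
      refine mul_le_mul_left ?_ _
      rw [ENNReal.mul_rpow_of_nonneg _ _ hs.le, mul_assoc, ← ENNReal.rpow_add _ _ hΛ0 hΛ]
      refine mul_le_mul' le_add_self (ENNReal.rpow_le_rpow_of_exponent_le hΛ1 (by linarith))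
  -- An infinite coefficient makes the right side infinite, because `A i` has positive measure.
  · push Not at hc
    obtain ⟨i, hi⟩ := hc
    have : ∫⁻ x, (∑' i, (A i).indicator (fun _ => c i) x) ^ s ∂μ = ⊤ := by
      refine top_le_iff.1 ?_
      calc ⊤ = ∫⁻ x, (A i).indicator (fun _ => ⊤) x ∂μ := by
            rw [lintegral_indicator_const (hAm i), ENNReal.top_mul (hA0 i)]
        _ ≤ _ := by
          refine lintegral_mono fun x => ?_
          by_cases hx : x ∈ A i
          · have h1 := ENNReal.le_tsum (f := fun i => (A i).indicator (fun _ => c i) x) i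
            simp only [hx, Set.indicator_of_mem, hi, top_le_iff] at h1
            simp [h1, hs]
          · simp [hx]
    rw [this, ENNReal.mul_top]
    · exact le_top
    · refine mul_ne_zero ?_ (by simp [ENNReal.rpow_eq_zero_iff, hΛ0, hΛ])
      unfold comparisonConst
      intro h
      rw [add_eq_zero] at h
      simp [ENNReal.rpow_eq_zero_iff, hs, not_lt.2 hs.le] at h

end Covering

/-! ### A triangle inequality for arbitrary positive exponents. -/

section WeightedSums

/-- A weighted triangle inequality for powers with an arbitrary positive exponent. -/
theorem ENNReal.rpow_tsum_mul_le {ι : Type*} {s : ℝ} (hs : 0 < s) (κ z : ι → ℝ≥0∞) :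
    (∑' i, κ i * z i) ^ s ≤ (∑' i, κ i) ^ s * ∑' i, z i ^ s := by
  calc (∑' i, κ i * z i) ^ s ≤ ((∑' i, κ i) * ⨆ i, z i) ^ s := by
        refine ENNReal.rpow_le_rpow ?_ hs.le
        rw [← ENNReal.tsum_mul_right]
        gcongr with i
        exact le_iSup z i
    _ = (∑' i, κ i) ^ s * ⨆ i, z i ^ s := by
        rw [ENNReal.mul_rpow_of_nonneg _ _ hs.le]
        congr 1
        exact (ENNReal.orderIsoRpow s hs).map_iSup _
    _ ≤ _ := by
        gcongr
        exact iSup_le fun i => ENNReal.le_tsum i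

end WeightedSums

/-! ### Geometry of dyadic cubes. -/

section DyadicGeometry

open MeasureTheory

variable {n : ℕ}

/-- The box `2^{-j}(k + [a, b)ⁿ)`. -/
def scaledBox (j : ℤ) (k : Fin n → ℤ) (a b : ℝ) : Set (RSpace n) :=
  {x | ∀ i, (2 : ℝ) ^ j * x i - k i ∈ Set.Ico a b}

theorem dyadicCube_eq_scaledBox (j : ℤ) (k : Fin n → ℤ) :
    dyadicCube j k = scaledBox j k 0 1 := rfl

theorem scaledBox_eq_preimage (j : ℤ) (k : Fin n → ℤ) (a b : ℝ) : scaledBox j k a b =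
    (MeasurableEquiv.toLp 2 (Fin n → ℝ)).symm ⁻¹' (Set.univ.pi fun i =>
      Set.Ico ((k i + a) * ((2 : ℝ) ^ j)⁻¹) ((k i + b) * ((2 : ℝ) ^ j)⁻¹)) := by
  have h2 : (0 : ℝ) < 2 ^ j := by positivity
  ext x
  simp only [scaledBox, Set.mem_ofPred_eq, Set.mem_preimage, Set.mem_pi, Set.mem_univ, true_imp_iff,
    Set.mem_Ico]
  refine forall_congr' fun i => ?_
  change _ ↔ (k i + a) * ((2 : ℝ) ^ j)⁻¹ ≤ x i ∧ x i < (k i + b) * ((2 : ℝ) ^ j)⁻¹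
  rw [← div_eq_mul_inv, ← div_eq_mul_inv, div_le_iff₀ h2, lt_div_iff₀ h2]
  constructor <;> rintro ⟨h1, h3⟩ <;> constructor <;> linarith

theorem measurableSet_scaledBox (j : ℤ) (k : Fin n → ℤ) (a b : ℝ) :
    MeasurableSet (scaledBox j k a b) := by
  rw [scaledBox_eq_preimage]
  exact (MeasurableEquiv.measurable _) (MeasurableSet.univ_pi fun i => measurableSet_Ico)

theorem volume_scaledBox (j : ℤ) (k : Fin n → ℤ) (a b : ℝ) :
    volume (scaledBox j k a b) = ENNReal.ofReal ((b - a) * ((2 : ℝ) ^ j)⁻¹) ^ n := by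
  rw [scaledBox_eq_preimage,
    (EuclideanSpace.volume_preserving_symm_measurableEquiv_toLp (Fin n)).measure_preimage
      (MeasurableSet.univ_pi fun i => measurableSet_Ico).nullMeasurableSet, Real.volume_pi_Ico]
  simp only [← sub_mul, add_sub_add_left_eq_sub, Finset.prod_const, Finset.card_univ,
    Fintype.card_fin]

theorem measurableSet_dyadicCube (j : ℤ) (k : Fin n → ℤ) : MeasurableSet (dyadicCube j k) :=
  measurableSet_scaledBox j k 0 1

theorem volume_dyadicCube (j : ℤ) (k : Fin n → ℤ) :
    volume (dyadicCube j k) = ENNReal.ofReal (((2 : ℝ) ^ j)⁻¹) ^ n := by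
  rw [dyadicCube_eq_scaledBox, volume_scaledBox]
  simp

theorem volume_scaledBox_eq_mul (j : ℤ) (k : Fin n → ℤ) {r : ℝ} (hr : 0 ≤ r) :
    volume (scaledBox j k (-r) r) = ENNReal.ofReal (2 * r) ^ n * volume (dyadicCube j k) := by
  rw [volume_scaledBox, volume_dyadicCube, ← mul_pow, ← ENNReal.ofReal_mul (by positivity)]
  congr 2
  ring_nf

theorem volume_dyadicCube_ne_zero (j : ℤ) (k : Fin n → ℤ) : volume (dyadicCube j k) ≠ 0 := by
  rw [volume_dyadicCube]
  have : (0 : ℝ) < (2 ^ j)⁻¹ := by positivity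
  exact pow_ne_zero _ (by simpa using this)

theorem volume_dyadicCube_ne_top (j : ℤ) (k : Fin n → ℤ) : volume (dyadicCube j k) ≠ ⊤ := by
  rw [volume_dyadicCube]
  exact ENNReal.pow_ne_top ENNReal.ofReal_ne_top

theorem mem_dyadicCube_iff {j : ℤ} {k : Fin n → ℤ} {x : RSpace n} :
    x ∈ dyadicCube j k ↔ ∀ i, ⌊(2 : ℝ) ^ j * x i⌋ = k i := by
  refine forall_congr' fun i => ?_
  rw [Int.floor_eq_iff, Set.mem_Ico]
  constructor <;> rintro ⟨h1, h2⟩ <;> constructor <;> linarith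

theorem dyadicCube_nonempty (j : ℤ) (k : Fin n → ℤ) : (dyadicCube j k).Nonempty := by
  refine ⟨((2 : ℝ) ^ j)⁻¹ • latticePoint k, fun i => ?_⟩
  have h2 : (2 : ℝ) ^ j ≠ 0 := by positivity
  simp [latticePoint, h2]

/-- Passing to a coarser dyadic scale is integer division of the index by a power of two, so the
coarse index is determined by the fine one. This is what makes dyadic cubes nested. -/
theorem floor_zpow_mul_of_le {j j' : ℤ} (h : j' ≤ j) (x : ℝ) :
    ⌊(2 : ℝ) ^ j' * x⌋ = ⌊(2 : ℝ) ^ j * x⌋ / ((2 ^ (j - j').toNat : ℕ) : ℤ) := by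
  rw [← Int.floor_div_natCast]
  congr 1
  have h1 : (2 : ℝ) ^ j = 2 ^ j' * 2 ^ (j - j').toNat := by
    rw [← zpow_natCast, ← zpow_add₀ two_ne_zero, Int.toNat_of_nonneg (by omega)]
    congr 1
    ring
  rw [h1]
  push_cast
  field_simp

theorem dyadicCube_subset_of_mem {j j' : ℤ} (h : j' ≤ j) {k k' : Fin n → ℤ} {x : RSpace n}
    (hx : x ∈ dyadicCube j k) (hx' : x ∈ dyadicCube j' k') : dyadicCube j k ⊆ dyadicCube j' k' := by
  intro y hy
  rw [mem_dyadicCube_iff] at *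
  intro i
  rw [floor_zpow_mul_of_le h, hy i, ← hx i, ← floor_zpow_mul_of_le h, hx' i]

/-- Comparison of volumes. In dimension zero all cubes coincide, hence `NeZero n`. -/
theorem scale_le_of_dyadicCube_subset [NeZero n] {j j' : ℤ} {k k' : Fin n → ℤ}
    (h : dyadicCube j k ⊆ dyadicCube j' k') : j' ≤ j := by
  have h1 := measure_mono (μ := volume) h
  rw [volume_dyadicCube, volume_dyadicCube,
    ENNReal.pow_le_pow_left_iff (NeZero.ne n),
    ENNReal.ofReal_le_ofReal_iff (by positivity), inv_le_inv₀ (by positivity) (by positivity)] at h1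
  exact (zpow_le_zpow_iff_right₀ one_lt_two).1 h1

end DyadicGeometry

/-! ### Summability of polynomial decay over the lattice. -/

section LatticeSums

variable {n : ℕ}

/-- The weight `1 + ‖k‖` on the lattice `ℤⁿ`. -/
noncomputable def latticeWeight (k : Fin n → ℤ) : ℝ≥0∞ := ENNReal.ofReal (1 + ‖k‖)

theorem one_le_latticeWeight (k : Fin n → ℤ) : 1 ≤ latticeWeight k := by
  rw [latticeWeight, ENNReal.one_le_ofReal]
  linarith [norm_nonneg k]

theorem latticeWeight_ne_top (k : Fin n → ℤ) : latticeWeight k ≠ ⊤ := ENNReal.ofReal_ne_top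

theorem summable_lattice_decay (n : ℕ) :
    ∃ N : ℕ, Summable fun k : Fin n → ℤ => (1 + ‖k‖)⁻¹ ^ N := by
  let L := Submodule.span ℤ (Set.range (Pi.basisFun ℝ (Fin n)))
  have hmem : ∀ k : Fin n → ℤ, (fun i => (k i : ℝ)) ∈ L := by
    intro k
    have : (fun i => (k i : ℝ)) = ∑ i, k i • Pi.basisFun ℝ (Fin n) i := by
      ext i
      simp [Pi.single_apply]
    rw [this]
    exact Submodule.sum_mem _ fun i _ => Submodule.smul_mem _ _ (Submodule.subset_span ⟨i, rfl⟩)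
  let f : (Fin n → ℤ) → L := fun k => ⟨_, hmem k⟩
  have hf : Function.Injective f := fun k k' h => by
    have := congrArg Subtype.val h
    ext i
    have := congrFun this i
    simpa [f] using this
  have hnorm : ∀ k, ‖f k‖ = ‖k‖ := fun k => by
    change ‖(fun i => (k i : ℝ))‖ = ‖k‖
    simp [Pi.norm_def]
    rfl
  refine ⟨Module.finrank ℤ L + 1, ?_⟩
  have h1 := (ZLattice.summable_norm_pow_inv L (Module.finrank ℤ L + 1)
    (Nat.lt_succ_self _)).comp_injective hf
  have h2 : Summable fun k : Fin n → ℤ => if k = 0 then (1 : ℝ) else 0 :=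
    summable_of_ne_finset_zero (s := {0}) fun k hk => by simpa using hk
  refine Summable.of_nonneg_of_le (fun k => by positivity) (fun k => ?_) (h2.add h1)
  simp only [Function.comp_apply, hnorm]
  by_cases hk : k = 0
  · simp [hk]
  · simp only [hk, if_false, zero_add]
    have : 0 < ‖k‖ := norm_pos_iff.2 hk
    gcongr
    linarith

theorem tsum_latticeWeight_ne_top (n : ℕ) :
    ∃ N : ℕ, ∑' k : Fin n → ℤ, (latticeWeight k)⁻¹ ^ N ≠ ⊤ := by
  obtain ⟨N, hN⟩ := summable_lattice_decay n
  refine ⟨N, ?_⟩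
  have : ∀ k : Fin n → ℤ, (latticeWeight k)⁻¹ ^ N = ENNReal.ofReal ((1 + ‖k‖)⁻¹ ^ N) := by
    intro k
    have : 0 < 1 + ‖k‖ := by positivity
    rw [latticeWeight, ENNReal.ofReal_pow (by positivity), ENNReal.ofReal_inv_of_pos this]
  simp_rw [this]
  exact hN.tsum_ofReal_ne_top

end LatticeSums

/-! ### A single off-diagonal of an almost diagonal operator. -/

section AlmostDiagonal

open MeasureTheory

variable {n : ℕ}

/-- The position `k' + 2^δ k₁` in the lattice, at scale `2^{-δ}`. -/
def fineIndex (δ : ℕ) (k' k₁ : Fin n → ℤ) : Fin n → ℤ := fun a => k' a + 2 ^ δ * k₁ a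

/-- The position `2 k₁ + e` in the lattice, for a residue `e ∈ {0,1}ⁿ`. -/
def parityIndex (e : Fin n → Fin 2) (k₁ : Fin n → ℤ) : Fin n → ℤ :=
  fun a => 2 * k₁ a + ((e a : ℕ) : ℤ)

theorem parityIndex_surjective :
    Function.Surjective fun p : (Fin n → Fin 2) × (Fin n → ℤ) => parityIndex p.1 p.2 := by
  intro k
  refine ⟨(fun a => ⟨(k a % 2).toNat, by omega⟩, fun a => k a / 2), ?_⟩
  funext a
  simp only [parityIndex]
  omega

/-- On a fixed off-diagonal, distinct targets have distinct sources, so a sum over targets never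
counts a source cube twice. -/
theorem fineIndex_injective (δ : ℕ) (k' : Fin n → ℤ) :
    Function.Injective fun i : ℤ × (Fin n → ℤ) => (i.1 - 1 + (δ : ℤ), fineIndex δ k' i.2) := by
  rintro ⟨j, k⟩ ⟨j₂, k₂⟩ h
  simp only [Prod.mk.injEq] at h
  obtain ⟨h1, h2⟩ := h
  refine Prod.ext (by simpa using h1) (funext fun a => ?_)
  have := congrFun h2 a
  simpa [fineIndex] using this

theorem abs_intCast_le_norm (k : Fin n → ℤ) (a : Fin n) : |(k a : ℝ)| ≤ ‖k‖ :=
  norm_le_pi_norm k a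

theorem parityIndex_mem {e : Fin n → Fin 2} {j : ℤ} {k₁ : Fin n → ℤ} {x : RSpace n}
    (hx : x ∈ dyadicCube j (parityIndex e k₁)) (a : Fin n) :
    0 ≤ (2 : ℝ) ^ (j - 1) * x a - k₁ a ∧ (2 : ℝ) ^ (j - 1) * x a - k₁ a < 1 := by
  have h := hx a
  have he : ((e a : ℕ) : ℝ) ≤ 1 := by
    have : (e a : ℕ) ≤ 1 := by omega
    exact_mod_cast this
  have he0 : (0 : ℝ) ≤ ((e a : ℕ) : ℝ) := by positivity
  rw [show j = (j - 1) + 1 by ring, zpow_add_one₀ two_ne_zero] at h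
  simp only [parityIndex, Set.mem_Ico] at h
  push_cast at h
  constructor <;> nlinarith [h.1, h.2]

theorem fineIndex_mem {δ : ℕ} {j : ℤ} {k' k₁ : Fin n → ℤ} {x : RSpace n}
    (hx : x ∈ dyadicCube (j - 1 + δ) (fineIndex δ k' k₁)) (a : Fin n) :
    |(2 : ℝ) ^ (j - 1) * x a - k₁ a| ≤ ‖k'‖ + 1 := by
  have h := hx a
  rw [zpow_add₀ two_ne_zero, zpow_natCast] at h
  simp only [fineIndex, Set.mem_Ico] at h
  push_cast at h
  have hδ : (1 : ℝ) ≤ 2 ^ δ := one_le_pow₀ one_le_two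
  have hk := abs_le.1 (abs_intCast_le_norm k' a)
  set y := (2 : ℝ) ^ (j - 1) * x a - k₁ a with hy
  have hb : |2 ^ δ * y| ≤ ‖k'‖ + 1 := by
    have : (2 : ℝ) ^ δ * y = 2 ^ (j - 1) * 2 ^ δ * x a - 2 ^ δ * k₁ a := by rw [hy]; ring
    rw [abs_le]
    constructor <;> linarith [h.1, h.2]
  rw [abs_mul, abs_of_pos (by positivity)] at hb
  nlinarith [abs_nonneg y]

/-- After rescaling by `2^(j-1)`, both cubes are close to `k₁`: the target within `1`, the source
within `‖k'‖ + 1`. The factor `s` is the scale at which the distance will be measured. -/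
theorem abs_sub_le_of_mem {e : Fin n → Fin 2} {δ : ℕ} {j : ℤ} {k' k₁ : Fin n → ℤ} {x y : RSpace n}
    (hx : x ∈ dyadicCube j (parityIndex e k₁))
    (hy : y ∈ dyadicCube (j - 1 + δ) (fineIndex δ k' k₁)) (a : Fin n) {s b : ℝ} (hs : 0 < s)
    (hsb : s ≤ b * 2 ^ (j - 1)) : |s * x a - s * y a| ≤ b * (‖k'‖ + 2) := by
  have h1 := parityIndex_mem hx a
  have h2 := abs_le.1 (fineIndex_mem hy a)
  have h3 : |(2 : ℝ) ^ (j - 1) * x a - 2 ^ (j - 1) * y a| ≤ ‖k'‖ + 2 := by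
    rw [abs_le]
    constructor <;> linarith [h1.1, h1.2, h2.1, h2.2]
  have h2j : (0 : ℝ) < 2 ^ (j - 1) := by positivity
  rw [← mul_sub, abs_mul, abs_of_pos h2j] at h3
  rw [← mul_sub, abs_mul, abs_of_pos hs]
  have hb : 0 < b := by
    by_contra! hb
    nlinarith
  calc s * |x a - y a| ≤ b * 2 ^ (j - 1) * |x a - y a| := by gcongr
    _ = b * (2 ^ (j - 1) * |x a - y a|) := by ring
    _ ≤ _ := by gcongr

/-- This and the mirrored inclusion below verify the dilate hypotheses of the comparison theorem.
Since `j' ≤ j` and `δ ≤ 2`, the scale ratio is at most `4`, so the displacement is at most `4 (‖k'‖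
+ 2)`. The point inside the source cube adds less than `1`, and `4 (‖k'‖ + 3)` suffices. -/
theorem parityIndex_subset_scaledBox [NeZero n] {e : Fin n → Fin 2} {δ : ℕ} (hδ : δ ≤ 2)
    {k' : Fin n → ℤ} {j j' : ℤ} {k₁ k₂ : Fin n → ℤ}
    (h : dyadicCube (j - 1 + δ) (fineIndex δ k' k₁) ⊆ dyadicCube (j' - 1 + δ) (fineIndex δ k' k₂)) :
    dyadicCube j (parityIndex e k₁) ⊆ scaledBox (j' - 1 + δ) (fineIndex δ k' k₂)
      (-(4 * (‖k'‖ + 3))) (4 * (‖k'‖ + 3)) := by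
  intro x hx a
  obtain ⟨y, hy⟩ := dyadicCube_nonempty (j - 1 + δ) (fineIndex δ k' k₁)
  have hj : j' ≤ j := by linarith [scale_le_of_dyadicCube_subset h]
  have hy' := h hy a
  have hsb : (2 : ℝ) ^ (j' - 1 + δ) ≤ 4 * 2 ^ (j - 1) := by
    rw [show (4 : ℝ) = 2 ^ (2 : ℤ) by norm_num, ← zpow_add₀ two_ne_zero]
    exact zpow_le_zpow_right₀ one_le_two (by omega)
  have := abs_le.1 (abs_sub_le_of_mem hx hy a (by positivity) hsb)
  rw [Set.mem_Ico] at *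
  constructor <;> linarith [hy'.1, hy'.2, this.1, this.2]

theorem fineIndex_subset_scaledBox [NeZero n] {e : Fin n → Fin 2} {δ : ℕ}
    {k' : Fin n → ℤ} {j j' : ℤ} {k₁ k₂ : Fin n → ℤ}
    (h : dyadicCube j (parityIndex e k₁) ⊆ dyadicCube j' (parityIndex e k₂)) :
    dyadicCube (j - 1 + δ) (fineIndex δ k' k₁) ⊆ scaledBox j' (parityIndex e k₂)
      (-(4 * (‖k'‖ + 3))) (4 * (‖k'‖ + 3)) := by
  intro y hy a
  obtain ⟨x, hx⟩ := dyadicCube_nonempty j (parityIndex e k₁)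
  have hj : j' ≤ j := scale_le_of_dyadicCube_subset h
  have hx' := h hx a
  have hsb : (2 : ℝ) ^ j' ≤ 2 * 2 ^ (j - 1) := by
    rw [mul_comm, ← zpow_add_one₀ two_ne_zero, sub_add_cancel]
    exact zpow_le_zpow_right₀ one_le_two hj
  have := abs_le.1 (abs_sub_le_of_mem hx hy a (by positivity) hsb)
  rw [Set.mem_Ico] at *
  have hk := norm_nonneg k'
  constructor <;> linarith [hx'.1, hx'.2, this.1, this.2]

/-- The cubes at scale `J - 2` that can contain the cubes near a cube of the dyadic cube `Q_{J,K}`. -/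
noncomputable def nearbyIndices (K k' : Fin n → ℤ) : Finset (Fin n → ℤ) :=
  Fintype.piFinset fun a => Finset.Icc (K a / 4 - (⌈‖k'‖⌉₊ + 4)) (K a / 4 + (⌈‖k'‖⌉₊ + 4))

theorem card_nearbyIndices_le (K k' : Fin n → ℤ) :
    ((nearbyIndices K k').card : ℝ≥0∞) ≤ 11 ^ n * latticeWeight k' ^ n := by
  unfold nearbyIndices
  rw [Fintype.card_piFinset]
  have : ∀ a, (Finset.Icc (K a / 4 - (⌈‖k'‖⌉₊ + 4 : ℤ)) (K a / 4 + (⌈‖k'‖⌉₊ + 4))).card =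
      2 * ⌈‖k'‖⌉₊ + 9 := by
    intro a
    rw [Int.card_Icc]
    omega
  simp only [this, Finset.prod_const, Finset.card_univ, Fintype.card_fin]
  push_cast
  rw [← mul_pow]
  gcongr
  have h1 : (2 * (⌈‖k'‖⌉₊ : ℝ) + 9) ≤ 11 * (1 + ‖k'‖) := by
    have := (Nat.ceil_lt_add_one (norm_nonneg k')).le
    linarith [norm_nonneg k']
  have h2 := ENNReal.ofReal_le_ofReal h1
  rw [ENNReal.ofReal_mul (by norm_num), ENNReal.ofReal_add (by positivity) (by norm_num),
    ENNReal.ofReal_mul (by norm_num)] at h2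
  simpa [latticeWeight] using h2

/-- A source cube has level at least `J - 1`. Level `J - 2` is chosen for the enclosing cube so that
every source level is strictly finer than it; the second norm, whose sum omits the level of the big
cube, needs this. -/
theorem exists_nearbyIndices [NeZero n] {e : Fin n → Fin 2} {δ : ℕ} {K k' k₁ : Fin n → ℤ}
    {J j : ℤ} (h : dyadicCube j (parityIndex e k₁) ⊆ dyadicCube J K) :
    ∃ w ∈ nearbyIndices K k',
      dyadicCube (j - 1 + δ) (fineIndex δ k' k₁) ⊆ dyadicCube (J - 2) w := by
  have hj : J ≤ j := scale_le_of_dyadicCube_subset h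
  obtain ⟨x, hx⟩ := dyadicCube_nonempty j (parityIndex e k₁)
  obtain ⟨y, hy⟩ := dyadicCube_nonempty (j - 1 + δ) (fineIndex δ k' k₁)
  refine ⟨fun a => ⌊(2 : ℝ) ^ (J - 2) * y a⌋, ?_, dyadicCube_subset_of_mem (by omega) hy
    (mem_dyadicCube_iff.2 fun _ => rfl)⟩
  unfold nearbyIndices
  rw [Fintype.mem_piFinset]
  intro a
  have hxa := h hx a
  have hsb : (2 : ℝ) ^ (J - 2) ≤ 1 * 2 ^ (j - 1) := by
    rw [one_mul]
    exact zpow_le_zpow_right₀ one_le_two (by omega)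
  have hd := abs_le.1 (abs_sub_le_of_mem hx hy a (by positivity) hsb)
  have h4 : (2 : ℝ) ^ J = 4 * 2 ^ (J - 2) := by
    rw [show (4 : ℝ) = 2 ^ (2 : ℤ) by norm_num, ← zpow_add₀ two_ne_zero]
    congr 1
    ring
  rw [h4, Set.mem_Ico] at hxa
  have hR := Nat.le_ceil ‖k'‖
  have hK : (4 * (K a / 4 : ℤ) : ℝ) ≤ K a ∧ (K a : ℝ) < 4 * (K a / 4 : ℤ) + 4 := by
    constructor
    · exact_mod_cast (by omega : 4 * (K a / 4) ≤ K a)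
    · exact_mod_cast (by omega : K a < 4 * (K a / 4) + 4)
  rw [Finset.mem_Icc]
  constructor
  · rw [Int.le_floor]
    push_cast
    linarith [hxa.1, hxa.2, hd.1, hd.2, hK.1, hK.2]
  · refine Int.lt_add_one_iff.1 (Int.floor_lt.2 ?_)
    push_cast
    linarith [hxa.1, hxa.2, hd.1, hd.2, hK.1, hK.2]

theorem NestedFamily.dyadicCube {ι : Type*} (s : ι → ℤ) (k : ι → Fin n → ℤ) :
    NestedFamily s fun i => _root_.dyadicCube (s i) (k i) := fun _ _ _ h hx hx' =>
  dyadicCube_subset_of_mem h hx hx'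

open Classical in
/-- The function `∑_{Q_{j,k} ⊆ Q_{J,K}} c^ε_{j,k} χ(2^j x - k)`. -/
noncomputable def localSum (J : ℤ) (K : Fin n → ℤ)
    (c : {ε : Fin n → Fin 2 // ε ≠ 0} → ℤ → (Fin n → ℤ) → ℝ≥0∞) (x : RSpace n) : ℝ≥0∞ :=
  ∑' (ε : {ε : Fin n → Fin 2 // ε ≠ 0}) (j : ℤ) (k : Fin n → ℤ),
    if dyadicCube j k ⊆ dyadicCube J K then
      c ε j k * (dyadicCube j k).indicator (fun _ => 1) x
    else 0

open Classical in
theorem measurable_localSum (J : ℤ) (K : Fin n → ℤ)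
    (c : {ε : Fin n → Fin 2 // ε ≠ 0} → ℤ → (Fin n → ℤ) → ℝ≥0∞) : Measurable (localSum J K c) := by
  unfold localSum
  refine Measurable.tsum fun ε => Measurable.tsum fun j =>
    Measurable.tsum fun k => ?_
  split_ifs
  · exact measurable_const.mul (measurable_const.indicator (measurableSet_dyadicCube j k))
  · exact measurable_const

open Classical in
/-- The weight that a single off-diagonal moves from a source cube to the cube
`Q_{j, 2k₁+e}`, if the latter is contained in `Q_{J,K}`. -/
noncomputable def shiftedCoeff (J : ℤ) (K : Fin n → ℤ)
    (c : ℤ → (Fin n → ℤ) → ℝ≥0∞) (e : Fin n → Fin 2) (δ : ℕ) (k' : Fin n → ℤ)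
    (i : ℤ × (Fin n → ℤ)) : ℝ≥0∞ :=
  if dyadicCube i.1 (parityIndex e i.2) ⊆ dyadicCube J K then
    c (i.1 - 1 + δ) (fineIndex δ k' i.2) else 0

/-- The contribution to `Q_{J,K}` of a single off-diagonal of the almost diagonal operator. -/
noncomputable def shiftedSum (J : ℤ) (K : Fin n → ℤ)
    (c : ℤ → (Fin n → ℤ) → ℝ≥0∞) (e : Fin n → Fin 2) (δ : ℕ) (k' : Fin n → ℤ)
    (x : RSpace n) : ℝ≥0∞ :=
  ∑' i : ℤ × (Fin n → ℤ), (dyadicCube i.1 (parityIndex e i.2)).indicator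
    (fun _ => shiftedCoeff J K c e δ k' i) x

theorem measurable_shiftedSum (J : ℤ) (K : Fin n → ℤ)
    (c : ℤ → (Fin n → ℤ) → ℝ≥0∞) (e : Fin n → Fin 2) (δ : ℕ) (k' : Fin n → ℤ) :
    Measurable (shiftedSum J K c e δ k') := by
  unfold shiftedSum
  exact Measurable.tsum fun i =>
    measurable_const.indicator (measurableSet_dyadicCube _ _)

/-- The source cubes of a single off-diagonal, with the weights used by `shiftedSum`. -/
noncomputable def sourceSum (J : ℤ) (K : Fin n → ℤ)
    (c : ℤ → (Fin n → ℤ) → ℝ≥0∞) (e : Fin n → Fin 2) (δ : ℕ) (k' : Fin n → ℤ)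
    (x : RSpace n) : ℝ≥0∞ :=
  ∑' i : ℤ × (Fin n → ℤ), (dyadicCube (i.1 - 1 + δ) (fineIndex δ k' i.2)).indicator
    (fun _ => shiftedCoeff J K c e δ k' i) x

/-- The two sums carry the same weights on cubes of comparable size, so the comparison theorem moves
the weights from targets to sources. The constant is polynomial in `‖k'‖`. -/
theorem lintegral_shiftedSum_le_sourceSum [NeZero n] {s : ℝ} (hs : 0 < s) (J : ℤ) (K : Fin n → ℤ)
    (c : ℤ → (Fin n → ℤ) → ℝ≥0∞) (e : Fin n → Fin 2) {δ : ℕ} (hδ : δ ≤ 2) (k' : Fin n → ℤ) :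
    ∫⁻ x, shiftedSum J K c e δ k' x ^ s ≤
      comparisonConst s * (ENNReal.ofReal (2 * (4 * (‖k'‖ + 3))) ^ n) ^ (2 * s + 1) *
        ∫⁻ x, sourceSum J K c e δ k' x ^ s := by
  have hr : 0 ≤ 4 * (‖k'‖ + 3) := by positivity
  set r := 4 * (‖k'‖ + 3) with hrdef
  let A : ℤ × (Fin n → ℤ) → Set (RSpace n) :=
    fun i => dyadicCube (i.1 - 1 + δ) (fineIndex δ k' i.2)
  let B : ℤ × (Fin n → ℤ) → Set (RSpace n) := fun i => dyadicCube i.1 (parityIndex e i.2)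
  let D : ℤ × (Fin n → ℤ) → Set (RSpace n) :=
    fun i => scaledBox (i.1 - 1 + δ) (fineIndex δ k' i.2) (-r) r
  let E : ℤ × (Fin n → ℤ) → Set (RSpace n) := fun i => scaledBox i.1 (parityIndex e i.2) (-r) r
  have hA : NestedFamily (fun i : ℤ × (Fin n → ℤ) => i.1 - 1 + δ) A := NestedFamily.dyadicCube _ _
  have hB : NestedFamily (fun i : ℤ × (Fin n → ℤ) => i.1) B := NestedFamily.dyadicCube _ _
  have hAm : ∀ i, MeasurableSet (A i) := fun i => measurableSet_dyadicCube _ _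
  have hBm : ∀ i, MeasurableSet (B i) := fun i => measurableSet_dyadicCube _ _
  have hA0 : ∀ i, volume (A i) ≠ 0 := fun i => volume_dyadicCube_ne_zero _ _
  have hB0 : ∀ i, volume (B i) ≠ ⊤ := fun i => volume_dyadicCube_ne_top _ _
  have hD : ∀ i i', A i ⊆ A i' → B i ⊆ D i' := fun i i' h => parityIndex_subset_scaledBox hδ h
  have hE : ∀ i i', B i ⊆ B i' → A i ⊆ E i' := fun i i' h => fineIndex_subset_scaledBox h
  have hDμ : ∀ i, volume (D i) ≤ ENNReal.ofReal (2 * r) ^ n * volume (A i) := fun i =>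
    (volume_scaledBox_eq_mul _ _ hr).le
  have hEμ : ∀ i, volume (E i) ≤ ENNReal.ofReal (2 * r) ^ n * volume (B i) := fun i =>
    (volume_scaledBox_eq_mul _ _ hr).le
  have hΛ : 1 ≤ ENNReal.ofReal (2 * r) ^ n := by
    refine one_le_pow₀ ?_
    rw [ENNReal.one_le_ofReal]
    linarith [norm_nonneg k']
  exact lintegral_tsum_indicator_rpow_le hA hB hAm hBm hA0 hB0
    (ENNReal.pow_ne_top ENNReal.ofReal_ne_top) hΛ hD hDμ hE hEμ (shiftedCoeff J K c e δ k') hs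

-- Each source cube is assigned to a nearby big cube that contains it, and injectivity of the source
-- index prevents repetition.
open Classical in
theorem sourceSum_le [NeZero n] (J : ℤ) (K : Fin n → ℤ)
    (c : {ε : Fin n → Fin 2 // ε ≠ 0} → ℤ → (Fin n → ℤ) → ℝ≥0∞)
    (ε : {ε : Fin n → Fin 2 // ε ≠ 0}) (e : Fin n → Fin 2) (δ : ℕ) (k' : Fin n → ℤ)
    (x : RSpace n) :
    sourceSum J K (c ε) e δ k' x ≤ ∑ w ∈ nearbyIndices K k', localSum (J - 2) w c x := by
  set g : (Fin n → ℤ) → ℤ × (Fin n → ℤ) → ℝ≥0∞ := fun w i =>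
    if dyadicCube i.1 i.2 ⊆ dyadicCube (J - 2) w then
      c ε i.1 i.2 * (dyadicCube i.1 i.2).indicator (fun _ => 1) x else 0 with hg
  calc _ ≤ ∑' i : ℤ × (Fin n → ℤ), ∑ w ∈ nearbyIndices K k',
        g w (i.1 - 1 + δ, fineIndex δ k' i.2) := by
        refine ENNReal.tsum_le_tsum fun i => ?_
        unfold shiftedCoeff
        by_cases hi : dyadicCube i.1 (parityIndex e i.2) ⊆ dyadicCube J K
        · obtain ⟨w, hw, hsub⟩ := exists_nearbyIndices (δ := δ) (k' := k') hi
          refine le_trans (le_of_eq ?_) (Finset.single_le_sum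
            (f := fun w => g w (i.1 - 1 + δ, fineIndex δ k' i.2)) (fun _ _ => zero_le) hw)
          simp only [hg, hsub, hi, if_true]
          by_cases hx : x ∈ dyadicCube (i.1 - 1 + δ) (fineIndex δ k' i.2) <;> simp [hx]
        · simp [hi]
    _ = ∑ w ∈ nearbyIndices K k', ∑' i : ℤ × (Fin n → ℤ),
        g w (i.1 - 1 + δ, fineIndex δ k' i.2) :=
        Summable.tsum_finsetSum fun _ _ => ENNReal.summable
    _ ≤ ∑ w ∈ nearbyIndices K k', ∑' i : ℤ × (Fin n → ℤ), g w i :=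
        Finset.sum_le_sum fun w _ =>
          ENNReal.tsum_comp_le_tsum_of_injective (fineIndex_injective δ k') (g w)
    _ ≤ _ := by
        refine Finset.sum_le_sum fun w _ => ?_
        rw [ENNReal.tsum_prod']
        exact ENNReal.le_tsum (f := fun ε => ∑' (j : ℤ) (k : Fin n → ℤ),
          if dyadicCube j k ⊆ dyadicCube (J - 2) w then
            c ε j k * (dyadicCube j k).indicator (fun _ => 1) x else 0) ε

/-- In the exponent `s + 1`, the part `s` comes from the power of a sum of `W.card` terms and the
`1` from adding their integrals. -/
theorem lintegral_sum_localSum_rpow_le {s : ℝ} (hs : 0 < s) (J : ℤ) (W : Finset (Fin n → ℤ))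
    (c : {ε : Fin n → Fin 2 // ε ≠ 0} → ℤ → (Fin n → ℤ) → ℝ≥0∞) {Y : ℝ≥0∞}
    (hY : ∀ w, ∫⁻ x, localSum J w c x ^ s ≤ Y) :
    ∫⁻ x, (∑ w ∈ W, localSum J w c x) ^ s ≤ (W.card : ℝ≥0∞) ^ (s + 1) * Y := by
  calc _ ≤ ∫⁻ x, (W.card : ℝ≥0∞) ^ s * ∑ w ∈ W, localSum J w c x ^ s :=
        lintegral_mono fun x => Finset.rpow_sum_le_card_mul_sum_rpow hs _ _
    _ = (W.card : ℝ≥0∞) ^ s * ∑ w ∈ W, ∫⁻ x, localSum J w c x ^ s := by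
        rw [lintegral_const_mul _ (Finset.measurable_fun_sum _ fun w _ =>
          (measurable_localSum _ w c).pow_const s),
          lintegral_finsetSum _ fun w _ => (measurable_localSum _ w c).pow_const s]
    _ ≤ (W.card : ℝ≥0∞) ^ s * ∑ w ∈ W, Y := by
        gcongr with w
        exact hY w
    _ = _ := by
        rw [Finset.sum_const, nsmul_eq_mul, ← mul_assoc,
          ENNReal.rpow_add_of_nonneg _ _ hs.le zero_le_one, ENNReal.rpow_one]

/-- Both losses, the dilation of cubes and the number of nearby big cubes, are powers of
`latticeWeight k'`. Only such a polynomial rate matters, since the matrix decay can be taken faster.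
-/
theorem lintegral_shiftedSum_rpow_le [NeZero n] {s : ℝ} (hs : 0 < s) :
    ∃ C : ℝ≥0∞, C ≠ ⊤ ∧ ∃ M : ℝ, ∀ (J : ℤ) (K : Fin n → ℤ)
      (c : {ε : Fin n → Fin 2 // ε ≠ 0} → ℤ → (Fin n → ℤ) → ℝ≥0∞) (Y : ℝ≥0∞)
      (_ : ∀ w, ∫⁻ x, localSum (J - 2) w c x ^ s ≤ Y) (ε : {ε : Fin n → Fin 2 // ε ≠ 0})
      (e : Fin n → Fin 2) (δ : ℕ) (_ : δ ≤ 2) (k' : Fin n → ℤ),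
      ∫⁻ x, shiftedSum J K (c ε) e δ k' x ^ s ≤ C * latticeWeight k' ^ M * Y := by
  have hs1 : 0 ≤ 2 * s + 1 := by linarith
  have hs2 : 0 ≤ s + 1 := by linarith
  refine ⟨comparisonConst s * (24 ^ n) ^ (2 * s + 1) * (11 ^ n) ^ (s + 1), ?_,
    n * (2 * s + 1) + n * (s + 1), ?_⟩
  · refine ENNReal.mul_ne_top (ENNReal.mul_ne_top (comparisonConst_ne_top hs) ?_) ?_
    · exact ENNReal.rpow_ne_top_of_nonneg hs1 (ENNReal.pow_ne_top (by simp))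
    · exact ENNReal.rpow_ne_top_of_nonneg hs2 (ENNReal.pow_ne_top (by simp))
  intro J K c Y hY ε e δ hδ k'
  have hΛw : ENNReal.ofReal (2 * (4 * (‖k'‖ + 3))) ≤ 24 * latticeWeight k' := by
    rw [latticeWeight, show (24 : ℝ≥0∞) = ENNReal.ofReal 24 by simp,
      ← ENNReal.ofReal_mul (by norm_num)]
    exact ENNReal.ofReal_le_ofReal (by linarith [norm_nonneg k'])
  have hwpow : ∀ r : ℝ, (latticeWeight k' ^ n) ^ r = latticeWeight k' ^ (n * r) := fun r => by
    rw [← ENNReal.rpow_natCast, ← ENNReal.rpow_mul]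
  have h3 : ∫⁻ x, sourceSum J K (c ε) e δ k' x ^ s ≤ (11 ^ n * latticeWeight k' ^ n) ^ (s + 1) * Y :=
    (lintegral_mono fun x => ENNReal.rpow_le_rpow (sourceSum_le J K c ε e δ k' x) hs.le).trans
      ((lintegral_sum_localSum_rpow_le hs _ _ c hY).trans (mul_le_mul_left
        (ENNReal.rpow_le_rpow (card_nearbyIndices_le K k') hs2) _))
  calc _ ≤ _ := lintegral_shiftedSum_le_sourceSum hs J K (c ε) e hδ k'
    _ ≤ comparisonConst s * ((24 * latticeWeight k') ^ n) ^ (2 * s + 1) *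
        ((11 ^ n * latticeWeight k' ^ n) ^ (s + 1) * Y) :=
      mul_le_mul' (mul_le_mul_right (ENNReal.rpow_le_rpow (pow_le_pow_left₀ zero_le hΛw n) hs1) _) h3
    _ = _ := by
      rw [mul_pow, ENNReal.mul_rpow_of_nonneg _ _ hs1, ENNReal.mul_rpow_of_nonneg _ _ hs2,
        hwpow, hwpow, ENNReal.rpow_add (n * (2 * s + 1)) _
          (zero_lt_one.trans_le (one_le_latticeWeight k')).ne' (latticeWeight_ne_top k')]
      ring

end AlmostDiagonal

/-! ### Summation of the off-diagonals. -/

section AlmostDiagonalBound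

open MeasureTheory

variable {n : ℕ}

/-- Index set for the off-diagonals of the almost diagonal operator: the type `ε'` of the source
wavelet, its relative scale `δ` and its relative position `k'`. -/
abbrev OffDiagonal (n : ℕ) : Type :=
  {ε : Fin n → Fin 2 // ε ≠ 0} × Fin 3 × (Fin n → ℤ)

theorem tsum_offDiagonal_ne_top {f : (Fin n → ℤ) → ℝ≥0∞} (hf : ∑' k, f k ≠ ⊤) :
    ∑' τ : OffDiagonal n, f τ.2.2 ≠ ⊤ := by
  rw [ENNReal.tsum_prod', tsum_fintype]
  refine ENNReal.sum_ne_top.2 fun ε _ => ?_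
  rw [ENNReal.tsum_prod', tsum_fintype]
  exact ENNReal.sum_ne_top.2 fun δ _ => hf

theorem tsum_parity_offDiagonal_ne_top {f : (Fin n → ℤ) → ℝ≥0∞} (hf : ∑' k, f k ≠ ⊤) :
    ∑' σ : (Fin n → Fin 2) × OffDiagonal n, f σ.2.2.2 ≠ ⊤ := by
  rw [ENNReal.tsum_prod', tsum_fintype]
  exact ENNReal.sum_ne_top.2 fun ε _ => tsum_offDiagonal_ne_top hf

-- The target cubes are grouped by the residue of their position modulo 2. The bound does not depend
-- on the type `ε` of the target wavelet, whence the cardinality factor.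
open Classical in
theorem localSum_le_tsum_shiftedSum [NeZero n] {N : ℕ} {C : ℝ≥0∞} {J : ℤ} {K : Fin n → ℤ}
    {c d : {ε : Fin n → Fin 2 // ε ≠ 0} → ℤ → (Fin n → ℤ) → ℝ≥0∞}
    (hd : ∀ ε j, J ≤ j → ∀ e k₁, d ε j (parityIndex e k₁) ≤ C * ∑' τ : OffDiagonal n,
      (latticeWeight τ.2.2)⁻¹ ^ N * c τ.1 (j - 1 + (τ.2.1 : ℕ)) (fineIndex τ.2.1 τ.2.2 k₁))
    (x : RSpace n) :
    localSum J K d x ≤ (Fintype.card {ε : Fin n → Fin 2 // ε ≠ 0} : ℝ≥0∞) *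
      ∑' σ : (Fin n → Fin 2) × OffDiagonal n, C * (latticeWeight σ.2.2.2)⁻¹ ^ N *
        shiftedSum J K (c σ.2.1) σ.1 σ.2.2.1 σ.2.2.2 x := by
  set Z := ∑' σ : (Fin n → Fin 2) × OffDiagonal n, C * (latticeWeight σ.2.2.2)⁻¹ ^ N *
        shiftedSum J K (c σ.2.1) σ.1 σ.2.2.1 σ.2.2.2 x with hZ
  have key : ∀ ε : {ε : Fin n → Fin 2 // ε ≠ 0}, (∑' (j : ℤ) (k : Fin n → ℤ),
      if dyadicCube j k ⊆ dyadicCube J K then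
        d ε j k * (dyadicCube j k).indicator (fun _ => 1) x else 0) ≤ Z := by
    intro ε
    set G : (Fin n → Fin 2) → OffDiagonal n → ℤ × (Fin n → ℤ) → ℝ≥0∞ := fun e τ i =>
      C * (latticeWeight τ.2.2)⁻¹ ^ N * (dyadicCube i.1 (parityIndex e i.2)).indicator
        (fun _ => shiftedCoeff J K (c τ.1) e τ.2.1 τ.2.2 i) x with hG
    calc _ ≤ ∑' (j : ℤ) (p : (Fin n → Fin 2) × (Fin n → ℤ)), ∑' τ, G p.1 τ (j, p.2) := by
          refine ENNReal.tsum_le_tsum fun j => ?_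
          refine (ENNReal.tsum_le_tsum_comp_of_surjective parityIndex_surjective _).trans ?_
          refine ENNReal.tsum_le_tsum fun p => ?_
          by_cases hsub : dyadicCube j (parityIndex p.1 p.2) ⊆ dyadicCube J K
          · by_cases hx : x ∈ dyadicCube j (parityIndex p.1 p.2)
            · have := hd ε j (scale_le_of_dyadicCube_subset hsub) p.1 p.2
              rw [← ENNReal.tsum_mul_left] at this
              simpa [hsub, hx, hG, shiftedCoeff, mul_assoc] using this
            · simp [hx]
          · simp [hsub]
      _ = ∑' (e : Fin n → Fin 2) (τ : OffDiagonal n) (i : ℤ × (Fin n → ℤ)), G e τ i := by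
          simp_rw [ENNReal.tsum_prod' (α := Fin n → Fin 2)]
          rw [ENNReal.tsum_comm]
          refine tsum_congr fun e => ?_
          rw [ENNReal.tsum_comm (α := OffDiagonal n), ENNReal.tsum_prod']
      _ = Z := by
          rw [hZ, ENNReal.tsum_prod']
          refine tsum_congr fun e => tsum_congr fun τ => ?_
          simp only [hG, ENNReal.tsum_mul_left, shiftedSum]
  unfold localSum
  refine (ENNReal.tsum_le_tsum key).trans (le_of_eq ?_)
  rw [tsum_fintype, Finset.sum_const, nsmul_eq_mul, Finset.card_univ]

/-- The decay `N₀ + N₂` is shared out: `N₀` supplies the summable weights in the triangle inequality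
for the power `s`, while `N₂` beats the growth `M` of a single off-diagonal and leaves another
summable factor. -/
theorem lintegral_localSum_rpow_le [NeZero n] {s : ℝ} (hs : 0 < s) :
    ∃ N : ℕ, ∀ C : ℝ≥0∞, C ≠ ⊤ → ∃ C' : ℝ≥0∞, C' ≠ ⊤ ∧ ∀ (J : ℤ) (K : Fin n → ℤ)
    (c d : {ε : Fin n → Fin 2 // ε ≠ 0} → ℤ → (Fin n → ℤ) → ℝ≥0∞) (Y : ℝ≥0∞)
    (_ : ∀ ε j, J ≤ j → ∀ e k₁, d ε j (parityIndex e k₁) ≤ C * ∑' τ : OffDiagonal n,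
      (latticeWeight τ.2.2)⁻¹ ^ N * c τ.1 (j - 1 + (τ.2.1 : ℕ)) (fineIndex τ.2.1 τ.2.2 k₁))
    (_ : ∀ w, ∫⁻ x, localSum (J - 2) w c x ^ s ≤ Y),
    ∫⁻ x, localSum J K d x ^ s ≤ C' * Y := by
  obtain ⟨N₀, hN₀⟩ := tsum_latticeWeight_ne_top n
  obtain ⟨C₁, hC₁, M, hM⟩ := lintegral_shiftedSum_rpow_le (n := n) hs
  -- The decay `N₂` is later raised to the power `s`, so `N₂ * s ≥ M + N₀` is what is required.
  set N₂ : ℕ := ⌈(M + N₀) / s⌉₊ with hN₂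
  have hN₂s : M + N₀ ≤ N₂ * s := by
    have := Nat.le_ceil ((M + N₀) / s)
    rwa [div_le_iff₀ hs] at this
  refine ⟨N₀ + N₂, fun C hC => ?_⟩
  set κ : (Fin n → Fin 2) × OffDiagonal n → ℝ≥0∞ := fun σ => (latticeWeight σ.2.2.2)⁻¹ ^ N₀
    with hκ
  set B : ℝ≥0∞ := (Fintype.card {ε : Fin n → Fin 2 // ε ≠ 0} : ℝ≥0∞) with hB
  refine ⟨B ^ s * (∑' σ, κ σ) ^ s * (C ^ s * C₁ * ∑' σ, κ σ), ?_, ?_⟩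
  · have hκtop : ∑' σ, κ σ ≠ ⊤ :=
      tsum_parity_offDiagonal_ne_top (f := fun k => (latticeWeight k)⁻¹ ^ N₀) hN₀
    refine ENNReal.mul_ne_top (ENNReal.mul_ne_top ?_ ?_) (ENNReal.mul_ne_top
      (ENNReal.mul_ne_top ?_ hC₁) hκtop)
    · exact ENNReal.rpow_ne_top_of_nonneg hs.le (by simp [hB])
    · exact ENNReal.rpow_ne_top_of_nonneg hs.le hκtop
    · exact ENNReal.rpow_ne_top_of_nonneg hs.le hC
  intro J K c d Y hd hY
  set S : (Fin n → Fin 2) × OffDiagonal n → RSpace n → ℝ≥0∞ := fun σ =>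
    shiftedSum J K (c σ.2.1) σ.1 σ.2.2.1 σ.2.2.2 with hS
  have hSm : ∀ σ, Measurable (S σ) := fun σ => measurable_shiftedSum _ _ _ _ _ _
  have hpt : ∀ x, localSum J K d x ^ s ≤ B ^ s * (∑' σ, κ σ) ^ s *
      ∑' σ, C ^ s * ((latticeWeight σ.2.2.2)⁻¹ ^ N₂) ^ s * S σ x ^ s := by
    intro x
    refine (ENNReal.rpow_le_rpow (localSum_le_tsum_shiftedSum hd x) hs.le).trans ?_
    rw [ENNReal.mul_rpow_of_nonneg _ _ hs.le, mul_assoc]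
    gcongr
    refine le_trans (le_of_eq ?_) ((ENNReal.rpow_tsum_mul_le hs κ
      fun σ => C * (latticeWeight σ.2.2.2)⁻¹ ^ N₂ * S σ x).trans (le_of_eq ?_))
    · congr 1
      refine tsum_congr fun σ => ?_
      rw [hκ, pow_add]
      ring
    · congr 1
      refine tsum_congr fun σ => ?_
      rw [ENNReal.mul_rpow_of_nonneg _ _ hs.le, ENNReal.mul_rpow_of_nonneg _ _ hs.le]
  refine (lintegral_mono hpt).trans ?_
  rw [lintegral_const_mul _ (Measurable.tsum fun σ => ((hSm σ).pow_const s).const_mul _),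
    lintegral_tsum fun σ => (((hSm σ).pow_const s).const_mul _).aemeasurable, mul_assoc _ _ Y]
  gcongr _ * ?_
  rw [mul_assoc, mul_comm _ Y, ← mul_assoc _ Y, ← ENNReal.tsum_mul_left]
  refine ENNReal.tsum_le_tsum fun σ => ?_
  rw [lintegral_const_mul _ ((hSm σ).pow_const s)]
  set w := latticeWeight σ.2.2.2 with hw
  have hw1 : 1 ≤ w := one_le_latticeWeight _
  have hw0 : w ≠ 0 := (zero_lt_one.trans_le hw1).ne'
  have hwt : w ≠ ⊤ := latticeWeight_ne_top _
  have hpow : (w⁻¹ ^ N₂) ^ s * w ^ M ≤ w⁻¹ ^ N₀ := by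
    rw [← ENNReal.rpow_natCast, ← ENNReal.rpow_mul, ← ENNReal.rpow_natCast, ENNReal.inv_rpow,
      ENNReal.inv_rpow, ← ENNReal.rpow_neg, ← ENNReal.rpow_neg, ← ENNReal.rpow_add _ _ hw0 hwt]
    exact ENNReal.rpow_le_rpow_of_exponent_le hw1 (by linarith)
  calc C ^ s * (w⁻¹ ^ N₂) ^ s * ∫⁻ x, S σ x ^ s
      ≤ C ^ s * (w⁻¹ ^ N₂) ^ s * (C₁ * w ^ M * Y) := by
        gcongr
        exact hM J K c Y hY _ _ _ (by omega) _
    _ = C ^ s * (C₁ * Y) * ((w⁻¹ ^ N₂) ^ s * w ^ M) := by ring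
    _ ≤ C ^ s * (C₁ * Y) * w⁻¹ ^ N₀ := by gcongr
    _ = _ := by
      simp only [hκ, ← hw]
      ring

theorem localNorm_eq (p q γ₂ : ℝ) (J : ℤ) (K : Fin n → ℤ)
    (c : {ε : Fin n → Fin 2 // ε ≠ 0} → ℤ → (Fin n → ℤ) → ℝ≥0∞) : localNorm p q γ₂ J K c =
    ENNReal.ofReal (((2 : ℝ) ^ (-((n : ℝ) * J))) ^ (γ₂ / n - 1 / p)) *
      (∫⁻ x, localSum J K c x ^ (p / q)) ^ (1 / p) := by
  have : ∀ x, localSum J K c x ^ (p / q) = (localSum J K c x ^ (1 / q)) ^ p := fun x => by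
    rw [← ENNReal.rpow_mul]
    congr 1
    ring
  simp_rw [this]
  rfl

/-- Boundedness of almost diagonal operators for the local norms. -/
theorem localNorm_le_of_almostDiagonal [NeZero n] {p q : ℝ} (hp : 0 < p) (hq : 0 < q) (γ₂ : ℝ) :
    ∃ N : ℕ, ∀ C : ℝ≥0∞, C ≠ ⊤ → ∃ C' : ℝ≥0∞, C' ≠ ⊤ ∧ ∀ (J : ℤ) (K : Fin n → ℤ)
    (c d : {ε : Fin n → Fin 2 // ε ≠ 0} → ℤ → (Fin n → ℤ) → ℝ≥0∞) (X : ℝ≥0∞)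
    (_ : ∀ ε j, J ≤ j → ∀ e k₁, d ε j (parityIndex e k₁) ≤ C * ∑' τ : OffDiagonal n,
      (latticeWeight τ.2.2)⁻¹ ^ N * c τ.1 (j - 1 + (τ.2.1 : ℕ)) (fineIndex τ.2.1 τ.2.2 k₁))
    (_ : ∀ w, localNorm p q γ₂ (J - 2) w c ≤ X),
    localNorm p q γ₂ J K d ≤ C' * X := by
  obtain ⟨N, hN⟩ := lintegral_localSum_rpow_le (n := n) (div_pos hp hq)
  refine ⟨N, fun C hC => ?_⟩
  obtain ⟨C₁, hC₁, h⟩ := hN C hC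
  set θ := γ₂ / n - 1 / p with hθ
  set A : ℤ → ℝ := fun J => ((2 : ℝ) ^ (-((n : ℝ) * J))) ^ θ with hA
  have hApos : ∀ J, 0 < A J := fun J => by positivity
  -- Passing from level `J` to `J - 2` changes the power of `|Q|` in front by a factor independent
  -- of `J`.
  have hAJ : ∀ J : ℤ, A J = (2 : ℝ) ^ (-(2 * (n : ℝ)) * θ) * A (J - 2) := by
    intro J
    simp only [hA]
    rw [← Real.rpow_mul zero_le_two, ← Real.rpow_mul zero_le_two, ← Real.rpow_add two_pos]
    congr 1
    push_cast
    ring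
  have hp' : 0 ≤ 1 / p := by positivity
  refine ⟨ENNReal.ofReal ((2 : ℝ) ^ (-(2 * (n : ℝ)) * θ)) * C₁ ^ (1 / p),
    ENNReal.mul_ne_top ENNReal.ofReal_ne_top (ENNReal.rpow_ne_top_of_nonneg hp' hC₁), ?_⟩
  intro J K c d X hd hX
  have hA0 : ENNReal.ofReal (A (J - 2)) ≠ 0 := by simpa using hApos (J - 2)
  have hY : ∀ w, ∫⁻ x, localSum (J - 2) w c x ^ (p / q) ≤
      ((ENNReal.ofReal (A (J - 2)))⁻¹ * X) ^ p := by
    intro w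
    have h1 := hX w
    rw [localNorm_eq, mul_comm, ← ENNReal.le_div_iff_mul_le (Or.inl hA0)
      (Or.inl ENNReal.ofReal_ne_top), ENNReal.div_eq_inv_mul, one_div,
      ENNReal.rpow_inv_le_iff hp] at h1
    exact h1
  have h2 := h J K c d _ hd hY
  rw [localNorm_eq]
  calc _ ≤ ENNReal.ofReal (A J) *
        (C₁ * ((ENNReal.ofReal (A (J - 2)))⁻¹ * X) ^ p) ^ (1 / p) := by gcongr
    _ = ENNReal.ofReal (A J) * (C₁ ^ (1 / p) * ((ENNReal.ofReal (A (J - 2)))⁻¹ * X)) := by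
      rw [ENNReal.mul_rpow_of_nonneg _ _ hp', ← ENNReal.rpow_mul, mul_one_div_cancel hp.ne',
        ENNReal.rpow_one]
    _ = ENNReal.ofReal ((2 : ℝ) ^ (-(2 * (n : ℝ)) * θ)) * C₁ ^ (1 / p) * X *
        (ENNReal.ofReal (A (J - 2)) * (ENNReal.ofReal (A (J - 2)))⁻¹) := by
      rw [hAJ J, ENNReal.ofReal_mul (by positivity)]
      ring
    _ = _ := by rw [ENNReal.mul_inv_cancel hA0 ENNReal.ofReal_ne_top, mul_one]

end AlmostDiagonalBound

/-! ### Identities for the Meyer functions. -/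

namespace MeyerProfile

open Real

variable (Ψ : MeyerProfile)

/-- Continuity adds the endpoints of the support interval. -/
theorem scale_eq_zero {ξ : ℝ} (hξ : 4 * π / 3 ≤ |ξ|) : Ψ.scale ξ = 0 := by
  have hpi := Real.pi_pos
  have hpos : 0 < |ξ| := by linarith
  have hcl : IsClosed (Ψ.scale ⁻¹' {0}) := isClosed_singleton.preimage Ψ.smooth.continuous
  have ht : Filter.Tendsto (fun m : ℕ => (1 + 1 / ((m : ℝ) + 1)) * ξ) Filter.atTop (nhds ξ) := by
    have := (tendsto_one_div_add_atTop_nhds_zero_nat (𝕜 := ℝ)).const_add 1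
    simpa using this.mul_const ξ
  refine hcl.mem_of_tendsto ht (Filter.Eventually.of_forall fun m => Ψ.support _ ?_)
  have h1 : (0 : ℝ) < 1 / ((m : ℝ) + 1) := by positivity
  rw [abs_mul, abs_of_pos (by linarith)]
  nlinarith

theorem scale_nonneg (ξ : ℝ) : 0 ≤ Ψ.scale ξ := (Ψ.mem_Icc ξ).1

/-- Either `Ψ⁰(ξ/2) = 1` or `Ψ⁰(ξ) = 0`. Hence the radicand of `Ω` is non-negative and the square
root can be undone. -/
theorem scale_sq_le (ξ : ℝ) : Ψ.scale ξ ^ 2 ≤ Ψ.scale (ξ / 2) ^ 2 := by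
  have h := Ψ.mem_Icc ξ
  rcases le_total |ξ| (4 * π / 3) with h1 | h1
  · rw [Ψ.eq_one (ξ / 2) (by rw [abs_div, abs_two]; linarith)]
    exact pow_le_pow_left₀ h.1 h.2 2
  · rw [Ψ.scale_eq_zero h1, zero_pow two_ne_zero]
    positivity

theorem detail_nonneg (ξ : ℝ) : 0 ≤ Ψ.detail ξ := Real.sqrt_nonneg _

theorem detail_sq (ξ : ℝ) : Ψ.detail ξ ^ 2 = Ψ.scale (ξ / 2) ^ 2 - Ψ.scale ξ ^ 2 :=
  Real.sq_sqrt (by linarith [Ψ.scale_sq_le ξ])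

theorem detail_neg (ξ : ℝ) : Ψ.detail (-ξ) = Ψ.detail ξ := by
  unfold detail
  rw [neg_div, Ψ.even, Ψ.even]

theorem detail_eq_scale {ξ : ℝ} (hξ : 4 * π / 3 ≤ |ξ|) : Ψ.detail ξ = Ψ.scale (ξ / 2) := by
  unfold detail
  rw [Ψ.scale_eq_zero hξ, zero_pow two_ne_zero, sub_zero, Real.sqrt_sq (Ψ.scale_nonneg _)]

theorem detail_eq_zero_of_le {ξ : ℝ} (hξ : |ξ| ≤ 2 * π / 3) : Ψ.detail ξ = 0 := by
  have hpi := Real.pi_pos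
  unfold detail
  rw [Ψ.eq_one ξ hξ, Ψ.eq_one (ξ / 2) (by rw [abs_div, abs_two]; linarith [abs_nonneg ξ])]
  simp

theorem detail_eq_zero_of_ge {ξ : ℝ} (hξ : 8 * π / 3 ≤ |ξ|) : Ψ.detail ξ = 0 := by
  have hpi := Real.pi_pos
  rw [Ψ.detail_eq_scale (by linarith), Ψ.scale_eq_zero (by rw [abs_div, abs_two]; linarith)]

/-- The case `u = 1` of the quadrature identity. Where `-ξ ∈ [2π/3, 4π/3]`, both half-arguments have
`Ψ⁰ = 1`, so the symmetry of `Ω` gives `Ω(ξ) = Ψ⁰(ξ+2π)` and `Ω(ξ+2π) = Ψ⁰(ξ)`. Elsewhere both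
products vanish by support. -/
theorem scale_mul_scale_eq (ξ : ℝ) :
    Ψ.scale ξ * Ψ.scale (ξ + 2 * π) = Ψ.detail ξ * Ψ.detail (ξ + 2 * π) := by
  have hpi := Real.pi_pos
  by_cases h : ξ ∈ Set.Icc (-(4 * π / 3)) (-(2 * π / 3))
  · have h0 : -ξ ∈ Set.Icc (2 * π / 3) (4 * π / 3) := ⟨by linarith [h.2], by linarith [h.1]⟩
    have e1 : 2 * π - -ξ = ξ + 2 * π := by ring
    have hs := Ψ.detail_symm (-ξ) h0
    rw [e1] at hs
    have hs' : Ψ.detail (-ξ) ^ 2 + Ψ.detail (ξ + 2 * π) ^ 2 = 1 := hs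
    rw [Ψ.detail_neg] at hs'
    have a1 : Ψ.scale (ξ / 2) = 1 := Ψ.eq_one _ (by rw [abs_le]; constructor <;> linarith [h.1, h.2])
    have a2 : Ψ.scale ((ξ + 2 * π) / 2) = 1 :=
      Ψ.eq_one _ (by rw [abs_le]; constructor <;> linarith [h.1, h.2])
    have d1 := Ψ.detail_sq ξ
    have d2 := Ψ.detail_sq (ξ + 2 * π)
    rw [a1] at d1
    rw [a2] at d2
    have b1 : Ψ.detail ξ = Ψ.scale (ξ + 2 * π) :=
      (pow_left_inj₀ (Ψ.detail_nonneg _) (Ψ.scale_nonneg _) two_ne_zero).1 (by linarith)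
    have b2 : Ψ.detail (ξ + 2 * π) = Ψ.scale ξ :=
      (pow_left_inj₀ (Ψ.detail_nonneg _) (Ψ.scale_nonneg _) two_ne_zero).1 (by linarith)
    rw [b1, b2, mul_comm]
  · rw [Set.mem_Icc, not_and_or, not_le, not_le] at h
    have hl : Ψ.scale ξ * Ψ.scale (ξ + 2 * π) = 0 := by
      rcases h with h | h
      · rw [Ψ.scale_eq_zero (ξ := ξ) (by rw [le_abs]; right; linarith), zero_mul]
      · rw [Ψ.scale_eq_zero (ξ := ξ + 2 * π) (by rw [le_abs]; left; linarith), mul_zero]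
    have hr : Ψ.detail ξ * Ψ.detail (ξ + 2 * π) = 0 := by
      rcases h with h | h
      · rcases le_total (-(8 * π / 3)) ξ with h2 | h2
        · rw [Ψ.detail_eq_zero_of_le (ξ := ξ + 2 * π)
            (by rw [abs_le]; constructor <;> linarith), mul_zero]
        · rw [Ψ.detail_eq_zero_of_ge (ξ := ξ) (by rw [le_abs]; right; linarith), zero_mul]
      · rcases le_total ξ (2 * π / 3) with h2 | h2
        · rw [Ψ.detail_eq_zero_of_le (ξ := ξ) (by rw [abs_le]; constructor <;> linarith), zero_mul]
        · rw [Ψ.detail_eq_zero_of_ge (ξ := ξ + 2 * π) (by rw [le_abs]; left; linarith), mul_zero]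
    rw [hl, hr]

/-- The case `u = 2`: where the product can be non-zero both arguments have modulus at least `4π/3`,
and there `Ω(ξ) = Ψ⁰(ξ/2)`. -/
theorem detail_mul_detail_eq (ξ : ℝ) :
    Ψ.detail ξ * Ψ.detail (ξ + 4 * π) = Ψ.scale (ξ / 2) * Ψ.scale (ξ / 2 + 2 * π) := by
  have hpi := Real.pi_pos
  have e : (ξ + 4 * π) / 2 = ξ / 2 + 2 * π := by ring
  by_cases h : ξ ∈ Set.Icc (-(8 * π / 3)) (-(4 * π / 3))
  · rw [Ψ.detail_eq_scale (ξ := ξ) (by rw [le_abs]; right; linarith [h.2]),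
      Ψ.detail_eq_scale (ξ := ξ + 4 * π) (by rw [le_abs]; left; linarith [h.1]), e]
  · rw [Set.mem_Icc, not_and_or, not_le, not_le] at h
    rcases h with h | h
    · rw [Ψ.detail_eq_zero_of_ge (ξ := ξ) (by rw [le_abs]; right; linarith),
        Ψ.scale_eq_zero (ξ := ξ / 2) (by rw [le_abs]; right; linarith), zero_mul, zero_mul]
    · rw [Ψ.detail_eq_zero_of_ge (ξ := ξ + 4 * π) (by rw [le_abs]; left; linarith),
        Ψ.scale_eq_zero (ξ := ξ / 2 + 2 * π) (by rw [le_abs]; left; linarith), mul_zero, mul_zero]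

/-- On the Fourier side this says that one level of scaling functions together with one level of
wavelets makes up the next level of scaling functions. Only the shifts `0`, `1`, `2` matter; from
`3` on the supports are disjoint. -/
theorem quadrature_nat (ξ : ℝ) (u : ℕ) :
    Ψ.scale ξ * Ψ.scale (ξ + 2 * π * u) + (-1) ^ u * (Ψ.detail ξ * Ψ.detail (ξ + 2 * π * u)) =
      if Even u then Ψ.scale (ξ / 2) * Ψ.scale (ξ / 2 + π * u) else 0 := by
  have hpi := Real.pi_pos
  rcases u with _ | _ | _ | u
  · have := Ψ.detail_sq ξ
    simp only [Nat.cast_zero, mul_zero, add_zero, pow_zero, one_mul, Even.zero, if_true]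
    linarith
  · have := Ψ.scale_mul_scale_eq ξ
    simp only [zero_add, Nat.cast_one, mul_one, pow_one, Nat.not_even_one, if_false]
    linarith
  · have h1 := Ψ.detail_mul_detail_eq ξ
    have h2 : Ψ.scale ξ * Ψ.scale (ξ + 4 * π) = 0 := by
      rcases le_total ξ (-(4 * π / 3)) with h | h
      · rw [Ψ.scale_eq_zero (ξ := ξ) (by rw [le_abs]; right; linarith), zero_mul]
      · rw [Ψ.scale_eq_zero (ξ := ξ + 4 * π) (by rw [le_abs]; left; linarith), mul_zero]
    have e1 : ξ + 2 * π * ((0 + 1 + 1 : ℕ) : ℝ) = ξ + 4 * π := by push_cast; ring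
    have e2 : ξ / 2 + π * ((0 + 1 + 1 : ℕ) : ℝ) = ξ / 2 + 2 * π := by push_cast; ring
    rw [e1, e2, h1, h2, if_pos (by decide)]
    ring
  · set v : ℕ := u + 1 + 1 + 1 with hv
    have h3 : (3 : ℝ) ≤ v := by
      have : 3 ≤ v := by omega
      exact_mod_cast this
    have h4 : 3 * π ≤ π * v := by nlinarith
    have hs : Ψ.scale ξ * Ψ.scale (ξ + 2 * π * v) = 0 := by
      rcases le_total ξ (-(4 * π / 3)) with h | h
      · rw [Ψ.scale_eq_zero (ξ := ξ) (by rw [le_abs]; right; linarith), zero_mul]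
      · rw [Ψ.scale_eq_zero (ξ := ξ + 2 * π * v) (by rw [le_abs]; left; linarith), mul_zero]
    have hd : Ψ.detail ξ * Ψ.detail (ξ + 2 * π * v) = 0 := by
      rcases le_total ξ (-(8 * π / 3)) with h | h
      · rw [Ψ.detail_eq_zero_of_ge (ξ := ξ) (by rw [le_abs]; right; linarith), zero_mul]
      · rw [Ψ.detail_eq_zero_of_ge (ξ := ξ + 2 * π * v) (by rw [le_abs]; left; linarith), mul_zero]
    have hr : Ψ.scale (ξ / 2) * Ψ.scale (ξ / 2 + π * v) = 0 := by
      rcases le_total (ξ / 2) (-(4 * π / 3)) with h | h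
      · rw [Ψ.scale_eq_zero (ξ := ξ / 2) (by rw [le_abs]; right; linarith), zero_mul]
      · rw [Ψ.scale_eq_zero (ξ := ξ / 2 + π * v) (by rw [le_abs]; left; linarith), mul_zero]
    rw [hs, hd, hr]
    simp

theorem quadrature (ξ : ℝ) (u : ℤ) :
    Ψ.scale ξ * Ψ.scale (ξ + 2 * π * u) + (-1) ^ u * (Ψ.detail ξ * Ψ.detail (ξ + 2 * π * u)) =
      if Even u then Ψ.scale (ξ / 2) * Ψ.scale (ξ / 2 + π * u) else 0 := by
  obtain ⟨v, rfl | rfl⟩ := u.eq_nat_or_neg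
  · simpa [Int.even_coe_nat] using Ψ.quadrature_nat ξ v
  · have h := Ψ.quadrature_nat (-ξ) v
    have e1 : ξ + 2 * π * ((-(v : ℤ) : ℤ) : ℝ) = -(-ξ + 2 * π * v) := by push_cast; ring
    have e2 : ξ / 2 + π * ((-(v : ℤ) : ℤ) : ℝ) = -(-ξ / 2 + π * v) := by push_cast; ring
    have e3 : ((-1 : ℝ)) ^ (-(v : ℤ)) = (-1) ^ v := by
      rw [zpow_neg, zpow_natCast, ← inv_pow, inv_neg_one]
    rw [Ψ.even, Ψ.detail_neg, show -ξ / 2 = -(ξ / 2) by ring, Ψ.even (ξ / 2)] at h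
    rw [e1, e2, e3, Ψ.even, Ψ.even, Ψ.detail_neg]
    simp only [even_neg, Int.even_coe_nat]
    rw [h]
    ring_nf

-- The phase `e^{-iξ/2}` of `Ψ¹` against its shift by `2πu` produces the sign `(-1)^u`.
open ComplexConjugate in
theorem sum_hat_mul_conj (ξ : ℝ) (u : ℤ) :
    ∑ e : Fin 2, Ψ.hat e ξ * conj (Ψ.hat e (ξ + 2 * π * u)) =
      if Even u then Ψ.hat 0 (ξ / 2) * conj (Ψ.hat 0 (ξ / 2 + π * u)) else 0 := by
  have hexp : Complex.exp (-(Complex.I * ξ / 2)) *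
      conj (Complex.exp (-(Complex.I * ((ξ + 2 * π * u : ℝ) : ℂ) / 2))) = (-1) ^ u := by
    rw [← Complex.exp_conj, ← Complex.exp_add, ← Complex.exp_pi_mul_I, ← Complex.exp_int_mul]
    congr 1
    simp only [map_neg, map_div₀, map_mul, Complex.conj_I, Complex.conj_ofReal, map_ofNat]
    push_cast
    ring
  have h := congrArg (fun r : ℝ => (r : ℂ)) (Ψ.quadrature ξ u)
  rw [Fin.sum_univ_two]
  simp only [hat, if_true, one_ne_zero, if_false, map_mul, Complex.conj_ofReal]
  rw [show ∀ a b c d : ℂ, a * b * (c * d) = (b * d) * (a * c) by intros; ring, hexp]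
  simp only [apply_ite (fun r : ℝ => (r : ℂ))] at h
  push_cast at h ⊢
  exact h

-- The sum over all `ε`, including `0`, factorises into one-dimensional sums.
open ComplexConjugate in
theorem sum_motherHat_mul_conj {n : ℕ} (v : RSpace n) (u : Fin n → ℤ) :
    ∑ ε : Fin n → Fin 2, Ψ.motherHat ε v * conj (Ψ.motherHat ε (v + latticePoint u)) =
      if ∀ i, Even (u i) then Ψ.motherHat 0 ((2 : ℝ)⁻¹ • v) *
        conj (Ψ.motherHat 0 ((2 : ℝ)⁻¹ • (v + latticePoint u))) else 0 := by
  unfold motherHat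
  simp only [map_prod, ← Finset.prod_mul_distrib]
  have h1 := (Finset.prod_univ_sum (fun _ : Fin n => (Finset.univ : Finset (Fin 2)))
    (fun i e => Ψ.hat e (2 * π * v i) * conj (Ψ.hat e (2 * π * (v + latticePoint u) i)))).symm
  rw [Fintype.piFinset_univ] at h1
  rw [h1]
  have h2 : ∀ i, ∑ e : Fin 2, Ψ.hat e (2 * π * v i) *
      conj (Ψ.hat e (2 * π * (v + latticePoint u) i)) = if Even (u i) then
        Ψ.hat 0 (2 * π * ((2 : ℝ)⁻¹ • v) i) *
          conj (Ψ.hat 0 (2 * π * ((2 : ℝ)⁻¹ • (v + latticePoint u)) i)) else 0 := by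
    intro i
    have h := Ψ.sum_hat_mul_conj (2 * π * v i) (u i)
    have e1 : 2 * π * (v + latticePoint u) i = 2 * π * v i + 2 * π * u i := by
      simp [latticePoint]; ring
    have e2 : 2 * π * ((2 : ℝ)⁻¹ • v) i = 2 * π * v i / 2 := by simp; ring
    have e3 : 2 * π * ((2 : ℝ)⁻¹ • (v + latticePoint u)) i = 2 * π * v i / 2 + π * u i := by
      simp [latticePoint]; ring
    rw [e1, e2, e3]
    exact h
  simp only [h2]
  split_ifs with h
  · exact Finset.prod_congr rfl fun i _ => by rw [if_pos (h i)]; rfl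
  · push Not at h
    obtain ⟨i, hi⟩ := h
    exact Finset.prod_eq_zero (Finset.mem_univ i) (by rw [if_neg]; simpa using hi)

end MeyerProfile

/-! ### Poisson summation in several variables. -/

section Poisson

open MeasureTheory UnitAddTorus

variable {n : ℕ}

/-- The integer vector `u` as a vector with real coordinates. -/
def realVec (u : Fin n → ℤ) : Fin n → ℝ := fun i => (u i : ℝ)

/-- The character `x ↦ e^{2πi k·x}`. -/
noncomputable def latticeChar (k : Fin n → ℤ) (x : Fin n → ℝ) : ℂ :=
  Real.fourierChar (∑ i, (k i : ℝ) * x i)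

theorem norm_latticeChar (k : Fin n → ℤ) (x : Fin n → ℝ) : ‖latticeChar k x‖ = 1 :=
  Circle.norm_coe _

theorem continuous_latticeChar (k : Fin n → ℤ) : Continuous (latticeChar k) :=
  continuous_subtype_val.comp (Real.continuous_fourierChar.comp (by fun_prop))

theorem mFourier_coe (k : Fin n → ℤ) (x : Fin n → ℝ) :
    mFourier k (fun i => (x i : UnitAddCircle)) = latticeChar k x := by
  simp only [mFourier, latticeChar, ContinuousMap.coe_mk, fourier_coe_apply, Real.fourierChar_apply]
  rw [← Complex.exp_sum]
  congr 1
  push_cast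
  rw [Finset.mul_sum, Finset.sum_mul]
  exact Finset.sum_congr rfl fun i _ => by ring

theorem fourierChar_int (z : ℤ) : Real.fourierChar (z : ℝ) = 1 := by
  ext
  rw [Real.fourierChar_apply, Circle.coe_one, Complex.exp_eq_one_iff]
  exact ⟨z, by push_cast; ring⟩

theorem latticeChar_add_int (k : Fin n → ℤ) (x : Fin n → ℝ) (u : Fin n → ℤ) :
    latticeChar k (x + realVec u) = latticeChar k x := by
  have : ∑ i, (k i : ℝ) * (x + realVec u) i =
      ∑ i, (k i : ℝ) * x i + ((∑ i, k i * u i : ℤ) : ℝ) := by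
    simp only [Pi.add_apply, realVec, mul_add, Finset.sum_add_distrib]
    push_cast
    rfl
  unfold latticeChar
  rw [this, AddChar.map_add_eq_mul, fourierChar_int, mul_one]

theorem finite_translates_meeting {h : (Fin n → ℝ) → ℂ} (hs : HasCompactSupport h) (R : ℝ) :
    {u : Fin n → ℤ | ∃ x : Fin n → ℝ, ‖x‖ ≤ R ∧ h (x + realVec u) ≠ 0}.Finite := by
  obtain ⟨M, hM⟩ := hs.isCompact.isBounded.exists_norm_le
  refine ((isCompact_closedBall (0 : Fin n → ℤ) (M + R)).finite_of_discrete).subset ?_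
  rintro u ⟨x, hx, hu⟩
  have h1 := hM _ (subset_tsupport _ hu)
  have h2 : ‖realVec u‖ = ‖u‖ := by simp [Pi.norm_def]; rfl
  rw [mem_closedBall_zero_iff, ← h2]
  calc ‖realVec u‖ = ‖(x + realVec u) - x‖ := by simp
    _ ≤ ‖x + realVec u‖ + ‖x‖ := norm_sub_le _ _
    _ ≤ _ := add_le_add h1 hx

/-- The periodization of a function on `ℝⁿ`. -/
noncomputable def periodize (h : (Fin n → ℝ) → ℂ) (x : Fin n → ℝ) : ℂ :=
  ∑' u : Fin n → ℤ, h (x + realVec u)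

theorem periodize_add_int (h : (Fin n → ℝ) → ℂ) (x : Fin n → ℝ) (w : Fin n → ℤ) :
    periodize h (x + realVec w) = periodize h x := by
  unfold periodize
  rw [← (Equiv.addLeft w).tsum_eq fun u => h (x + realVec u)]
  refine tsum_congr fun u => ?_
  congr 1
  ext i
  simp [realVec]
  ring

theorem continuous_periodize {h : (Fin n → ℝ) → ℂ} (hc : Continuous h)
    (hs : HasCompactSupport h) : Continuous (periodize h) := by
  rw [continuous_iff_continuousAt]
  intro x₀
  obtain hF := finite_translates_meeting hs (‖x₀‖ + 1)
  have hev : (fun x => ∑ u ∈ hF.toFinset, h (x + realVec u)) =ᶠ[nhds x₀] periodize h := by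
    filter_upwards [Metric.ball_mem_nhds x₀ one_pos] with x hx
    refine (tsum_eq_sum fun u hu => ?_).symm
    by_contra hne
    refine hu (hF.mem_toFinset.2 ⟨x, ?_, hne⟩)
    have h1 : ‖x - x₀‖ < 1 := by simpa [dist_eq_norm] using hx
    calc ‖x‖ = ‖x₀ + (x - x₀)‖ := by simp
      _ ≤ ‖x₀‖ + ‖x - x₀‖ := norm_add_le _ _
      _ ≤ _ := by linarith
  refine ContinuousAt.congr ?_ hev
  exact (continuous_finsetSum _ fun u _ => hc.comp (continuous_id.add continuous_const)).continuousAt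

/-- The periodization, as a function on the torus. -/
noncomputable def torusPeriodize (h : (Fin n → ℝ) → ℂ) (t : UnitAddTorus (Fin n)) : ℂ :=
  periodize h fun i => (AddCircle.equivIoc 1 0 (t i) : ℝ)

theorem torusPeriodize_coe (h : (Fin n → ℝ) → ℂ) (x : Fin n → ℝ) :
    torusPeriodize h (fun i => (x i : UnitAddCircle)) = periodize h x := by
  have h1 : ∀ i, ∃ w : ℤ, (AddCircle.equivIoc 1 0 (x i : UnitAddCircle) : ℝ) + w = x i := by
    intro i
    have h2 : (((AddCircle.equivIoc 1 0 (x i : UnitAddCircle) : ℝ)) : UnitAddCircle) = x i :=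
      (AddCircle.equivIoc (1 : ℝ) 0).symm_apply_apply _
    obtain ⟨w, hw⟩ := AddSubgroup.mem_zmultiples_iff.1 (QuotientAddGroup.eq.1 h2)
    refine ⟨w, ?_⟩
    rw [zsmul_eq_mul, mul_one] at hw
    rw [hw]
    ring
  choose w hw using h1
  unfold torusPeriodize
  rw [← periodize_add_int h _ w]
  congr 1
  exact funext hw

theorem continuous_torusPeriodize {h : (Fin n → ℝ) → ℂ} (hc : Continuous h)
    (hs : HasCompactSupport h) : Continuous (torusPeriodize h) := by
  have hq : IsOpenQuotientMap (Pi.map fun (_ : Fin n) (x : ℝ) => (x : UnitAddCircle)) :=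
    IsOpenQuotientMap.piMap fun _ => QuotientAddGroup.isOpenQuotientMap_mk
  rw [hq.isQuotientMap.continuous_iff]
  have : torusPeriodize h ∘ (Pi.map fun (_ : Fin n) (x : ℝ) => (x : UnitAddCircle)) =
      periodize h := funext fun x => torusPeriodize_coe h x
  rw [this]
  exact continuous_periodize hc hs

/-- Integration over `ℝⁿ` by summing over the translates of the unit cube. -/
theorem hasSum_setIntegral_translates {h : (Fin n → ℝ) → ℂ} (hi : Integrable h) :
    HasSum (fun u : Fin n → ℤ => ∫ x in {x : Fin n → ℝ | ∀ i, x i ∈ Set.Ioc (0 : ℝ) (0 + 1)},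
      h (x + realVec u)) (∫ x, h x) := by
  set Q : Set (Fin n → ℝ) := {x | ∀ i, x i ∈ Set.Ioc (0 : ℝ) (0 + 1)} with hQ
  have hQm : MeasurableSet Q := MeasurableSet.univ_pi' fun i => measurableSet_Ioc
  -- These are the half-open cubes `u + (0,1]ⁿ`, described by ceilings; they tile the space.
  set s : (Fin n → ℤ) → Set (Fin n → ℝ) := fun u => {x | ∀ i, ⌈x i⌉ = u i + 1} with hsdef
  have hsQ : ∀ u, (fun x => x + realVec u) ⁻¹' s u = Q := by
    intro u
    ext x
    simp only [hsdef, hQ, Set.mem_preimage, Set.mem_ofPred_eq, Pi.add_apply, realVec,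
      Int.ceil_eq_iff, Set.mem_Ioc]
    refine forall_congr' fun i => ?_
    push_cast
    constructor <;> rintro ⟨h1, h2⟩ <;> constructor <;> linarith
  have hsm : ∀ u, MeasurableSet (s u) := by
    intro u
    have : s u = ⋂ i, (fun x : Fin n → ℝ => ⌈x i⌉) ⁻¹' {u i + 1} := by ext; simp [hsdef]
    rw [this]
    exact MeasurableSet.iInter fun i =>
      (Int.measurable_ceil.comp (measurable_pi_apply i)) (measurableSet_singleton _)
  have hU : ⋃ u, s u = Set.univ := by
    refine Set.eq_univ_of_forall fun x => Set.mem_iUnion.2 ⟨fun i => ⌈x i⌉ - 1, fun i => ?_⟩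
    simp
  have hd : Pairwise (Function.onFun Disjoint s) := by
    intro u w huw
    refine Set.disjoint_left.2 fun x hx hx' => huw (funext fun i => ?_)
    have := (hx i).symm.trans (hx' i)
    omega
  have h1 := hasSum_integral_iUnion (μ := volume) (f := h) hsm hd (by rw [hU]; exact hi.integrableOn)
  rw [hU, setIntegral_univ] at h1
  refine h1.congr_fun fun u => ?_
  have h2 := (measurePreserving_add_right (volume : Measure (Fin n → ℝ))
    (realVec u)).setIntegral_preimage_emb (MeasurableEquiv.addRight (realVec u)).measurableEmbedding
    h (s u)
  rw [hsQ] at h2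
  exact h2

theorem integral_torus_periodize {h : (Fin n → ℝ) → ℂ} (hi : Integrable h) :
    ∫ x in {x : Fin n → ℝ | ∀ i, x i ∈ Set.Ioc (0 : ℝ) (0 + 1)}, periodize h x = ∫ x, h x := by
  rw [← (hasSum_setIntegral_translates hi).tsum_eq]
  unfold periodize
  refine (integral_tsum_of_summable_integral_norm (fun u => ?_) ?_).symm
  · exact (hi.comp_add_right _).integrableOn
  -- The tiling formula applied to `‖h‖` gives the absolute convergence that justifies exchanging
  -- sum and integral.
  · have hn : Integrable fun x => ((‖h x‖ : ℝ) : ℂ) := hi.norm.ofReal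
    have := (hasSum_setIntegral_translates hn).summable
    simp only [integral_complex_ofReal] at this
    exact Complex.summable_ofReal.1 this

/-- The character is `ℤⁿ`-periodic, so it can be moved inside the periodization before the integral
is unfolded. -/
theorem mFourierCoeff_torusPeriodize {h : (Fin n → ℝ) → ℂ} (hi : Integrable h) (k : Fin n → ℤ) :
    mFourierCoeff (torusPeriodize h) k = ∫ x, latticeChar (-k) x * h x := by
  rw [mFourierCoeff_eq_integral _ _ 0]
  have hi' : Integrable fun x => latticeChar (-k) x * h x :=
    hi.bdd_mul (c := 1) (continuous_latticeChar (-k)).aestronglyMeasurable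
      (Filter.Eventually.of_forall fun x => (norm_latticeChar _ x).le)
  rw [← integral_torus_periodize hi']
  refine integral_congr_ae (Filter.Eventually.of_forall fun x => ?_)
  simp only [mFourier_coe, torusPeriodize_coe, smul_eq_mul]
  unfold periodize
  rw [← tsum_mul_left]
  exact tsum_congr fun u => by simp only [latticeChar_add_int]

/-- The Poisson summation formula in `n` variables, for compactly supported functions. -/
theorem hasSum_fourier_periodize {h : (Fin n → ℝ) → ℂ} (hc : Continuous h)
    (hs : HasCompactSupport h)
    (hsum : Summable fun k : Fin n → ℤ => ∫ x, latticeChar (-k) x * h x) (x : Fin n → ℝ) :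
    HasSum (fun k : Fin n → ℤ => (∫ x, latticeChar (-k) x * h x) * latticeChar k x)
      (periodize h x) := by
  have hi : Integrable h := hc.integrable_of_hasCompactSupport hs
  let f : C(UnitAddTorus (Fin n), ℂ) := ⟨torusPeriodize h, continuous_torusPeriodize hc hs⟩
  have hf : mFourierCoeff f = fun k => ∫ x, latticeChar (-k) x * h x :=
    funext fun k => mFourierCoeff_torusPeriodize hi k
  have h1 := hasSum_mFourier_series_apply_of_summable (f := f)
    (by rw [hf]; exact hsum) fun i => (x i : UnitAddCircle)
  have h2 : f (fun i => (x i : UnitAddCircle)) = periodize h x := torusPeriodize_coe h x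
  rw [h2, hf] at h1
  simpa only [mFourier_coe, smul_eq_mul] using h1

theorem fourierChar_inner_latticePoint (k : Fin n → ℤ) (v : RSpace n) :
    (Real.fourierChar (inner ℝ (latticePoint k) v) : ℂ) = latticeChar k (WithLp.ofLp v) := by
  unfold latticeChar
  congr 2
  simp [latticePoint, PiLp.inner_apply, mul_comm]

/-- The Poisson summation formula on Euclidean space, for compactly supported smooth functions. -/
theorem hasSum_fourier_latticePoint {g : 𝓢(RSpace n, ℂ)} (hg : HasCompactSupport (g : RSpace n → ℂ))
    (hsum : Summable fun k : Fin n → ℤ => 𝓕 (g : RSpace n → ℂ) (latticePoint k)) (v : RSpace n) :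
    HasSum (fun k : Fin n → ℤ => 𝓕 (g : RSpace n → ℂ) (latticePoint k) *
      (Real.fourierChar (inner ℝ (latticePoint k) v) : ℂ))
      (∑' u : Fin n → ℤ, g (v + latticePoint u)) := by
  set h : (Fin n → ℝ) → ℂ := fun x => g (WithLp.toLp 2 x) with hh
  have hc : Continuous h := g.continuous.comp (PiLp.continuous_toLp 2 _)
  have hs : HasCompactSupport h :=
    hg.comp_homeomorph (PiLp.homeomorph 2 (fun _ : Fin n => ℝ)).symm
  have e1 : ∀ k : Fin n → ℤ, 𝓕 (g : RSpace n → ℂ) (latticePoint k) =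
      ∫ x, latticeChar (-k) x * h x := by
    intro k
    rw [Real.fourier_eq, ← (PiLp.volume_preserving_toLp (Fin n)).integral_comp
      (MeasurableEquiv.toLp 2 (Fin n → ℝ)).measurableEmbedding]
    refine integral_congr_ae (Filter.Eventually.of_forall fun x => ?_)
    have h1 := fourierChar_inner_latticePoint (-k) (WithLp.toLp 2 x)
    have h2 : inner ℝ (latticePoint (-k)) (WithLp.toLp 2 x) =
        -inner ℝ (WithLp.toLp 2 x) (latticePoint k) := by
      rw [real_inner_comm, ← inner_neg_right]
      congr 1
      ext i
      simp [latticePoint]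
    rw [h2] at h1
    simp only [Circle.smul_def, smul_eq_mul, hh]
    rw [h1]
  have h1 := hasSum_fourier_periodize hc hs (by simpa only [e1] using hsum) (WithLp.ofLp v)
  simp only [← e1] at h1
  simp only [fourierChar_inner_latticePoint]
  exact h1

end Poisson

/-! ### Expansion in wavelets on the Fourier side. -/

section Expansion

open ComplexConjugate

variable {n : ℕ}

theorem norm_le_norm_latticePoint (k : Fin n → ℤ) : ‖k‖ ≤ ‖latticePoint k‖ := by
  refine (pi_norm_le_iff_of_nonneg (norm_nonneg _)).2 fun i => ?_
  refine le_trans (le_of_eq ?_) (PiLp.norm_apply_le (latticePoint k) i)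
  simp [latticePoint, Int.norm_eq_abs]

theorem latticePoint_neg (k : Fin n → ℤ) : latticePoint (-k) = -latticePoint k := by
  ext i
  simp [latticePoint]

/-- Sums over translates of `U` are finite, so they may be split and reindexed freely. -/
theorem finite_lattice_of_support {U : RSpace n → ℂ} {R : ℝ}
    (hU : ∀ v i, R ≤ |v i| → U v = 0) (δ : ℕ) (v : RSpace n) :
    {u : Fin n → ℤ | U (v + (2 : ℝ) ^ δ • latticePoint u) ≠ 0}.Finite := by
  refine ((isCompact_closedBall (0 : Fin n → ℤ) (|R| + ‖v‖)).finite_of_discrete).subset ?_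
  intro u hu
  rw [mem_closedBall_zero_iff, pi_norm_le_iff_of_nonneg (by positivity)]
  intro i
  have h1 : |(v + (2 : ℝ) ^ δ • latticePoint u) i| < R := by
    by_contra h
    exact hu (hU _ i (not_lt.1 h))
  have h2 : (v + (2 : ℝ) ^ δ • latticePoint u) i = v i + 2 ^ δ * u i := by simp [latticePoint]
  have h3 : |v i| ≤ ‖v‖ := PiLp.norm_apply_le v i
  have h4 : |(u i : ℝ)| ≤ |(2 : ℝ) ^ δ * u i| := by
    rw [abs_mul, abs_of_pos (by positivity : (0 : ℝ) < 2 ^ δ)]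
    exact le_mul_of_one_le_left (abs_nonneg _) (one_le_pow₀ (by norm_num : (1 : ℝ) ≤ 2))
  rw [h2] at h1
  have h5 : |(2 : ℝ) ^ δ * u i| ≤ |v i + 2 ^ δ * u i| + |v i| := by
    calc |(2 : ℝ) ^ δ * u i| = |(v i + 2 ^ δ * u i) - v i| := by ring_nf
      _ ≤ _ := abs_sub _ _
  rw [Int.norm_eq_abs]
  linarith [le_abs_self R]

namespace MeyerProfile

variable (Ψ : MeyerProfile)

theorem motherHat_zero_eq_zero {v : RSpace n} {i : Fin n} (hv : 2 / 3 ≤ |v i|) :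
    Ψ.motherHat 0 v = 0 := by
  have hpi := Real.pi_pos
  refine Finset.prod_eq_zero (Finset.mem_univ i) ?_
  simp only [hat, Pi.zero_apply, if_true]
  rw [Ψ.scale_eq_zero, Complex.ofReal_zero]
  rw [abs_mul, abs_of_pos (by positivity)]
  nlinarith

theorem motherHat_zero_eq_one {v : RSpace n} (hv : ∀ i, |v i| ≤ 1 / 3) :
    Ψ.motherHat 0 v = 1 := by
  have hpi := Real.pi_pos
  refine Finset.prod_eq_one fun i _ => ?_
  simp only [hat, Pi.zero_apply, if_true]
  rw [Ψ.eq_one, Complex.ofReal_one]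
  rw [abs_mul, abs_of_pos (by positivity)]
  nlinarith [hv i]

theorem sum_motherHat_ne_zero_mul_conj (v : RSpace n) (u : Fin n → ℤ) :
    ∑ ε : {ε : Fin n → Fin 2 // ε ≠ 0},
        Ψ.motherHat ε.1 v * conj (Ψ.motherHat ε.1 (v + latticePoint u)) =
      (if ∀ i, Even (u i) then Ψ.motherHat 0 ((2 : ℝ)⁻¹ • v) *
        conj (Ψ.motherHat 0 ((2 : ℝ)⁻¹ • (v + latticePoint u))) else 0) -
      Ψ.motherHat 0 v * conj (Ψ.motherHat 0 (v + latticePoint u)) := by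
  rw [← Ψ.sum_motherHat_mul_conj, Fintype.sum_eq_add_sum_subtype_ne _ (0 : Fin n → Fin 2)]
  ring

/-- The function `y ↦ U(2^δ y) conj(Φ̂^ε(y))`. -/
noncomputable def scaledPairing (U : 𝓢(RSpace n, ℂ)) (ε : Fin n → Fin 2) (δ : ℕ) :
    𝓢(RSpace n, ℂ) :=
  HasCompactSupport.toSchwartzMap (f := fun y => U ((2 : ℝ) ^ δ • y) * conj (Ψ.motherHat ε y))
    (((Ψ.motherHat_hasCompactSupport ε).comp_left (g := fun z => conj z) (map_zero _)).mul_left)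
    (((U.smooth ⊤).comp (contDiff_const_smul _)).mul
      (Complex.conjCLE.contDiff.comp (Ψ.motherHat_contDiff ε)))

theorem scaledPairing_apply (U : 𝓢(RSpace n, ℂ)) (ε : Fin n → Fin 2) (δ : ℕ) (y : RSpace n) :
    Ψ.scaledPairing U ε δ y = U ((2 : ℝ) ^ δ • y) * conj (Ψ.motherHat ε y) :=
  rfl

theorem scaledPairing_hasCompactSupport (U : 𝓢(RSpace n, ℂ)) (ε : Fin n → Fin 2) (δ : ℕ) :
    HasCompactSupport (Ψ.scaledPairing U ε δ : RSpace n → ℂ) :=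
  ((Ψ.motherHat_hasCompactSupport ε).comp_left (g := fun z => conj z) (map_zero _)).mul_left

/-- The Fourier side of the projection onto the scaling functions of level `δ`. -/
noncomputable def scalePart (U : 𝓢(RSpace n, ℂ)) (δ : ℕ) (v : RSpace n) : ℂ :=
  ∑' u : Fin n → ℤ, U (v + (2 : ℝ) ^ δ • latticePoint u) *
    (Ψ.motherHat 0 (((2 : ℝ) ^ δ)⁻¹ • v) *
      conj (Ψ.motherHat 0 (((2 : ℝ) ^ δ)⁻¹ • (v + (2 : ℝ) ^ δ • latticePoint u))))

/-- Wherever `U` is non-zero some coordinate exceeds `2/3` in modulus, and there the scaling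
function of level `0` vanishes. -/
theorem scalePart_zero {U : 𝓢(RSpace n, ℂ)} (hU : ∀ v, (∀ i, |v i| ≤ 2 / 3) → U v = 0)
    (v : RSpace n) : Ψ.scalePart U 0 v = 0 := by
  unfold scalePart
  refine (tsum_congr fun u => ?_).trans tsum_zero
  by_cases h : ∀ i, |(v + (2 : ℝ) ^ 0 • latticePoint u) i| ≤ 2 / 3
  · rw [hU _ h, zero_mul]
  · push Not at h
    obtain ⟨i, hi⟩ := h
    rw [Ψ.motherHat_zero_eq_zero (i := i)
      (v := ((2 : ℝ) ^ 0)⁻¹ • (v + (2 : ℝ) ^ 0 • latticePoint u)) (by simpa using hi.le)]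
    simp

/-- On the support of `U` the dilated scaling function equals `1`, which gives the term `u = 0`. A
term with `u_i ≠ 0` would need `|v_i| < 16/3` and `|v_i + 8 u_i| < 8/3`, whose sum falls short of
`8`. -/
theorem scalePart_three {U : 𝓢(RSpace n, ℂ)} (hU : ∀ v i, 8 / 3 ≤ |v i| → U v = 0)
    (v : RSpace n) : Ψ.scalePart U 3 v = U v := by
  unfold scalePart
  rw [tsum_eq_single 0]
  · have e : latticePoint (0 : Fin n → ℤ) = 0 := by ext i; simp [latticePoint]
    rw [e, smul_zero, add_zero]
    by_cases h : ∃ i, 8 / 3 ≤ |v i|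
    · obtain ⟨i, hi⟩ := h
      rw [hU v i hi, zero_mul]
    · push Not at h
      rw [Ψ.motherHat_zero_eq_one, map_one, mul_one, mul_one]
      intro i
      rw [PiLp.smul_apply, smul_eq_mul, abs_mul, abs_of_pos (by positivity)]
      linarith [h i]
  · intro u hu
    obtain ⟨i, hi⟩ : ∃ i, u i ≠ 0 := by
      by_contra h
      push Not at h
      exact hu (funext h)
    have h1 : (1 : ℝ) ≤ |(u i : ℝ)| := by
      exact_mod_cast Int.one_le_abs hi
    have h2 : (v + (2 : ℝ) ^ 3 • latticePoint u) i = v i + 8 * u i := by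
      simp [latticePoint]; norm_num
    have h3 : 8 * |(u i : ℝ)| ≤ |v i + 8 * u i| + |v i| := by
      calc 8 * |(u i : ℝ)| = |(v i + 8 * u i) - v i| := by rw [add_sub_cancel_left, abs_mul]; norm_num
        _ ≤ _ := abs_sub _ _
    by_cases h : 8 / 3 ≤ |v i + 8 * u i|
    · rw [hU _ i (by rwa [h2]), zero_mul]
    · rw [Ψ.motherHat_zero_eq_zero (i := i) (v := ((2 : ℝ) ^ 3)⁻¹ • v), zero_mul, mul_zero]
      rw [PiLp.smul_apply, smul_eq_mul, abs_mul, abs_of_pos (by positivity)]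
      linarith

/-- The wavelets of level `δ` span the difference of consecutive scaling projections. Even
translates in the Meyer identity give level `δ + 1`, and the missing index `ε = 0` accounts for
level `δ`. -/
theorem sum_motherHat_mul_periodization {U : 𝓢(RSpace n, ℂ)}
    (hU : ∀ v i, 8 / 3 ≤ |v i| → U v = 0) (δ : ℕ) (v : RSpace n) :
    ∑ ε : {ε : Fin n → Fin 2 // ε ≠ 0}, Ψ.motherHat ε.1 (((2 : ℝ) ^ δ)⁻¹ • v) *
        ∑' u : Fin n → ℤ, Ψ.scaledPairing U ε.1 δ (((2 : ℝ) ^ δ)⁻¹ • v + latticePoint u) =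
      Ψ.scalePart U (δ + 1) v - Ψ.scalePart U δ v := by
  have h2 : (2 : ℝ) ^ δ ≠ 0 := by positivity
  set y := ((2 : ℝ) ^ δ)⁻¹ • v with hy
  have hv : ∀ u : Fin n → ℤ, (2 : ℝ) ^ δ • (y + latticePoint u) =
      v + (2 : ℝ) ^ δ • latticePoint u := fun u => by rw [smul_add, hy, smul_inv_smul₀ h2]
  have hv' : ∀ u : Fin n → ℤ, y + latticePoint u =
      ((2 : ℝ) ^ δ)⁻¹ • (v + (2 : ℝ) ^ δ • latticePoint u) := fun u => by
    rw [← hv, inv_smul_smul₀ h2]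
  have hfin := finite_lattice_of_support hU δ v
  have hsum : ∀ F : (Fin n → ℤ) → ℂ,
      Summable fun u => U (v + (2 : ℝ) ^ δ • latticePoint u) * F u := fun F =>
    summable_of_hasFiniteSupport (hfin.subset fun u hu h => hu (by simp [h]))
  simp only [← tsum_mul_left, scaledPairing_apply, hv]
  rw [← Summable.tsum_finsetSum]
  · have e : ∀ u : Fin n → ℤ, ∑ ε : {ε : Fin n → Fin 2 // ε ≠ 0}, Ψ.motherHat ε.1 y *
        (U (v + (2 : ℝ) ^ δ • latticePoint u) * conj (Ψ.motherHat ε.1 (y + latticePoint u))) =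
        U (v + (2 : ℝ) ^ δ • latticePoint u) * (if ∀ i, Even (u i) then
          Ψ.motherHat 0 ((2 : ℝ)⁻¹ • y) *
            conj (Ψ.motherHat 0 ((2 : ℝ)⁻¹ • (y + latticePoint u))) else 0) -
        U (v + (2 : ℝ) ^ δ • latticePoint u) * (Ψ.motherHat 0 y *
            conj (Ψ.motherHat 0 (y + latticePoint u))) := by
      intro u
      rw [← mul_sub, ← Ψ.sum_motherHat_ne_zero_mul_conj, Finset.mul_sum]
      exact Finset.sum_congr rfl fun ε _ => by ring
    simp only [e]
    rw [Summable.tsum_sub (hsum _) (hsum _)]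
    congr 1
    -- Only `u = 2w` contributes, and `2^δ · 2w = 2^(δ+1) w` turns these into the translates of
    -- level `δ + 1`.
    · have hinj : Function.Injective fun w : Fin n → ℤ => fun i => 2 * w i := by
        intro w w' h
        funext i
        have := congrFun h i
        simpa using this
      rw [← hinj.tsum_eq]
      · unfold scalePart
        refine tsum_congr fun w => ?_
        have e0 : (2 : ℝ) ^ δ • latticePoint (fun i => 2 * w i) =
            (2 : ℝ) ^ (δ + 1) • latticePoint w := by
          ext i
          simp [latticePoint]
          ring
        have e1 : (2 : ℝ)⁻¹ • y = ((2 : ℝ) ^ (δ + 1))⁻¹ • v := by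
          rw [hy, smul_smul, pow_succ, mul_inv, mul_comm]
        have e2 : (2 : ℝ)⁻¹ • (y + latticePoint fun i => 2 * w i) =
            ((2 : ℝ) ^ (δ + 1))⁻¹ • (v + (2 : ℝ) ^ (δ + 1) • latticePoint w) := by
          rw [hv', e0, smul_smul, pow_succ, mul_inv, mul_comm]
        rw [if_pos fun i => even_two_mul _, e0, e1, e2]
      · intro u hu
        by_cases hev : ∀ i, Even (u i)
        · choose w hw using fun i => hev i
          exact ⟨w, funext fun i => by simp only [hw i]; ring⟩
        · exact absurd (by simp [hev]) hu
    · unfold scalePart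
      exact tsum_congr fun u => by rw [hv']
  · intro ε _
    exact (hsum fun u => Ψ.motherHat ε.1 y * conj (Ψ.motherHat ε.1 (y + latticePoint u))).congr
      fun u => by ring

end MeyerProfile

theorem exists_fourier_decay (U : 𝓢(RSpace n, ℂ)) (N : ℕ) :
    ∃ C : ℝ, 0 ≤ C ∧ ∀ k : Fin n → ℤ,
      ‖𝓕 (U : RSpace n → ℂ) (latticePoint k)‖ ≤ C * (1 + ‖k‖)⁻¹ ^ N := by
  refine ⟨2 ^ N * ((Finset.Iic (N, 0)).sup fun m => SchwartzMap.seminorm ℝ m.1 m.2) (𝓕 U),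
    by positivity, fun k => ?_⟩
  have h := SchwartzMap.one_add_le_sup_seminorm_apply (𝕜 := ℝ) (m := (N, 0)) (k := N) (n := 0)
    le_rfl le_rfl (𝓕 U) (latticePoint k)
  rw [norm_iteratedFDeriv_zero] at h
  rw [inv_pow, ← div_eq_mul_inv, le_div_iff₀ (by positivity), mul_comm]
  refine le_trans ?_ h
  change _ ≤ _ * ‖𝓕 (U : RSpace n → ℂ) (latticePoint k)‖
  gcongr
  exact norm_le_norm_latticePoint k

theorem enorm_le_latticeWeight {z : ℂ} {C : ℝ} (hC : 0 ≤ C) {k : Fin n → ℤ} {N : ℕ}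
    (h : ‖z‖ ≤ C * (1 + ‖k‖)⁻¹ ^ N) : ‖z‖ₑ ≤ ENNReal.ofReal C * (latticeWeight k)⁻¹ ^ N := by
  unfold latticeWeight
  rw [← ENNReal.ofReal_inv_of_pos (by positivity), ← ENNReal.ofReal_pow (by positivity),
    ← ENNReal.ofReal_mul hC, ← ofReal_norm]
  exact ENNReal.ofReal_le_ofReal h

/-- The map `w` records the lattice position of an index; any further finite components of the index
enter only through `hw`. -/
theorem tsum_enorm_ne_top_of_decay {ι : Type*} {c : ι → ℂ} {w : ι → Fin n → ℤ}
    (hw : ∀ N : ℕ, ∑' k : Fin n → ℤ, (latticeWeight k)⁻¹ ^ N ≠ ⊤ →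
      ∑' i, (latticeWeight (w i))⁻¹ ^ N ≠ ⊤)
    (hc : ∀ N : ℕ, ∃ C : ℝ, 0 ≤ C ∧ ∀ i, ‖c i‖ ≤ C * (1 + ‖w i‖)⁻¹ ^ N) :
    ∑' i, ‖c i‖ₑ ≠ ⊤ := by
  obtain ⟨N, hN⟩ := tsum_latticeWeight_ne_top n
  obtain ⟨C, hC0, hC⟩ := hc N
  refine ne_top_of_le_ne_top ?_ (ENNReal.tsum_le_tsum fun i => enorm_le_latticeWeight hC0 (hC i))
  rw [ENNReal.tsum_mul_left]
  exact ENNReal.mul_ne_top ENNReal.ofReal_ne_top (hw N hN)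

namespace MeyerProfile

variable (Ψ : MeyerProfile)

/-- A function with Fourier transform in the annulus `2/3 ≤ max |v_i| ≤ 8/3` is a combination of
wavelets of three consecutive levels, with rapidly decreasing coefficients. -/
theorem exists_fourier_expansion {U : 𝓢(RSpace n, ℂ)} (h1 : ∀ v i, 8 / 3 ≤ |v i| → U v = 0)
    (h2 : ∀ v, (∀ i, |v i| ≤ 2 / 3) → U v = 0) : ∃ c : OffDiagonal n → ℂ,
    (∀ N : ℕ, ∃ C : ℝ, 0 ≤ C ∧ ∀ τ, ‖c τ‖ ≤ C * (1 + ‖τ.2.2‖)⁻¹ ^ N) ∧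
    ∀ v, HasSum (fun τ : OffDiagonal n => c τ *
      ((Real.fourierChar (-(inner ℝ (((2 : ℝ) ^ (τ.2.1 : ℕ))⁻¹ • latticePoint τ.2.2) v)) : ℂ) *
        Ψ.motherHat τ.1.1 (((2 : ℝ) ^ (τ.2.1 : ℕ))⁻¹ • v))) (U v) := by
  -- These are the Fourier coefficients supplied by Poisson summation. The argument `-k` compensates
  -- for the sign of the character, since a translated wavelet carries `e^{-2πi k·v}`.
  let c : OffDiagonal n → ℂ := fun τ =>
    𝓕 (Ψ.scaledPairing U τ.1.1 τ.2.1 : RSpace n → ℂ) (latticePoint (-τ.2.2))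
  have hdec : ∀ N : ℕ, ∃ C : ℝ, 0 ≤ C ∧ ∀ τ, ‖c τ‖ ≤ C * (1 + ‖τ.2.2‖)⁻¹ ^ N := by
    intro N
    choose C hC0 hC using fun σ : {ε : Fin n → Fin 2 // ε ≠ 0} × Fin 3 =>
      exists_fourier_decay (Ψ.scaledPairing U σ.1.1 σ.2) N
    refine ⟨∑ σ, C σ, Finset.sum_nonneg fun σ _ => hC0 σ, fun τ => ?_⟩
    refine (hC (τ.1, τ.2.1) (-τ.2.2)).trans ?_
    rw [norm_neg]
    gcongr
    exact Finset.single_le_sum (f := C) (fun σ _ => hC0 σ) (Finset.mem_univ (τ.1, τ.2.1))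
  refine ⟨c, hdec, fun v => ?_⟩
  have hpoisson : ∀ (ε : {ε : Fin n → Fin 2 // ε ≠ 0}) (δ : Fin 3),
      HasSum (fun k : Fin n → ℤ => c (ε, δ, k) *
        ((Real.fourierChar (-(inner ℝ (((2 : ℝ) ^ (δ : ℕ))⁻¹ • latticePoint k) v)) : ℂ) *
          Ψ.motherHat ε.1 (((2 : ℝ) ^ (δ : ℕ))⁻¹ • v)))
        (Ψ.motherHat ε.1 (((2 : ℝ) ^ (δ : ℕ))⁻¹ • v) * ∑' u : Fin n → ℤ,
          Ψ.scaledPairing U ε.1 δ (((2 : ℝ) ^ (δ : ℕ))⁻¹ • v + latticePoint u)) := by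
    intro ε δ
    have hs : Summable fun k : Fin n → ℤ =>
        𝓕 (Ψ.scaledPairing U ε.1 δ : RSpace n → ℂ) (latticePoint k) :=
      Summable.of_enorm (tsum_enorm_ne_top_of_decay (w := id) (fun _ h => h)
        (exists_fourier_decay (Ψ.scaledPairing U ε.1 δ)))
    have h := (hasSum_fourier_latticePoint (Ψ.scaledPairing_hasCompactSupport U ε.1 δ) hs
      (((2 : ℝ) ^ (δ : ℕ))⁻¹ • v)).mul_left (Ψ.motherHat ε.1 (((2 : ℝ) ^ (δ : ℕ))⁻¹ • v))
    rw [← (Equiv.neg (Fin n → ℤ)).hasSum_iff] at h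
    refine h.congr_fun fun k => ?_
    simp only [Function.comp_apply, Equiv.neg_apply, latticePoint_neg, inner_neg_left,
      inner_smul_left, inner_smul_right, conj_trivial, c]
    ring_nf
  have hsummable : Summable fun τ : OffDiagonal n => c τ *
      ((Real.fourierChar (-(inner ℝ (((2 : ℝ) ^ (τ.2.1 : ℕ))⁻¹ • latticePoint τ.2.2) v)) : ℂ) *
        Ψ.motherHat τ.1.1 (((2 : ℝ) ^ (τ.2.1 : ℕ))⁻¹ • v)) := by
    refine Summable.of_enorm ?_
    set B : ℝ≥0∞ := ∑ σ : {ε : Fin n → Fin 2 // ε ≠ 0} × Fin 3,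
      ‖Ψ.motherHat σ.1.1 (((2 : ℝ) ^ (σ.2 : ℕ))⁻¹ • v)‖ₑ with hB
    have hle : ∀ σ : {ε : Fin n → Fin 2 // ε ≠ 0} × Fin 3,
        ‖Ψ.motherHat σ.1.1 (((2 : ℝ) ^ (σ.2 : ℕ))⁻¹ • v)‖ₑ ≤ B := fun σ =>
      Finset.single_le_sum (f := fun σ : {ε : Fin n → Fin 2 // ε ≠ 0} × Fin 3 =>
        ‖Ψ.motherHat σ.1.1 (((2 : ℝ) ^ (σ.2 : ℕ))⁻¹ • v)‖ₑ) (fun _ _ => zero_le)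
        (Finset.mem_univ σ)
    have hBt : B ≠ ⊤ := ENNReal.sum_ne_top.2 fun σ _ => enorm_ne_top
    clear_value B
    refine ne_top_of_le_ne_top (b := ∑' τ, ‖c τ‖ₑ * B) ?_ (ENNReal.tsum_le_tsum fun τ => ?_)
    · rw [ENNReal.tsum_mul_right]
      exact ENNReal.mul_ne_top
        (tsum_enorm_ne_top_of_decay (w := fun τ : OffDiagonal n => τ.2.2)
          (fun N h => tsum_offDiagonal_ne_top h) hdec) hBt
    · have hchar : ∀ r : ℝ, ‖(Real.fourierChar r : ℂ)‖ₑ = 1 := fun r => by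
        rw [← ofReal_norm, Circle.norm_coe, ENNReal.ofReal_one]
      rw [enorm_mul, enorm_mul, hchar, one_mul]
      exact mul_le_mul_right (hle (τ.1, τ.2.1)) _
  have hval := hsummable.hasSum
  -- The projection of level `3` reproduces `U` and that of level `0` annihilates it, so the three
  -- wavelet levels telescope to `U`.
  have htele := congrArg₂ (· - ·) (Ψ.scalePart_three h1 v) (Ψ.scalePart_zero h2 v)
  simp only [sub_zero] at htele
  rw [← htele]
  convert hval using 1
  rw [hsummable.tsum_prod, tsum_fintype]
  have hin : ∀ ε : {ε : Fin n → Fin 2 // ε ≠ 0}, Summable fun σ : Fin 3 × (Fin n → ℤ) =>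
      c (ε, σ) * ((Real.fourierChar (-(inner ℝ (((2 : ℝ) ^ (σ.1 : ℕ))⁻¹ • latticePoint σ.2) v)) : ℂ)
        * Ψ.motherHat ε.1 (((2 : ℝ) ^ (σ.1 : ℕ))⁻¹ • v)) := fun ε => hsummable.prod_factor ε
  simp only [fun ε => (hin ε).tsum_prod, tsum_fintype, fun ε δ => (hpoisson ε δ).tsum_eq]
  rw [Finset.sum_comm]
  simp only [Ψ.sum_motherHat_mul_periodization h1]
  rw [Fin.sum_univ_three]
  change _ = (Ψ.scalePart U 1 v - Ψ.scalePart U 0 v) + (Ψ.scalePart U 2 v - Ψ.scalePart U 1 v) +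
    (Ψ.scalePart U 3 v - Ψ.scalePart U 2 v)
  ring

end MeyerProfile

end Expansion

/-! ### Series in the Schwartz space. -/

section SchwartzSeries

variable {E : Type*} [NormedAddCommGroup E] [NormedSpace ℝ E]

/-- A pointwise convergent series of Schwartz functions converges in the Schwartz space if it
converges absolutely for each of the seminorms. -/
theorem SchwartzMap.hasSum_of_summable_seminorm {ι : Type*} {F : ι → 𝓢(E, ℂ)} {φ : 𝓢(E, ℂ)}
    (hF : ∀ x, HasSum (fun i => F i x) (φ x))
    (hs : ∀ a b : ℕ, Summable fun i => SchwartzMap.seminorm ℂ a b (F i)) : HasSum F φ := by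
  have hφ : (φ : E → ℂ) = fun x => ∑' i, F i x := funext fun x => (hF x).tsum_eq.symm
  -- Termwise differentiation, justified by uniform summability of all derivatives through `hs 0`.
  have hd : ∀ (b : ℕ) (x : E), HasSum (fun i => iteratedFDeriv ℝ b (F i) x)
      (iteratedFDeriv ℝ b φ x) := by
    intro b x
    have hle : ∀ (k : ℕ) (i : ι) (x : E), ((k : ℕ) : ℕ∞) ≤ ⊤ →
        ‖iteratedFDeriv ℝ k (F i) x‖ ≤ SchwartzMap.seminorm ℂ 0 k (F i) := fun k i x _ => by
      simpa using SchwartzMap.le_seminorm ℂ 0 k (F i) x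
    rw [hφ, iteratedFDeriv_tsum_apply (N := ⊤) (fun i => (F i).smooth ⊤) (fun k _ => hs 0 k) hle
      le_top]
    exact ((hs 0 b).of_norm_bounded fun i => hle b i x le_top).hasSum
  refine ((schwartz_withSeminorms ℂ E ℂ).tendsto_nhds _ _).2 ?_
  rintro ⟨a, b⟩ r hr
  -- Each seminorm of a remainder is bounded by the tail of the corresponding series of seminorms.
  have ht := tendsto_tsum_compl_atTop_zero fun i => SchwartzMap.seminorm ℂ a b (F i)
  filter_upwards [(tendsto_order.1 ht).2 r hr] with s hsr
  refine lt_of_le_of_lt ?_ hsr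
  refine SchwartzMap.seminorm_le_bound ℂ a b _ (tsum_nonneg fun i => apply_nonneg _ _) fun x => ?_
  have h1 : iteratedFDeriv ℝ b (∑ i ∈ s, F i - φ : 𝓢(E, ℂ)) x =
      -∑' i : {i // i ∉ s}, iteratedFDeriv ℝ b (F i) x := by
    have hsub : ((∑ i ∈ s, F i - φ : 𝓢(E, ℂ)) : E → ℂ) =
        (fun y => ∑ i ∈ s, F i y) - (φ : E → ℂ) := by
      ext y
      simp
    rw [hsub, iteratedFDeriv_sub_apply
      (ContDiff.sum fun i _ => (F i).smooth b).contDiffAt (φ.smooth b).contDiffAt,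
      iteratedFDeriv_fun_sum_apply fun i _ => ((F i).smooth b).contDiffAt]
    have := (hd b x).summable.sum_add_tsum_subtype_compl s
    rw [(hd b x).tsum_eq] at this
    rw [← this]
    abel
  have hsc : Summable fun i : {i // i ∉ s} => SchwartzMap.seminorm ℂ a b (F i) :=
    (hs a b).subtype _
  have hdc : Summable fun i : {i // i ∉ s} => ‖iteratedFDeriv ℝ b (F i) x‖ :=
    Summable.of_nonneg_of_le (fun _ => norm_nonneg _)
      (fun i => by simpa using SchwartzMap.le_seminorm ℂ 0 b (F i) x) ((hs 0 b).subtype _)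
  rw [h1, norm_neg]
  refine (mul_le_mul_of_nonneg_left (norm_tsum_le_tsum_norm hdc) (by positivity)).trans ?_
  rw [← tsum_mul_left]
  exact (hdc.mul_left _).tsum_le_tsum (fun i => SchwartzMap.le_seminorm ℂ a b (F i) x) hsc

end SchwartzSeries

/-! ### Dilations and translations of Schwartz functions. -/

section Zoom

open MeasureTheory

variable {n : ℕ}

/-- The map `u ↦ 2^{nj/2} u(2^j x - k)` on Schwartz functions. -/
noncomputable def zoomCLM (j : ℤ) (k : Fin n → ℤ) : 𝓢(RSpace n, ℂ) →L[ℂ] 𝓢(RSpace n, ℂ) :=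
  (((2 : ℝ) ^ ((n : ℝ) * j / 2) : ℝ) : ℂ) •
    SchwartzMap.compCLMOfAntilipschitz ℂ (zoom_hasTemperateGrowth j k) (zoom_antilipschitz j k)

theorem zoomCLM_apply (j : ℤ) (k : Fin n → ℤ) (u : 𝓢(RSpace n, ℂ)) (x : RSpace n) :
    zoomCLM j k u x =
      (((2 : ℝ) ^ ((n : ℝ) * j / 2) : ℝ) : ℂ) * u ((2 : ℝ) ^ j • x - latticePoint k) :=
  rfl

theorem zoomCLM_mother (Ψ : MeyerProfile) (ε : Fin n → Fin 2) (j : ℤ) (k : Fin n → ℤ) :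
    zoomCLM j k (Ψ.mother ε) = Ψ.waveletFun ε j k :=
  rfl

/-- The composition `2^δ (2^j x - k) - k' = 2^(j+δ) x - (k' + 2^δ k)` is the origin of `fineIndex`.
-/
theorem zoomCLM_zoomCLM (j : ℤ) (k : Fin n → ℤ) (δ : ℕ) (k' : Fin n → ℤ) (u : 𝓢(RSpace n, ℂ)) :
    zoomCLM j k (zoomCLM δ k' u) = zoomCLM (j + δ) (fineIndex δ k' k) u := by
  ext x
  simp only [zoomCLM_apply]
  rw [← mul_assoc, ← Complex.ofReal_mul, ← Real.rpow_add two_pos]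
  congr 2
  · push_cast
    ring_nf
  · rw [smul_sub, smul_smul, sub_sub]
    congr 1
    · rw [zpow_add₀ two_ne_zero, mul_comm]
    · ext i
      simp [latticePoint, fineIndex]
      ring

/-- The normalizing constant of `zoomCLM` on the Fourier side. -/
noncomputable def zoomFactor (n : ℕ) (j : ℤ) : ℝ :=
  (2 : ℝ) ^ ((n : ℝ) * j / 2) * (((2 : ℝ) ^ j) ^ n)⁻¹

theorem zoomFactor_pos (n : ℕ) (j : ℤ) : 0 < zoomFactor n j := by
  unfold zoomFactor
  positivity

theorem fourier_zoomCLM (j : ℤ) (k : Fin n → ℤ) (u : 𝓢(RSpace n, ℂ)) (v : RSpace n) :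
    𝓕 (zoomCLM j k u : RSpace n → ℂ) v = (zoomFactor n j : ℂ) *
      ((Real.fourierChar (-(inner ℝ (((2 : ℝ) ^ j)⁻¹ • latticePoint k) v)) : ℂ) *
        𝓕 (u : RSpace n → ℂ) (((2 : ℝ) ^ j)⁻¹ • v)) := by
  have h2 : (0 : ℝ) < 2 ^ j := by positivity
  set F : RSpace n → ℂ := fun y =>
    Real.fourierChar (-(inner ℝ (((2 : ℝ) ^ j)⁻¹ • (y + latticePoint k)) v)) •
      ((((2 : ℝ) ^ ((n : ℝ) * j / 2) : ℝ) : ℂ) * u y) with hF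
  have e1 : 𝓕 (zoomCLM j k u : RSpace n → ℂ) v =
      ∫ x : RSpace n, F ((2 : ℝ) ^ j • x - latticePoint k) := by
    rw [Real.fourier_eq]
    refine integral_congr_ae (Filter.Eventually.of_forall fun x => ?_)
    simp only [hF, sub_add_cancel, inv_smul_smul₀ h2.ne', zoomCLM_apply]
  have e2 : ∫ y : RSpace n, F (y - latticePoint k) = ∫ y : RSpace n, F y :=
    integral_sub_right_eq_self F _
  have e3 : ∀ y, F y =
      ((Real.fourierChar (-(inner ℝ (((2 : ℝ) ^ j)⁻¹ • latticePoint k) v)) : ℂ) *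
        (((2 : ℝ) ^ ((n : ℝ) * j / 2) : ℝ) : ℂ)) *
      (Real.fourierChar (-(inner ℝ y (((2 : ℝ) ^ j)⁻¹ • v))) • u y) := by
    intro y
    simp only [hF, smul_add, inner_add_left, neg_add, AddChar.map_add_eq_mul, Circle.smul_def,
      Circle.coe_mul, smul_eq_mul, inner_smul_left, inner_smul_right]
    simp only [conj_trivial]
    ring
  rw [e1, Measure.integral_comp_smul volume (fun y => F (y - latticePoint k)), e2]
  simp only [e3]
  rw [integral_const_mul, ← Real.fourier_eq, finrank_euclideanSpace_fin,
    abs_of_pos (by positivity), Complex.real_smul, zoomFactor]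
  push_cast
  ring

/-- Polynomial growth of a family of Schwartz functions indexed by a lattice. -/
def PolynomialGrowth (F : (Fin n → ℤ) → 𝓢(RSpace n, ℂ)) : Prop :=
  ∀ a b : ℕ, ∃ (N : ℕ) (C : ℝ), 0 ≤ C ∧
    ∀ k, SchwartzMap.seminorm ℂ a b (F k) ≤ C * (1 + ‖k‖) ^ N

/-- By continuity, one seminorm of `T u` is controlled by finitely many seminorms of `u`. -/
theorem PolynomialGrowth.comp {F : (Fin n → ℤ) → 𝓢(RSpace n, ℂ)} (hF : PolynomialGrowth F)
    (T : 𝓢(RSpace n, ℂ) →L[ℂ] 𝓢(RSpace n, ℂ)) : PolynomialGrowth fun k => T (F k) := by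
  intro a b
  have hcont : Continuous ((SchwartzMap.seminorm ℂ a b).comp
      (T : 𝓢(RSpace n, ℂ) →ₗ[ℂ] 𝓢(RSpace n, ℂ))) :=
    ((schwartz_withSeminorms ℂ (RSpace n) ℂ).continuous_seminorm (a, b)).comp T.continuous
  obtain ⟨s, D, -, hD⟩ := Seminorm.bound_of_continuous
    (schwartz_withSeminorms ℂ (RSpace n) ℂ) _ hcont
  choose N C hC0 hC using fun m : ℕ × ℕ => hF m.1 m.2
  refine ⟨∑ m ∈ s, N m, D * ∑ m ∈ s, C m,
    mul_nonneg D.2 (Finset.sum_nonneg fun m _ => hC0 m), fun k => ?_⟩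
  refine (hD (F k)).trans ?_
  rw [smul_apply, NNReal.smul_def, smul_eq_mul, mul_assoc]
  refine mul_le_mul_of_nonneg_left ?_ D.2
  refine Seminorm.finset_sup_apply_le (by
    have := Finset.sum_nonneg fun m (_ : m ∈ s) => hC0 m
    positivity) fun m hm => ?_
  refine (hC m k).trans ?_
  have h1 : (1 : ℝ) ≤ 1 + ‖k‖ := by linarith [norm_nonneg k]
  have h2 : C m ≤ ∑ m ∈ s, C m := Finset.single_le_sum (fun m _ => hC0 m) hm
  have h3 : N m ≤ ∑ m ∈ s, N m := Finset.single_le_sum (fun m _ => Nat.zero_le _) hm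
  exact mul_le_mul h2 (pow_le_pow_right₀ h1 h3) (by positivity) ((hC0 m).trans h2)

theorem norm_latticePoint_le (k : Fin n → ℤ) : ‖latticePoint k‖ ≤ n * ‖k‖ := by
  have h : ∀ i, ‖latticePoint k i‖ ≤ ‖k‖ := fun i => by
    refine le_trans (le_of_eq ?_) (norm_le_pi_norm k i)
    simp [latticePoint, Int.norm_eq_abs]
  rw [EuclideanSpace.norm_eq]
  refine Real.sqrt_le_iff.2 ⟨by positivity, ?_⟩
  refine (Finset.sum_le_sum fun i _ => pow_le_pow_left₀ (norm_nonneg _) (h i) 2).trans ?_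
  simp only [Finset.sum_const, Finset.card_univ, Fintype.card_fin, nsmul_eq_mul, mul_pow]
  gcongr
  exact_mod_cast Nat.le_self_pow two_ne_zero n

/-- Translation by `k` changes `‖x‖` by at most `n ‖k‖`, so a weight of degree `a` grows like `(1 +
‖k‖)^a`. -/
theorem polynomialGrowth_translate (u : 𝓢(RSpace n, ℂ)) :
    PolynomialGrowth fun k => u.compSubConstCLM ℂ (latticePoint k) := by
  intro a b
  refine ⟨a, 2 ^ a * (SchwartzMap.seminorm ℂ a b u + n ^ a * SchwartzMap.seminorm ℂ 0 b u),
    by positivity, fun k => ?_⟩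
  refine SchwartzMap.seminorm_le_bound ℂ a b _ (by positivity) fun x => ?_
  have h0 : iteratedFDeriv ℝ b (u.compSubConstCLM ℂ (latticePoint k)) x =
      iteratedFDeriv ℝ b u (x - latticePoint k) := by
    change iteratedFDeriv ℝ b (fun y => u (y - latticePoint k)) x = _
    rw [iteratedFDeriv_comp_sub]
  rw [h0]
  set y := x - latticePoint k with hy
  have h1 : ‖x‖ ≤ ‖y‖ + n * ‖k‖ := by
    calc ‖x‖ = ‖y + latticePoint k‖ := by rw [hy, sub_add_cancel]
      _ ≤ ‖y‖ + ‖latticePoint k‖ := norm_add_le _ _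
      _ ≤ _ := by gcongr; exact norm_latticePoint_le k
  have h2 : ‖x‖ ^ a ≤ 2 ^ a * (‖y‖ ^ a + (n * ‖k‖) ^ a) := by
    refine (pow_le_pow_left₀ (norm_nonneg _) h1 a).trans ?_
    refine (add_pow_le (norm_nonneg _) (by positivity) a).trans ?_
    gcongr
    · norm_num
    · omega
  have h3 := SchwartzMap.le_seminorm ℂ a b u y
  have h4 : ‖iteratedFDeriv ℝ b u y‖ ≤ SchwartzMap.seminorm ℂ 0 b u := by
    simpa using SchwartzMap.le_seminorm ℂ 0 b u y
  have h5 : ‖k‖ ^ a ≤ (1 + ‖k‖) ^ a := by gcongr; linarith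
  have h6 : (1 : ℝ) ≤ (1 + ‖k‖) ^ a := one_le_pow₀ (by linarith [norm_nonneg k])
  have h7 : 0 ≤ SchwartzMap.seminorm ℂ a b u := apply_nonneg _ _
  have h8 : 0 ≤ SchwartzMap.seminorm ℂ 0 b u := apply_nonneg _ _
  calc ‖x‖ ^ a * ‖iteratedFDeriv ℝ b u y‖
      ≤ 2 ^ a * (‖y‖ ^ a + (n * ‖k‖) ^ a) * ‖iteratedFDeriv ℝ b u y‖ := by gcongr
    _ = 2 ^ a * (‖y‖ ^ a * ‖iteratedFDeriv ℝ b u y‖ +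
        n ^ a * ‖iteratedFDeriv ℝ b u y‖ * ‖k‖ ^ a) := by rw [mul_pow]; ring
    _ ≤ 2 ^ a * (SchwartzMap.seminorm ℂ a b u * (1 + ‖k‖) ^ a +
        n ^ a * SchwartzMap.seminorm ℂ 0 b u * (1 + ‖k‖) ^ a) := by
      refine mul_le_mul_of_nonneg_left ?_ (by positivity)
      refine add_le_add (h3.trans (le_mul_of_one_le_right h7 h6)) ?_
      gcongr
    _ = _ := by ring

theorem polynomialGrowth_zoomCLM (δ : ℕ) (u : 𝓢(RSpace n, ℂ)) :
    PolynomialGrowth fun k => zoomCLM δ k u := by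
  have h := (polynomialGrowth_translate u).comp (zoomCLM δ 0)
  have e : ∀ k : Fin n → ℤ, zoomCLM δ 0 (u.compSubConstCLM ℂ (latticePoint k)) =
      zoomCLM δ k u := by
    intro k
    ext x
    simp only [zoomCLM_apply, SchwartzMap.compSubConstCLM_apply]
    congr 2
    have : latticePoint (0 : Fin n → ℤ) = 0 := by ext i; simp [latticePoint]
    rw [this, sub_zero]
  simpa only [e] using h

end Zoom

/-! ### Riesz transforms of wavelets. -/

section WaveletExpansion

variable {n : ℕ}

theorem SchwartzMap.fourier_ext {φ ψ : 𝓢(RSpace n, ℂ)}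
    (h : ∀ v, 𝓕 (φ : RSpace n → ℂ) v = 𝓕 (ψ : RSpace n → ℂ) v) : φ = ψ :=
  (FourierTransform.fourierCLE ℂ 𝓢(RSpace n, ℂ)).injective (SchwartzMap.ext h)

/-- Rapid decay of the coefficients beats the polynomial growth of the seminorms of translated
wavelets. -/
theorem PolynomialGrowth.summable_seminorm
    {W : {ε : Fin n → Fin 2 // ε ≠ 0} → ℕ → (Fin n → ℤ) → 𝓢(RSpace n, ℂ)}
    (hW : ∀ ε δ, PolynomialGrowth (W ε δ)) {c : OffDiagonal n → ℂ}
    (hc : ∀ N : ℕ, ∃ C : ℝ, 0 ≤ C ∧ ∀ τ, ‖c τ‖ ≤ C * (1 + ‖τ.2.2‖)⁻¹ ^ N) (a b : ℕ) :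
    Summable fun τ : OffDiagonal n => SchwartzMap.seminorm ℂ a b
      (c τ • W τ.1 τ.2.1 τ.2.2) := by
  choose M D hD0 hD using fun σ : {ε : Fin n → Fin 2 // ε ≠ 0} × Fin 3 =>
    hW σ.1 σ.2 a b
  have hdec : ∀ N : ℕ, ∃ C : ℝ, 0 ≤ C ∧ ∀ τ : OffDiagonal n,
      ‖((SchwartzMap.seminorm ℂ a b (c τ • W τ.1 τ.2.1 τ.2.2) :
        ℝ) : ℂ)‖ ≤ C * (1 + ‖τ.2.2‖)⁻¹ ^ N := by
    intro N
    obtain ⟨C, hC0, hC⟩ := hc (N + ∑ σ, M σ)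
    refine ⟨C * ∑ σ, D σ, mul_nonneg hC0 (Finset.sum_nonneg fun σ _ => hD0 σ), fun τ => ?_⟩
    have h1 : (1 : ℝ) ≤ 1 + ‖τ.2.2‖ := by linarith [norm_nonneg τ.2.2]
    have h2 : D (τ.1, τ.2.1) ≤ ∑ σ, D σ :=
      Finset.single_le_sum (fun σ _ => hD0 σ) (Finset.mem_univ (τ.1, τ.2.1))
    have h3 : M (τ.1, τ.2.1) ≤ ∑ σ, M σ :=
      Finset.single_le_sum (fun σ _ => Nat.zero_le _) (Finset.mem_univ (τ.1, τ.2.1))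
    have h4 : 0 < 1 + ‖τ.2.2‖ := by linarith
    rw [Complex.norm_real, Real.norm_of_nonneg (apply_nonneg _ _), map_smul_eq_mul]
    calc ‖c τ‖ * _ ≤ (C * (1 + ‖τ.2.2‖)⁻¹ ^ (N + ∑ σ, M σ)) *
          ((∑ σ, D σ) * (1 + ‖τ.2.2‖) ^ (∑ σ, M σ)) := by
          refine mul_le_mul (hC τ) ((hD (τ.1, τ.2.1) τ.2.2).trans ?_) (apply_nonneg _ _)
            (by positivity)
          exact mul_le_mul h2 (pow_le_pow_right₀ h1 h3) (by positivity) ((hD0 _).trans h2)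
      _ = C * (∑ σ, D σ) * (1 + ‖τ.2.2‖)⁻¹ ^ N := by
          rw [pow_add, inv_pow _ (∑ σ, M σ)]
          field_simp
  exact Complex.summable_ofReal.1 (Summable.of_enorm
    (tsum_enorm_ne_top_of_decay (fun N h => tsum_offDiagonal_ne_top h) hdec))

namespace MeyerProfile

variable (Ψ : MeyerProfile)

theorem fourier_rieszTest_wavelet (l : Fin n) (ε : {ε : Fin n → Fin 2 // ε ≠ 0}) (j : ℤ)
    (k : Fin n → ℤ) (v : RSpace n) :
    𝓕 ((rieszTest l (Ψ.wavelet ε j k) : 𝓢(RSpace n, ℂ)) : RSpace n → ℂ) v =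
      rieszSymbol l v * ((zoomFactor n j : ℂ) *
        ((Real.fourierChar (-(inner ℝ (((2 : ℝ) ^ j)⁻¹ • latticePoint k) v)) : ℂ) *
          Ψ.motherHat ε.1 (((2 : ℝ) ^ j)⁻¹ • v))) := by
  rw [fourier_rieszTest]
  change _ * 𝓕 (Ψ.waveletFun ε.1 j k : RSpace n → ℂ) v = _
  rw [← zoomCLM_mother, fourier_zoomCLM, fourier_mother]
  rfl

theorem motherHat_eq_zero_of_ge (ε : Fin n → Fin 2) {v : RSpace n} {i : Fin n}
    (hv : 4 / 3 ≤ |v i|) : Ψ.motherHat ε v = 0 := by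
  have hpi := Real.pi_pos
  refine Finset.prod_eq_zero (Finset.mem_univ i) ?_
  have h : 8 * Real.pi / 3 ≤ |2 * Real.pi * v i| := by
    rw [abs_mul, abs_of_pos (by positivity)]
    nlinarith
  unfold hat
  split_ifs
  · rw [Ψ.scale_eq_zero (by linarith), Complex.ofReal_zero]
  · rw [Ψ.detail_eq_zero_of_ge h, Complex.ofReal_zero, zero_mul]

theorem motherHat_eq_zero_of_le {ε : Fin n → Fin 2} (hε : ε ≠ 0) {v : RSpace n}
    (hv : ∀ i, |v i| ≤ 1 / 3) : Ψ.motherHat ε v = 0 := by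
  have hpi := Real.pi_pos
  obtain ⟨i, hi⟩ : ∃ i, ε i ≠ 0 := by
    by_contra h
    push Not at h
    exact hε (funext h)
  refine Finset.prod_eq_zero (Finset.mem_univ i) (Ψ.hat_one_eq_zero hi ?_)
  rw [abs_mul, abs_of_pos (by positivity)]
  nlinarith [hv i]

theorem zoomCLM_wavelet (ε : {ε : Fin n → Fin 2 // ε ≠ 0}) (j : ℤ) (k : Fin n → ℤ) (δ : ℕ)
    (k' : Fin n → ℤ) : zoomCLM j k (Ψ.wavelet ε δ k' : 𝓢(RSpace n, ℂ)) =
      Ψ.wavelet ε (j + δ) (fineIndex δ k' k) := by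
  change zoomCLM j k (Ψ.waveletFun ε.1 δ k') = Ψ.waveletFun ε.1 (j + δ) (fineIndex δ k' k)
  rw [← zoomCLM_mother, zoomCLM_zoomCLM, zoomCLM_mother]

/-- Riesz transforms commute with translations, and with dilations because the symbol is homogeneous
of degree zero. -/
theorem zoomCLM_rieszTest_wavelet (l : Fin n) (ε : {ε : Fin n → Fin 2 // ε ≠ 0}) (j : ℤ)
    (k : Fin n → ℤ) (δ : ℕ) (k' : Fin n → ℤ) :
    zoomCLM j k (rieszTest l (Ψ.wavelet ε δ k') : 𝓢(RSpace n, ℂ)) =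
      rieszTest l (Ψ.wavelet ε (j + δ) (fineIndex δ k' k)) := by
  refine SchwartzMap.fourier_ext fun v => ?_
  have h2 : (0 : ℝ) < ((2 : ℝ) ^ j)⁻¹ := by positivity
  have h := congrArg (fun u : 𝓢(RSpace n, ℂ) => 𝓕 (u : RSpace n → ℂ) v)
    (Ψ.zoomCLM_wavelet ε j k δ k')
  simp only [fourier_zoomCLM] at h
  rw [fourier_zoomCLM, fourier_rieszTest, fourier_rieszTest]
  change _ * (_ * (rieszSymbol l _ * _)) = rieszSymbol l v * _
  rw [← h, rieszSymbol_smul l h2]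
  ring

theorem polynomialGrowth_wavelet (ε : {ε : Fin n → Fin 2 // ε ≠ 0}) (δ : ℕ) :
    PolynomialGrowth fun k : Fin n → ℤ => (Ψ.wavelet ε δ k : 𝓢(RSpace n, ℂ)) :=
  polynomialGrowth_zoomCLM δ (Ψ.mother ε.1)

/-- The Riesz transform of a wavelet is a combination of wavelets of the neighbouring levels, with
rapidly decreasing coefficients that depend on the level and the position only through the parity
of the position. -/
theorem exists_rieszTest_expansion (l : Fin n) (ε : {ε : Fin n → Fin 2 // ε ≠ 0})
    (e : Fin n → Fin 2) : ∃ c : OffDiagonal n → ℂ,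
    (∀ N : ℕ, ∃ C : ℝ, 0 ≤ C ∧ ∀ τ, ‖c τ‖ ≤ C * (1 + ‖τ.2.2‖)⁻¹ ^ N) ∧
    ∀ (f : LizorkinDist n) (j : ℤ) (k₁ : Fin n → ℤ), HasSum (fun τ : OffDiagonal n => c τ *
        f (Ψ.wavelet τ.1 (j - 1 + (τ.2.1 : ℕ)) (fineIndex τ.2.1 τ.2.2 k₁)))
      (f (rieszTest l (Ψ.wavelet ε j (parityIndex e k₁)))) := by
  -- It suffices to expand the wavelet of level `1` at the residue `e`, whose annulus is the one
  -- treated on the Fourier side and involves levels `0`, `1`, `2`. A zoom by `(j - 1, k₁)` then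
  -- reaches level `j` and position `2 k₁ + e`.
  set k₀ : Fin n → ℤ := fun a => ((e a : ℕ) : ℤ)
  obtain ⟨φ, hφ⟩ : ∃ φ : 𝓢(RSpace n, ℂ), φ = rieszTest l (Ψ.wavelet ε (1 : ℕ) k₀) := ⟨_, rfl⟩
  have hφv := Ψ.fourier_rieszTest_wavelet l ε (1 : ℕ) k₀
  rw [← hφ] at hφv
  change ∀ v, (𝓕 φ : 𝓢(RSpace n, ℂ)) v = _ at hφv
  obtain ⟨c, hc, hcs⟩ := Ψ.exists_fourier_expansion (U := 𝓕 φ)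
    (fun v i hv => by
      rw [hφv, Ψ.motherHat_eq_zero_of_ge ε.1 (i := i), mul_zero, mul_zero, mul_zero]
      rw [PiLp.smul_apply, smul_eq_mul, abs_mul, abs_of_pos (by positivity)]
      norm_num
      linarith)
    (fun v hv => by
      rw [hφv, Ψ.motherHat_eq_zero_of_le ε.2, mul_zero, mul_zero, mul_zero]
      intro i
      rw [PiLp.smul_apply, smul_eq_mul, abs_mul, abs_of_pos (by positivity)]
      norm_num
      linarith [hv i])
  let c' : OffDiagonal n → ℂ := fun τ => c τ * ((zoomFactor n (τ.2.1 : ℕ) : ℝ) : ℂ)⁻¹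
  have hc' : ∀ N : ℕ, ∃ C : ℝ, 0 ≤ C ∧ ∀ τ, ‖c' τ‖ ≤ C * (1 + ‖τ.2.2‖)⁻¹ ^ N := by
    intro N
    obtain ⟨C, hC0, hC⟩ := hc N
    have hz : ∀ δ : Fin 3, 0 ≤ (zoomFactor n (δ : ℕ))⁻¹ := fun δ =>
      inv_nonneg.2 (zoomFactor_pos n _).le
    refine ⟨C * ∑ δ : Fin 3, (zoomFactor n (δ : ℕ))⁻¹,
      mul_nonneg hC0 (Finset.sum_nonneg fun δ _ => hz δ), fun τ => ?_⟩
    rw [norm_mul, norm_inv, Complex.norm_real, Real.norm_of_nonneg (zoomFactor_pos n _).le,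
      mul_right_comm]
    refine mul_le_mul (hC τ) ?_ (hz _) (by positivity)
    exact Finset.single_le_sum (f := fun δ : Fin 3 => (zoomFactor n (δ : ℕ))⁻¹)
      (fun δ _ => hz δ) (Finset.mem_univ τ.2.1)
  refine ⟨c', hc', fun f j k₁ => ?_⟩
  -- Pointwise convergence is known on the Fourier side. It is upgraded there to convergence in the
  -- Schwartz space and carried back by the inverse transform.
  have hsum : HasSum (fun τ : OffDiagonal n =>
      c' τ • (Ψ.wavelet τ.1 (τ.2.1 : ℕ) τ.2.2 : 𝓢(RSpace n, ℂ))) φ := by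
    have hW : ∀ ε (δ : ℕ), PolynomialGrowth fun k : Fin n → ℤ =>
        𝓕 (Ψ.wavelet ε δ k : 𝓢(RSpace n, ℂ)) := fun ε δ =>
      (Ψ.polynomialGrowth_wavelet ε δ).comp
        (FourierTransform.fourierCLE ℂ 𝓢(RSpace n, ℂ)).toContinuousLinearMap
    have hF : HasSum (fun τ : OffDiagonal n =>
        c' τ • 𝓕 (Ψ.wavelet τ.1 (τ.2.1 : ℕ) τ.2.2 : 𝓢(RSpace n, ℂ))) (𝓕 φ) := by
      refine SchwartzMap.hasSum_of_summable_seminorm (fun v => ?_)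
        fun a b => PolynomialGrowth.summable_seminorm hW hc' a b
      refine (hcs v).congr_fun fun τ => ?_
      have h1 : (𝓕 (Ψ.wavelet τ.1 (τ.2.1 : ℕ) τ.2.2 : 𝓢(RSpace n, ℂ)) : 𝓢(RSpace n, ℂ)) v = _ :=
        fourier_zoomCLM (τ.2.1 : ℕ) τ.2.2 (Ψ.mother τ.1.1) v
      have h0 : ((zoomFactor n (τ.2.1 : ℕ) : ℝ) : ℂ) ≠ 0 :=
        Complex.ofReal_ne_zero.2 (zoomFactor_pos n _).ne'
      rw [smul_apply, h1, fourier_mother, smul_eq_mul, zpow_natCast]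
      simp only [c']
      rw [mul_assoc (c τ), inv_mul_cancel_left₀ h0]
      rfl
    have h := (FourierTransform.fourierCLE ℂ 𝓢(RSpace n, ℂ)).symm.toContinuousLinearMap.hasSum hF
    simp only [map_smul] at h
    convert h using 1
    · funext τ
      congr 1
      exact ((FourierTransform.fourierCLE ℂ 𝓢(RSpace n, ℂ)).symm_apply_apply _).symm
    · exact ((FourierTransform.fourierCLE ℂ 𝓢(RSpace n, ℂ)).symm_apply_apply _).symm
  have hz := (zoomCLM (j - 1) k₁).hasSum hsum
  have hj : j - 1 + ((1 : ℕ) : ℤ) = j := by push_cast; ring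
  have hk : fineIndex 1 k₀ k₁ = parityIndex e k₁ := by
    funext a
    simp [fineIndex, parityIndex, k₀]
    ring
  rw [hφ, zoomCLM_rieszTest_wavelet, hj, hk] at hz
  simp only [map_smul, zoomCLM_wavelet] at hz
  -- The topology of `𝓢_∞` is induced from the Schwartz space, so the series converges there and `f`
  -- acts term by term.
  have hl : HasSum (fun τ : OffDiagonal n => c' τ •
      Ψ.wavelet τ.1 (j - 1 + (τ.2.1 : ℕ)) (fineIndex τ.2.1 τ.2.2 k₁))
      (rieszTest l (Ψ.wavelet ε j (parityIndex e k₁))) :=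
    (Topology.IsInducing.hasSum_iff (g := (lizorkin n).subtype) Topology.IsInducing.subtypeVal
      _ _).1 hz
  simpa only [map_smul, smul_eq_mul] using f.hasSum hl

end MeyerProfile

end WaveletExpansion

/-! ### Elementary properties of the local norms. -/

section LocalNorm

open MeasureTheory

variable {n : ℕ}

theorem localNorm_mono [NeZero n] {p q : ℝ} (hp : 0 < p) (hq : 0 < q) (γ₂ : ℝ) {J : ℤ}
    (K : Fin n → ℤ) {c d : {ε : Fin n → Fin 2 // ε ≠ 0} → ℤ → (Fin n → ℤ) → ℝ≥0∞}
    (h : ∀ ε j k, J ≤ j → c ε j k ≤ d ε j k) :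
    localNorm p q γ₂ J K c ≤ localNorm p q γ₂ J K d := by
  rw [localNorm_eq, localNorm_eq]
  have hpq : 0 ≤ p / q := by positivity
  have hp' : 0 ≤ 1 / p := by positivity
  gcongr with x
  unfold localSum
  refine ENNReal.tsum_le_tsum fun ε => ENNReal.tsum_le_tsum fun j => ENNReal.tsum_le_tsum fun k => ?_
  split_ifs with hs
  · gcongr
    exact h ε j k (scale_le_of_dyadicCube_subset hs)
  · exact le_rfl

theorem localNorm_rpow_mul {p q : ℝ} (hp : 0 < p) (hq : 0 < q) (γ₂ : ℝ) (J : ℤ)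
    (K : Fin n → ℤ) (r : ℝ≥0∞) (c : {ε : Fin n → Fin 2 // ε ≠ 0} → ℤ → (Fin n → ℤ) → ℝ≥0∞) :
    localNorm p q γ₂ J K (fun ε j k => r ^ q * c ε j k) = r * localNorm p q γ₂ J K c := by
  have hpq : 0 ≤ p / q := by positivity
  have hp' : 0 ≤ 1 / p := by positivity
  have h1 : ∀ x, localSum J K (fun ε j k => r ^ q * c ε j k) x = r ^ q * localSum J K c x := by
    intro x
    unfold localSum
    simp only [← ENNReal.tsum_mul_left, mul_ite, mul_zero, mul_assoc]
  rw [localNorm_eq, localNorm_eq]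
  simp only [h1, ENNReal.mul_rpow_of_nonneg _ _ hpq, ← ENNReal.rpow_mul, mul_div_cancel₀ p hq.ne']
  rw [lintegral_const_mul _ ((measurable_localSum _ _ _).pow_const _),
    ENNReal.mul_rpow_of_nonneg _ _ hp', ← ENNReal.rpow_mul, mul_one_div_cancel hp.ne',
    ENNReal.rpow_one]
  ring

theorem ENNReal.add_rpow_le_two_rpow_mul {s : ℝ} (hs : 0 ≤ s) (x y : ℝ≥0∞) :
    (x + y) ^ s ≤ 2 ^ s * (x ^ s + y ^ s) := by
  have h : (x + y) ^ s ≤ 2 ^ s * (max x y) ^ s := by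
    rw [← ENNReal.mul_rpow_of_nonneg _ _ hs, two_mul]
    gcongr
    · exact le_max_left _ _
    · exact le_max_right _ _
  refine h.trans ?_
  gcongr
  rcases le_total x y with h1 | h1
  · rw [max_eq_right h1]
    exact le_add_self
  · rw [max_eq_left h1]
    exact le_self_add

/-- A quasi-triangle inequality with a constant suffices, and it avoids distinguishing cases for `p
/ q`. -/
theorem exists_localNorm_add_le {p q : ℝ} (hp : 0 < p) (hq : 0 < q) (γ₂ : ℝ) :
    ∃ C : ℝ≥0∞, C ≠ ⊤ ∧ ∀ (J : ℤ) (K : Fin n → ℤ)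
      (c d : {ε : Fin n → Fin 2 // ε ≠ 0} → ℤ → (Fin n → ℤ) → ℝ≥0∞),
      localNorm p q γ₂ J K (fun ε j k => c ε j k + d ε j k) ≤
        C * (localNorm p q γ₂ J K c + localNorm p q γ₂ J K d) := by
  have hpq : 0 ≤ p / q := by positivity
  have hp' : 0 ≤ 1 / p := by positivity
  refine ⟨((2 : ℝ≥0∞) ^ (p / q)) ^ (1 / p) * 2 ^ (1 / p), ENNReal.mul_ne_top
    (ENNReal.rpow_ne_top_of_nonneg hp' (ENNReal.rpow_ne_top_of_nonneg hpq ENNReal.ofNat_ne_top))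
    (ENNReal.rpow_ne_top_of_nonneg hp' ENNReal.ofNat_ne_top), fun J K c d => ?_⟩
  have h1 : ∀ x, localSum J K (fun ε j k => c ε j k + d ε j k) x =
      localSum J K c x + localSum J K d x := by
    intro x
    unfold localSum
    simp only [← ENNReal.tsum_add]
    refine tsum_congr fun ε => tsum_congr fun j => tsum_congr fun k => ?_
    split_ifs
    · rw [add_mul]
    · rw [add_zero]
  rw [localNorm_eq, localNorm_eq, localNorm_eq, ← mul_add, mul_left_comm]
  refine mul_le_mul_right ?_ _
  simp only [h1]
  calc (∫⁻ x, (localSum J K c x + localSum J K d x) ^ (p / q)) ^ (1 / p)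
      ≤ (∫⁻ x, 2 ^ (p / q) * (localSum J K c x ^ (p / q) + localSum J K d x ^ (p / q)))
          ^ (1 / p) := by
        gcongr with x
        exact ENNReal.add_rpow_le_two_rpow_mul hpq _ _
    _ = ((2 : ℝ≥0∞) ^ (p / q)) ^ (1 / p) * ((∫⁻ x, localSum J K c x ^ (p / q)) +
          ∫⁻ x, localSum J K d x ^ (p / q)) ^ (1 / p) := by
        rw [lintegral_const_mul' _ _ (ENNReal.rpow_ne_top_of_nonneg hpq ENNReal.ofNat_ne_top),
          lintegral_add_left ((measurable_localSum _ _ _).pow_const _),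
          ENNReal.mul_rpow_of_nonneg _ _ hp']
    _ ≤ _ := by
        rw [mul_assoc]
        gcongr
        exact ENNReal.add_rpow_le_two_rpow_mul hp' _ _

end LocalNorm

/-! ### Almost diagonal bound for the coefficients. -/

section CoefficientBound

variable {n : ℕ}

/-- The wavelet coefficients of a Riesz transform are controlled by the wavelet coefficients through
an almost diagonal matrix. -/
theorem MeyerProfile.exists_enorm_rieszTest_rpow_le (Ψ : MeyerProfile) {q : ℝ} (hq : 1 ≤ q)
    (N : ℕ) : ∃ C : ℝ≥0∞, C ≠ ⊤ ∧ ∀ (l : Fin n) (ε : {ε : Fin n → Fin 2 // ε ≠ 0})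
      (e : Fin n → Fin 2) (f : LizorkinDist n) (j : ℤ) (k₁ : Fin n → ℤ),
      ‖f (rieszTest l (Ψ.wavelet ε j (parityIndex e k₁)))‖ₑ ^ q ≤
        C * ∑' τ : OffDiagonal n, (latticeWeight τ.2.2)⁻¹ ^ N *
          ‖f (Ψ.wavelet τ.1 (j - 1 + (τ.2.1 : ℕ)) (fineIndex τ.2.1 τ.2.2 k₁))‖ₑ ^ q := by
  have hq0 : 0 < q := by linarith
  obtain ⟨M, hM⟩ := tsum_latticeWeight_ne_top n
  choose c hc hcs using fun σ : Fin n × {ε : Fin n → Fin 2 // ε ≠ 0} × (Fin n → Fin 2) =>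
    Ψ.exists_rieszTest_expansion σ.1 σ.2.1 σ.2.2
  -- Of the decay `M + N`, the part `M` makes the weights in the triangle inequality summable and
  -- `N` is kept for the conclusion.
  choose D hD0 hD using fun σ => hc σ (M + N)
  set D' : ℝ≥0∞ := ∑ σ, ENNReal.ofReal (D σ) with hD'
  set S : ℝ≥0∞ := ∑' τ : OffDiagonal n, (latticeWeight τ.2.2)⁻¹ ^ M with hS
  have hD't : D' ≠ ⊤ := ENNReal.sum_ne_top.2 fun σ _ => ENNReal.ofReal_ne_top
  have hSt : S ≠ ⊤ := tsum_offDiagonal_ne_top (n := n) hM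
  refine ⟨S ^ q * D' ^ q, ENNReal.mul_ne_top (ENNReal.rpow_ne_top_of_nonneg hq0.le hSt)
    (ENNReal.rpow_ne_top_of_nonneg hq0.le hD't), fun l ε e f j k₁ => ?_⟩
  set z : OffDiagonal n → ℂ := fun τ =>
    f (Ψ.wavelet τ.1 (j - 1 + (τ.2.1 : ℕ)) (fineIndex τ.2.1 τ.2.2 k₁)) with hz
  have hcz : ∀ τ, ‖c (l, ε, e) τ‖ₑ ≤ D' * (latticeWeight τ.2.2)⁻¹ ^ (M + N) := fun τ =>
    (enorm_le_latticeWeight (hD0 _) (hD (l, ε, e) τ)).trans (mul_le_mul_left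
      (Finset.single_le_sum (f := fun σ => ENNReal.ofReal (D σ)) (fun _ _ => zero_le)
        (Finset.mem_univ (l, ε, e))) _)
  have h1 : ‖f (rieszTest l (Ψ.wavelet ε j (parityIndex e k₁)))‖ₑ ≤
      ∑' τ : OffDiagonal n, (latticeWeight τ.2.2)⁻¹ ^ M *
        (D' * (latticeWeight τ.2.2)⁻¹ ^ N * ‖z τ‖ₑ) := by
    rw [← (hcs (l, ε, e) f j k₁).tsum_eq]
    refine (enorm_tsum_le_tsum_enorm).trans (ENNReal.tsum_le_tsum fun τ => ?_)
    rw [enorm_mul]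
    calc ‖c (l, ε, e) τ‖ₑ * ‖z τ‖ₑ ≤ D' * (latticeWeight τ.2.2)⁻¹ ^ (M + N) * ‖z τ‖ₑ :=
          mul_le_mul_left (hcz τ) _
      _ = _ := by rw [pow_add]; ring
  refine (ENNReal.rpow_le_rpow h1 hq0.le).trans ((ENNReal.rpow_tsum_mul_le hq0 _ _).trans ?_)
  rw [mul_assoc]
  refine mul_le_mul_right ?_ _
  rw [← ENNReal.tsum_mul_left]
  refine ENNReal.tsum_le_tsum fun τ => ?_
  rw [ENNReal.mul_rpow_of_nonneg _ _ hq0.le, ENNReal.mul_rpow_of_nonneg _ _ hq0.le, mul_assoc]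
  refine mul_le_mul_right (mul_le_mul_left ?_ _) _
  -- Raising the factor `(latticeWeight k)⁻¹ ^ N`, which is at most `1`, to the power `q ≥ 1` only
  -- decreases it.
  refine ENNReal.rpow_le_self_of_le_one ?_ hq
  exact pow_le_one₀ zero_le (ENNReal.inv_le_one.2 (one_le_latticeWeight _))

end CoefficientBound

/-! ### One weight for both sides of the threshold `t = 2^{-2βj}`. -/

section LevelWeight

/-- The exponent of `levelWeight`. -/
noncomputable def levelExponent (β q γ m m' : ℝ) (j : ℤ) (σ : ℝ) : ℝ :=
  q * j * γ + 2 * β * q * (m * max (j - σ) 0 + m' * min (j - σ) 0)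

/-- For `t = 2^{-2βσ}`, the weight `2^{qjγ} max(1, t 2^{2βj})^{qm} min(1, t 2^{2βj})^{qm'}`. -/
noncomputable def levelWeight (β q γ m m' : ℝ) (j : ℤ) (σ : ℝ) : ℝ≥0∞ :=
  ENNReal.ofReal ((2 : ℝ) ^ levelExponent β q γ m m' j σ)

/-- The exponent is a Lipschitz function of `j`, with constants independent of `σ` also across the
kink at `j = σ`. Coefficients of norms I and II, or III and IV, may therefore be mixed when the
level moves by one. -/
theorem levelWeight_le {β q m m' : ℝ} (hβ : 0 ≤ β) (hq : 0 ≤ q) (hm : 0 ≤ m) (hm' : 0 ≤ m') (γ : ℝ)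
    {j j' : ℤ} (h : |j - j'| ≤ 1) (σ : ℝ) : levelWeight β q γ m m' j σ ≤
      ENNReal.ofReal ((2 : ℝ) ^ (q * |γ| + 2 * β * q * (m + m'))) *
        levelWeight β q γ m m' j' σ := by
  have hr : |(j : ℝ) - j'| ≤ 1 := by exact_mod_cast h
  obtain ⟨hr1, hr2⟩ := abs_le.1 hr
  unfold levelWeight
  rw [← ENNReal.ofReal_mul (by positivity), ← Real.rpow_add two_pos]
  refine ENNReal.ofReal_le_ofReal (Real.rpow_le_rpow_of_exponent_le one_le_two ?_)
  unfold levelExponent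
  have h1 : max ((j : ℝ) - σ) 0 ≤ max ((j' : ℝ) - σ) 0 + 1 :=
    max_le (by linarith [le_max_left ((j' : ℝ) - σ) 0]) (by linarith [le_max_right ((j' : ℝ) - σ) 0])
  have h2 : min ((j : ℝ) - σ) 0 ≤ min ((j' : ℝ) - σ) 0 + 1 := by
    rw [← min_add_add_right]
    exact min_le_min (by linarith) (by linarith)
  have h3 : ((j : ℝ) - j') * γ ≤ |γ| := by
    calc ((j : ℝ) - j') * γ ≤ |((j : ℝ) - j') * γ| := le_abs_self _
      _ = |(j : ℝ) - j'| * |γ| := abs_mul _ _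
      _ ≤ 1 * |γ| := by gcongr
      _ = |γ| := one_mul _
  have h4 := mul_le_mul_of_nonneg_left h3 hq
  have h5 := mul_le_mul_of_nonneg_left h1 hm
  have h6 := mul_le_mul_of_nonneg_left h2 hm'
  have h7 := mul_le_mul_of_nonneg_left (add_le_add h5 h6) (by positivity : 0 ≤ 2 * β * q)
  linarith

/-- The level `-log₂ t / (2β)` that corresponds to the time `t`. -/
noncomputable def timeLevel (β t : ℝ) : ℝ := -(Real.logb 2 t / (2 * β))

theorem le_timeLevel_iff {β t : ℝ} (hβ : 0 < β) (ht : 0 < t) (j : ℤ) :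
    (j : ℝ) ≤ timeLevel β t ↔ t ≤ (2 : ℝ) ^ (-(2 * j * β)) := by
  rw [← Real.logb_le_iff_le_rpow one_lt_two ht, timeLevel, le_neg, div_le_iff₀ (by positivity)]
  constructor <;> intro h <;> linarith

theorem rpow_eq_two_rpow_timeLevel {β t : ℝ} (hβ : 0 < β) (ht : 0 < t) (x : ℝ) :
    t ^ x = (2 : ℝ) ^ (-(2 * β * timeLevel β t * x)) := by
  have h : -(2 * β * timeLevel β t * x) = Real.logb 2 t * x := by
    unfold timeLevel
    field_simp
  rw [h, Real.rpow_mul zero_le_two, Real.rpow_logb two_pos (by norm_num) ht]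

theorem rpow_mul_ofReal_eq {β t : ℝ} (hβ : 0 < β) (ht : 0 < t) {q : ℝ} (hq : 0 ≤ q) (γ m : ℝ)
    (j : ℤ) : ENNReal.ofReal (t ^ m) ^ q * ENNReal.ofReal ((2 : ℝ) ^ (q * j * (γ + 2 * m * β))) =
      ENNReal.ofReal ((2 : ℝ) ^ (q * j * γ + 2 * β * q * (m * (j - timeLevel β t)))) := by
  rw [ENNReal.ofReal_rpow_of_nonneg (by positivity) hq, ← Real.rpow_mul ht.le,
    rpow_eq_two_rpow_timeLevel hβ ht, ← ENNReal.ofReal_mul (by positivity), ← Real.rpow_add two_pos]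
  congr 2
  ring

/-- Above the time level the weight is that of norms I and III. Below it, by the next lemma, it is
that of norm IV, or of norm II if `m' = 0`. -/
theorem levelWeight_of_timeLevel_le {β t : ℝ} (hβ : 0 < β) (ht : 0 < t) {q : ℝ} (hq : 0 ≤ q)
    (γ m m' : ℝ) {j : ℤ} (h : timeLevel β t ≤ j) : levelWeight β q γ m m' j (timeLevel β t) =
      ENNReal.ofReal (t ^ m) ^ q * ENNReal.ofReal ((2 : ℝ) ^ (q * j * (γ + 2 * m * β))) := by
  rw [rpow_mul_ofReal_eq hβ ht hq, levelWeight, levelExponent, max_eq_left (by linarith),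
    min_eq_right (by linarith), mul_zero, add_zero]

theorem levelWeight_of_le_timeLevel {β t : ℝ} (hβ : 0 < β) (ht : 0 < t) {q : ℝ} (hq : 0 ≤ q)
    (γ m m' : ℝ) {j : ℤ} (h : (j : ℝ) ≤ timeLevel β t) : levelWeight β q γ m m' j (timeLevel β t) =
      ENNReal.ofReal (t ^ m') ^ q * ENNReal.ofReal ((2 : ℝ) ^ (q * j * (γ + 2 * m' * β))) := by
  rw [rpow_mul_ofReal_eq hβ ht hq, levelWeight, levelExponent, max_eq_right (by linarith),
    min_eq_left (by linarith), mul_zero, zero_add]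

theorem ofReal_rpow_div {t : ℝ} (ht : 0 < t) {q : ℝ} (hq : 0 ≤ q) (m : ℝ) :
    ENNReal.ofReal (t ^ (q * m) / t) = ENNReal.ofReal (t ^ m) ^ q * ENNReal.ofReal t⁻¹ := by
  rw [ENNReal.ofReal_rpow_of_nonneg (by positivity) hq, ← Real.rpow_mul ht.le,
    ← ENNReal.ofReal_mul (by positivity), mul_comm m q, div_eq_mul_inv]

end LevelWeight

/-! ### The four norms expressed through two arrays. -/

section RieszBound

open MeasureTheory

variable {n : ℕ} (Ψ : MeyerProfile) {p q m m' β : ℝ} (γ₁ γ₂ : ℝ)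

/-- The coefficient array that underlies the first two norms. -/
noncomputable def pointwiseArray (q γ m β : ℝ) (a : ℝ → LizorkinDist n) (t : ℝ)
    (ε : {ε : Fin n → Fin 2 // ε ≠ 0}) (j : ℤ) (k : Fin n → ℤ) : ℝ≥0∞ :=
  levelWeight β q γ m 0 j (timeLevel β t) * ‖waveletCoeff Ψ a ε j k t‖ₑ ^ q

/-- The coefficient array that underlies the last two norms. -/
noncomputable def integralArray (q γ m m' β : ℝ) (a : ℝ → LizorkinDist n) (J : ℤ)
    (ε : {ε : Fin n → Fin 2 // ε ≠ 0}) (j : ℤ) (k : Fin n → ℤ) : ℝ≥0∞ :=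
  ∫⁻ t in Set.Ioc (0 : ℝ) ((2 : ℝ) ^ (-(2 * J * β))),
    levelWeight β q γ m m' j (timeLevel β t) * ENNReal.ofReal t⁻¹ *
      ‖waveletCoeff Ψ a ε j k t‖ₑ ^ q

/-- The array is restricted to `J < j` because norm II leaves out the level of the big cube itself.
-/
theorem exists_localNorm_pointwiseArray_le [NeZero n] (hp : 0 < p) (hq : 0 < q) (hβ : 0 < β) :
    ∃ C : ℝ≥0∞, C ≠ ⊤ ∧ ∀ (a : ℝ → LizorkinDist n) (J : ℤ) (K : Fin n → ℤ) (t : ℝ), 0 < t →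
      localNorm p q γ₂ J K (fun ε j k =>
        if J < j then pointwiseArray Ψ q (γ₁ + n / 2) m β a t ε j k else 0) ≤
      C * (tentNormI Ψ p q γ₁ γ₂ m β a + tentNormII Ψ p q γ₁ γ₂ β a) := by
  obtain ⟨C, hC, hadd⟩ := exists_localNorm_add_le (n := n) hp hq γ₂
  refine ⟨C, hC, fun a J K t ht => ?_⟩
  classical
  set cI : {ε : Fin n → Fin 2 // ε ≠ 0} → ℤ → (Fin n → ℤ) → ℝ≥0∞ := fun ε j k =>
    if max (J : ℝ) (-(Real.logb 2 t / (2 * β))) ≤ j then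
      ENNReal.ofReal ((2 : ℝ) ^ (q * j * (γ₁ + n / 2 + 2 * m * β))) *
        ‖waveletCoeff Ψ a ε j k t‖ₑ ^ q
    else 0 with hcI
  set cII : {ε : Fin n → Fin 2 // ε ≠ 0} → ℤ → (Fin n → ℤ) → ℝ≥0∞ := fun ε j k =>
    if J < j ∧ (j : ℝ) < -(Real.logb 2 t / (2 * β)) then
      ENNReal.ofReal ((2 : ℝ) ^ (q * j * (γ₁ + n / 2))) * ‖waveletCoeff Ψ a ε j k t‖ₑ ^ q
    else 0 with hcII
  have h1 : ENNReal.ofReal (t ^ m) * localNorm p q γ₂ J K cI ≤ tentNormI Ψ p q γ₁ γ₂ m β a := by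
    unfold tentNormI
    refine le_iSup_of_le J (le_iSup_of_le K (le_iSup_of_le t (le_iSup_of_le ht (le_of_eq ?_))))
    congr! 6
  have h2 : localNorm p q γ₂ J K cII ≤ tentNormII Ψ p q γ₁ γ₂ β a := by
    unfold tentNormII
    refine le_iSup_of_le J (le_iSup_of_le K (le_iSup_of_le t (le_iSup_of_le ht (le_of_eq ?_))))
    congr! 6
  refine le_trans ?_ (mul_le_mul_right (add_le_add h1 h2) C)
  rw [← localNorm_rpow_mul hp hq]
  refine le_trans (localNorm_mono hp hq γ₂ K fun ε j k _ => ?_) (hadd J K _ _)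
  split_ifs with hj
  · rcases le_or_gt (timeLevel β t) j with h | h
    · refine le_add_right (le_of_eq ?_)
      have : max (J : ℝ) (-(Real.logb 2 t / (2 * β))) ≤ j := max_le (by exact_mod_cast hj.le) h
      rw [pointwiseArray, levelWeight_of_timeLevel_le hβ ht hq.le _ _ _ h]
      simp only [hcI, if_pos this]
      ring
    · refine le_add_left (le_of_eq ?_)
      have : J < j ∧ (j : ℝ) < -(Real.logb 2 t / (2 * β)) := ⟨hj, h⟩
      rw [pointwiseArray, levelWeight_of_le_timeLevel hβ ht hq.le _ _ _ h.le]
      simp only [hcII, if_pos this]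
      simp
  · exact zero_le

theorem tentNormI_le_of_pointwiseArray [NeZero n] (hp : 0 < p) (hq : 0 < q) (hβ : 0 < β)
    {b : ℝ → LizorkinDist n} {X : ℝ≥0∞}
    (hX : ∀ (J : ℤ) (K : Fin n → ℤ) (t : ℝ), 0 < t →
      localNorm p q γ₂ J K (pointwiseArray Ψ q (γ₁ + n / 2) m β b t) ≤ X) :
    tentNormI Ψ p q γ₁ γ₂ m β b ≤ X := by
  unfold tentNormI
  refine iSup_le fun J => iSup_le fun K => iSup_le fun t => iSup_le fun ht => ?_
  rw [← localNorm_rpow_mul hp hq]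
  refine le_trans (localNorm_mono hp hq γ₂ K fun ε j k _ => ?_) (hX J K t ht)
  split_ifs with h
  · rw [pointwiseArray, levelWeight_of_timeLevel_le hβ ht hq.le _ _ _ ((le_max_right _ _).trans h)]
    exact (mul_assoc _ _ _).ge
  · simp

theorem tentNormII_le_of_pointwiseArray [NeZero n] (hp : 0 < p) (hq : 0 < q) (hβ : 0 < β)
    {b : ℝ → LizorkinDist n} {X : ℝ≥0∞}
    (hX : ∀ (J : ℤ) (K : Fin n → ℤ) (t : ℝ), 0 < t →
      localNorm p q γ₂ J K (pointwiseArray Ψ q (γ₁ + n / 2) m β b t) ≤ X) :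
    tentNormII Ψ p q γ₁ γ₂ β b ≤ X := by
  unfold tentNormII
  refine iSup_le fun J => iSup_le fun K => iSup_le fun t => iSup_le fun ht => ?_
  refine le_trans (localNorm_mono hp hq γ₂ K fun ε j k _ => ?_) (hX J K t ht)
  split_ifs with h
  · rw [pointwiseArray, levelWeight_of_le_timeLevel hβ ht hq.le _ _ _ h.2.le]
    simp
  · exact zero_le

theorem integralArray_integrand_eq (hq : 0 ≤ q) {γ μ t : ℝ} (ht : 0 < t) {j : ℤ} {w z : ℝ≥0∞}
    (hw : w = ENNReal.ofReal (t ^ μ) ^ q *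
      ENNReal.ofReal ((2 : ℝ) ^ (q * j * (γ + 2 * μ * β)))) :
    ENNReal.ofReal ((2 : ℝ) ^ (q * j * (γ + 2 * μ * β))) *
      (z * ENNReal.ofReal (t ^ (q * μ) / t)) = w * ENNReal.ofReal t⁻¹ * z := by
  rw [ofReal_rpow_div ht hq, hw]
  ring

/-- The time interval is split at `2^{-2jβ}`: the upper piece is the integral of norm III, and the
lower piece is contained in that of norm IV. -/
theorem exists_localNorm_integralArray_le [NeZero n] (hp : 0 < p) (hq : 0 < q) (hβ : 0 < β) :
    ∃ C : ℝ≥0∞, C ≠ ⊤ ∧ ∀ (a : ℝ → LizorkinDist n) (J : ℤ) (K : Fin n → ℤ),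
      localNorm p q γ₂ J K (integralArray Ψ q (γ₁ + n / 2) m m' β a J) ≤
      C * (tentNormIII Ψ p q γ₁ γ₂ m β a + tentNormIV Ψ p q γ₁ γ₂ m' β a) := by
  obtain ⟨C, hC, hadd⟩ := exists_localNorm_add_le (n := n) hp hq γ₂
  refine ⟨C, hC, fun a J K => ?_⟩
  refine le_trans ?_ (mul_le_mul_right (add_le_add
    (le_iSup_of_le J (le_iSup_of_le K le_rfl)) (le_iSup_of_le J (le_iSup_of_le K le_rfl))) C)
  refine le_trans (localNorm_mono hp hq γ₂ K fun ε j k _ => ?_) (hadd J K _ _)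
  have hpos : ∀ i : ℤ, (0 : ℝ) < (2 : ℝ) ^ (-(2 * i * β)) := fun i => by positivity
  unfold integralArray
  rw [← lintegral_const_mul' _ _ ENNReal.ofReal_ne_top,
    ← lintegral_const_mul' _ _ ENNReal.ofReal_ne_top]
  have hsub : Set.Ioc (0 : ℝ) ((2 : ℝ) ^ (-(2 * J * β))) ⊆
      Set.Ioc ((2 : ℝ) ^ (-(2 * j * β))) ((2 : ℝ) ^ (-(2 * J * β))) ∪
        Set.Ioc (0 : ℝ) ((2 : ℝ) ^ (-(2 * j * β))) := fun t ht => by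
    rcases le_or_gt t ((2 : ℝ) ^ (-(2 * j * β))) with h | h
    · exact Or.inr ⟨ht.1, h⟩
    · exact Or.inl ⟨h, ht.2⟩
  refine (lintegral_mono_set hsub).trans ((lintegral_union_le _ _ _).trans (add_le_add ?_ ?_))
  · refine setLIntegral_mono' measurableSet_Ioc fun t ht => le_of_eq ?_
    have ht0 : 0 < t := (hpos j).trans ht.1
    have hσ : timeLevel β t ≤ j := by
      by_contra h
      exact absurd ((le_timeLevel_iff hβ ht0 j).1 (not_le.1 h).le) (not_le.2 ht.1)
    exact (integralArray_integrand_eq hq.le ht0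
      (levelWeight_of_timeLevel_le hβ ht0 hq.le _ _ _ hσ)).symm
  · refine setLIntegral_mono' measurableSet_Ioc fun t ht => le_of_eq ?_
    exact (integralArray_integrand_eq hq.le ht.1 (levelWeight_of_le_timeLevel hβ ht.1 hq.le _ _ _
      ((le_timeLevel_iff hβ ht.1 j).2 ht.2))).symm

theorem tentNormIII_le_of_integralArray [NeZero n] (hp : 0 < p) (hq : 0 < q) (hβ : 0 < β)
    {b : ℝ → LizorkinDist n} {X : ℝ≥0∞}
    (hX : ∀ (J : ℤ) (K : Fin n → ℤ),
      localNorm p q γ₂ J K (integralArray Ψ q (γ₁ + n / 2) m m' β b J) ≤ X) :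
    tentNormIII Ψ p q γ₁ γ₂ m β b ≤ X := by
  unfold tentNormIII
  refine iSup_le fun J => iSup_le fun K => ?_
  refine le_trans (localNorm_mono hp hq γ₂ K fun ε j k _ => ?_) (hX J K)
  have hpos : (0 : ℝ) < (2 : ℝ) ^ (-(2 * j * β)) := by positivity
  unfold integralArray
  rw [← lintegral_const_mul' _ _ ENNReal.ofReal_ne_top]
  refine le_trans (setLIntegral_mono' measurableSet_Ioc fun t ht => le_of_eq ?_)
    (lintegral_mono_set (Set.Ioc_subset_Ioc_left hpos.le))
  have ht0 : 0 < t := hpos.trans ht.1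
  have hσ : timeLevel β t ≤ j := by
    by_contra h
    exact absurd ((le_timeLevel_iff hβ ht0 j).1 (not_le.1 h).le) (not_le.2 ht.1)
  exact integralArray_integrand_eq hq.le ht0 (levelWeight_of_timeLevel_le hβ ht0 hq.le _ _ _ hσ)

/-- The cubes that enter have `j ≥ J`, hence `2^{-2jβ} ≤ 2^{-2Jβ}`, and the integral of norm IV is
part of the full one. -/
theorem tentNormIV_le_of_integralArray [NeZero n] (hp : 0 < p) (hq : 0 < q) (hβ : 0 < β)
    {b : ℝ → LizorkinDist n} {X : ℝ≥0∞}
    (hX : ∀ (J : ℤ) (K : Fin n → ℤ),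
      localNorm p q γ₂ J K (integralArray Ψ q (γ₁ + n / 2) m m' β b J) ≤ X) :
    tentNormIV Ψ p q γ₁ γ₂ m' β b ≤ X := by
  unfold tentNormIV
  refine iSup_le fun J => iSup_le fun K => ?_
  refine le_trans (localNorm_mono hp hq γ₂ K fun ε j k hj => ?_) (hX J K)
  have hjr : (J : ℝ) ≤ j := by exact_mod_cast hj
  unfold integralArray
  rw [← lintegral_const_mul' _ _ ENNReal.ofReal_ne_top]
  refine le_trans (setLIntegral_mono' measurableSet_Ioc fun t ht => le_of_eq ?_)
    (lintegral_mono_set (Set.Ioc_subset_Ioc_right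
      (Real.rpow_le_rpow_of_exponent_le one_le_two (by nlinarith))))
  exact integralArray_integrand_eq hq.le ht.1 (levelWeight_of_le_timeLevel hβ ht.1 hq.le _ _ _
    ((le_timeLevel_iff hβ ht.1 j).2 ht.2))

end RieszBound

/-! ### Boundedness of the Riesz transforms. -/

section RieszBoundedness

open MeasureTheory

variable {n : ℕ} (Ψ : MeyerProfile) {p q m m' β : ℝ} (γ₁ γ₂ : ℝ)

theorem waveletCoeff_riesz (l : Fin n) (a : ℝ → LizorkinDist n)
    (ε : {ε : Fin n → Fin 2 // ε ≠ 0}) (j : ℤ) (k : Fin n → ℤ) (t : ℝ) :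
    waveletCoeff Ψ (fun t => riesz l (a t)) ε j k t = -a t (rieszTest l (Ψ.wavelet ε j k)) :=
  rfl

/-- The wavelet coefficients of `R_l a`, with level weights, are controlled by those of `a` through
an almost diagonal matrix. -/
theorem exists_levelWeight_mul_riesz_le (hq : 1 ≤ q) (hβ : 0 ≤ β) (hm : 0 ≤ m) (hm' : 0 ≤ m')
    (γ : ℝ) (N : ℕ) : ∃ C : ℝ≥0∞, C ≠ ⊤ ∧ ∀ (l : Fin n) (a : ℝ → LizorkinDist n)
      (ε : {ε : Fin n → Fin 2 // ε ≠ 0}) (e : Fin n → Fin 2) (j : ℤ) (k₁ : Fin n → ℤ) (t : ℝ),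
      levelWeight β q γ m m' j (timeLevel β t) *
          ‖waveletCoeff Ψ (fun t => riesz l (a t)) ε j (parityIndex e k₁) t‖ₑ ^ q ≤
        C * ∑' τ : OffDiagonal n, (latticeWeight τ.2.2)⁻¹ ^ N *
          (levelWeight β q γ m m' (j - 1 + (τ.2.1 : ℕ)) (timeLevel β t) *
            ‖waveletCoeff Ψ a τ.1 (j - 1 + (τ.2.1 : ℕ)) (fineIndex τ.2.1 τ.2.2 k₁) t‖ₑ ^ q) := by
  have hq0 : 0 ≤ q := by linarith
  obtain ⟨C, hC, h⟩ := Ψ.exists_enorm_rieszTest_rpow_le (n := n) hq N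
  set D : ℝ≥0∞ := ENNReal.ofReal ((2 : ℝ) ^ (q * |γ| + 2 * β * q * (m + m')))
  refine ⟨C * D, ENNReal.mul_ne_top hC ENNReal.ofReal_ne_top, fun l a ε e j k₁ t => ?_⟩
  rw [waveletCoeff_riesz, enorm_neg]
  refine (mul_le_mul_right (h l ε e (a t) j k₁) _).trans ?_
  rw [mul_left_comm, mul_assoc]
  refine mul_le_mul_right ?_ C
  rw [← ENNReal.tsum_mul_left, ← ENNReal.tsum_mul_left]
  refine ENNReal.tsum_le_tsum fun τ => ?_
  have hτ : |j - (j - 1 + ((τ.2.1 : ℕ) : ℤ))| ≤ 1 := by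
    have := τ.2.1.isLt
    rw [abs_le]
    constructor <;> omega
  refine (mul_le_mul_left (levelWeight_le hβ hq0 hm hm' γ hτ (timeLevel β t)) _).trans
    (le_of_eq ?_)
  simp only [waveletCoeff]
  ring

theorem exists_localNorm_pointwiseArray_riesz_le [NeZero n] (hp : 0 < p) (hq : 1 ≤ q) (hβ : 0 < β)
    (hm : 0 ≤ m) : ∃ C : ℝ≥0∞, C ≠ ⊤ ∧ ∀ (l : Fin n) (a : ℝ → LizorkinDist n) (J : ℤ)
      (K : Fin n → ℤ) (t : ℝ), 0 < t →
      localNorm p q γ₂ J K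
        (pointwiseArray Ψ q (γ₁ + n / 2) m β (fun t => riesz l (a t)) t) ≤
      C * (tentNormI Ψ p q γ₁ γ₂ m β a + tentNormII Ψ p q γ₁ γ₂ β a) := by
  have hq0 : 0 < q := by linarith
  obtain ⟨N, hN⟩ := localNorm_le_of_almostDiagonal (n := n) hp hq0 γ₂
  obtain ⟨C₁, hC₁, h₁⟩ := exists_levelWeight_mul_riesz_le (n := n) Ψ hq hβ.le hm le_rfl
    (γ₁ + n / 2) N
  obtain ⟨C₂, hC₂, h₂⟩ := hN C₁ hC₁
  obtain ⟨C₃, hC₃, h₃⟩ := exists_localNorm_pointwiseArray_le (n := n) Ψ (m := m) γ₁ γ₂ hp hq0 hβ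
  refine ⟨C₂ * C₃, ENNReal.mul_ne_top hC₂ hC₃, fun l a J K t ht => ?_⟩
  rw [mul_assoc]
  refine h₂ J K _ _ _ (fun ε j hj e k₁ => ?_) fun w => h₃ a (J - 2) w t ht
  refine (h₁ l a ε e j k₁ t).trans (le_of_eq ?_)
  congr 1
  refine tsum_congr fun τ => ?_
  -- Source levels are at least `J - 1`, so the strict restriction to levels above `J - 2` removes
  -- nothing.
  rw [if_pos (by omega)]
  rfl

/-- The pointwise almost diagonal bound is integrated in `t`. Weak measurability of `a` enters
through the exchange of the integral with the sum over off-diagonals. -/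
theorem exists_localNorm_integralArray_riesz_le [NeZero n] (hp : 0 < p) (hq : 1 ≤ q) (hβ : 0 < β)
    (hm : 0 ≤ m) (hm' : 0 ≤ m') : ∃ C : ℝ≥0∞, C ≠ ⊤ ∧ ∀ (l : Fin n) (a : ℝ → LizorkinDist n)
      (_ : ∀ φ : lizorkin n, Measurable fun t : Set.Ioi (0 : ℝ) => a t φ) (J : ℤ)
      (K : Fin n → ℤ), localNorm p q γ₂ J K
        (integralArray Ψ q (γ₁ + n / 2) m m' β (fun t => riesz l (a t)) J) ≤
      C * (tentNormIII Ψ p q γ₁ γ₂ m β a + tentNormIV Ψ p q γ₁ γ₂ m' β a) := by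
  have hq0 : 0 < q := by linarith
  obtain ⟨N, hN⟩ := localNorm_le_of_almostDiagonal (n := n) hp hq0 γ₂
  obtain ⟨C₁, hC₁, h₁⟩ := exists_levelWeight_mul_riesz_le (n := n) Ψ hq hβ.le hm hm'
    (γ₁ + n / 2) N
  obtain ⟨C₂, hC₂, h₂⟩ := hN C₁ hC₁
  obtain ⟨C₃, hC₃, h₃⟩ := exists_localNorm_integralArray_le (n := n) Ψ (m := m) (m' := m') γ₁ γ₂
    hp hq0 hβ
  refine ⟨C₂ * C₃, ENNReal.mul_ne_top hC₂ hC₃, fun l a ha J K => ?_⟩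
  rw [mul_assoc]
  refine h₂ J K _ _ _ (fun ε j hj e k₁ => ?_) fun w => h₃ a (J - 2) w
  have hmeas : ∀ φ : lizorkin n, AEMeasurable (fun t => a t φ)
      (volume.restrict (Set.Ioc (0 : ℝ) ((2 : ℝ) ^ (-(2 * J * β))))) := fun φ =>
    (aemeasurable_restrict_of_measurable_subtype measurableSet_Ioi (ha φ)).mono_measure
      (Measure.restrict_mono Set.Ioc_subset_Ioi_self le_rfl)
  have hlevel : Measurable fun t => timeLevel β t := by
    unfold timeLevel
    unfold Real.logb
    fun_prop
  have hweight : ∀ i : ℤ, Measurable fun t => levelWeight β q (γ₁ + n / 2) m m' i (timeLevel β t) := by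
    intro i
    unfold levelWeight levelExponent
    fun_prop
  set F : OffDiagonal n → ℝ → ℝ≥0∞ := fun τ t =>
    levelWeight β q (γ₁ + n / 2) m m' (j - 1 + (τ.2.1 : ℕ)) (timeLevel β t) *
      ENNReal.ofReal t⁻¹ *
      ‖waveletCoeff Ψ a τ.1 (j - 1 + (τ.2.1 : ℕ)) (fineIndex τ.2.1 τ.2.2 k₁) t‖ₑ ^ q with hF
  have hFm : ∀ τ, AEMeasurable (F τ)
      (volume.restrict (Set.Ioc (0 : ℝ) ((2 : ℝ) ^ (-(2 * J * β))))) := fun τ =>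
    (((hweight _).mul measurable_inv.ennreal_ofReal).aemeasurable).mul
      ((hmeas _).enorm.pow_const q)
  calc integralArray Ψ q (γ₁ + n / 2) m m' β (fun t => riesz l (a t)) J ε j (parityIndex e k₁)
      ≤ ∫⁻ t in Set.Ioc (0 : ℝ) ((2 : ℝ) ^ (-(2 * J * β))),
          C₁ * ∑' τ : OffDiagonal n, (latticeWeight τ.2.2)⁻¹ ^ N * F τ t := by
        refine lintegral_mono fun t => ?_
        dsimp only
        rw [mul_right_comm]
        refine (mul_le_mul_left (h₁ l a ε e j k₁ t) _).trans (le_of_eq ?_)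
        rw [mul_assoc, ← ENNReal.tsum_mul_right]
        congr 1
        refine tsum_congr fun τ => ?_
        simp only [hF]
        ring
    _ = C₁ * ∑' τ : OffDiagonal n, (latticeWeight τ.2.2)⁻¹ ^ N *
          ∫⁻ t in Set.Ioc (0 : ℝ) ((2 : ℝ) ^ (-(2 * J * β))), F τ t := by
        rw [lintegral_const_mul' _ _ hC₁, lintegral_tsum fun τ => (hFm τ).const_mul _]
        congr 1
        refine tsum_congr fun τ => ?_
        exact lintegral_const_mul' _ _
          (ENNReal.pow_ne_top (ENNReal.inv_ne_top.2 (zero_lt_one.trans_le (one_le_latticeWeight _)).ne'))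
    _ ≤ _ := by
        gcongr with τ
        -- The source array belongs to a cube of level `J - 2`, whose time interval is longer.
        refine lintegral_mono_set (Set.Ioc_subset_Ioc_right
          (Real.rpow_le_rpow_of_exponent_le one_le_two ?_))
        push_cast
        nlinarith

end RieszBoundedness

theorem theorem4p2 (n : ℕ) (Ψ : MeyerProfile) (p q γ₁ γ₂ m m' β : ℝ) (hp : 1 < p) (hq : 1 < q)
    (hm : p < m) (hm' : 0 < m') (hβ : 0 < β) :
    ∃ C : ℝ≥0, ∀ l : Fin n, ∀ a ∈ tentSpace (n := n) Ψ p q γ₁ γ₂ m m' β,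
      (fun t => riesz l (a t)) ∈ tentSpace (n := n) Ψ p q γ₁ γ₂ m m' β ∧
        tentNorm Ψ p q γ₁ γ₂ m m' β (fun t => riesz l (a t)) ≤
          C * tentNorm Ψ p q γ₁ γ₂ m m' β a := by
  rcases Nat.eq_zero_or_pos n with rfl | hn
  · exact ⟨0, fun l => l.elim0⟩
  have : NeZero n := ⟨hn.ne'⟩
  have hp0 : 0 < p := by linarith
  have hq0 : 0 < q := by linarith
  have hm0 : 0 ≤ m := by linarith
  obtain ⟨C₁, hC₁, h₁⟩ := exists_localNorm_pointwiseArray_riesz_le (n := n) Ψ γ₁ γ₂ hp0 hq.le hβ hm0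
  obtain ⟨C₂, hC₂, h₂⟩ := exists_localNorm_integralArray_riesz_le (n := n) Ψ γ₁ γ₂ hp0 hq.le hβ hm0
    hm'.le
  -- Norms I and II share the bound with `C₁`, and norms III and IV the one with `C₂`, so each is
  -- counted twice.
  have hCt : 2 * C₁ + 2 * C₂ ≠ ⊤ := ENNReal.add_ne_top.2
    ⟨ENNReal.mul_ne_top ENNReal.ofNat_ne_top hC₁, ENNReal.mul_ne_top ENNReal.ofNat_ne_top hC₂⟩
  obtain ⟨C, hC⟩ := WithTop.ne_top_iff_exists.1 hCt
  change (C : ℝ≥0∞) = _ at hC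
  refine ⟨C, fun l a ha => ?_⟩
  have hle : tentNorm Ψ p q γ₁ γ₂ m m' β (fun t => riesz l (a t)) ≤
      C * tentNorm Ψ p q γ₁ γ₂ m m' β a := by
    have hI := tentNormI_le_of_pointwiseArray Ψ γ₁ γ₂ hp0 hq0 hβ (h₁ l a)
    have hII := tentNormII_le_of_pointwiseArray Ψ γ₁ γ₂ hp0 hq0 hβ (h₁ l a)
    have hIII := tentNormIII_le_of_integralArray Ψ γ₁ γ₂ hp0 hq0 hβ (h₂ l a ha.1)
    have hIV := tentNormIV_le_of_integralArray Ψ γ₁ γ₂ hp0 hq0 hβ (h₂ l a ha.1)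
    rw [hC]
    unfold tentNorm
    refine (add_le_add (add_le_add (add_le_add hI hII) hIII) hIV).trans ?_
    set A := tentNormI Ψ p q γ₁ γ₂ m β a + tentNormII Ψ p q γ₁ γ₂ β a
    set B := tentNormIII Ψ p q γ₁ γ₂ m β a + tentNormIV Ψ p q γ₁ γ₂ m' β a
    rw [add_assoc A]
    calc C₁ * A + C₁ * A + C₂ * B + C₂ * B = (2 * C₁) * A + (2 * C₂) * B := by ring
      _ ≤ (2 * C₁ + 2 * C₂) * A + (2 * C₁ + 2 * C₂) * B := by
        gcongr
        · exact le_self_add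
        · exact le_add_self
      _ = _ := (mul_add _ _ _).symm
  refine ⟨⟨fun φ => ?_, hle.trans_lt (ENNReal.mul_lt_top ENNReal.coe_lt_top ha.2)⟩, hle⟩
  exact (ha.1 (rieszTest l φ)).neg
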